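/- **Setting.** For each sample size $n$ let $(\mathbf X,Y)$ be a random element of $\mathbb R^{p_n}\times\mathbb R$ (its law may depend on $n$), and let $(\mathbf X_i,Y_i)$, $i=1,\dots,n$, be independent copies of it. All constants in the assumptions below ($K_1,K_2,M,\rho$ and the bounds in the definition of the loss and in G, H1–H3) are independent of $n$. Let $l(\omega,y)$ be a measurable loss, convex in $\omega$, with $E|l(\omega,Y)|<\infty$ for every $\omega\in\mathbb R$, and let $l'(\omega,y)$ be a measurable generalized derivative, i.e. $l(x_1,y)-l(x_2,y)=\int_{x_2}^{x_1}l'(s,y)\,ds$ for all $x_1>x_2$ and all $y$. The loss is *conditional strictly convex*: almost surely $\omega\mapsto E[l(\omega,Y)\mid\mathbf X]$ is twice continuously differentiable, and for every $R$ there is $c>0$ (independent of $\mathbf X$ and $n$) with $\partial^2E[l(\omega,Y)\mid\mathbf X]/\partial\omega^2\ge c$ for all $|\omega|\le R$. Every covariate $X_j$, $1\le j\le p_n$, has a density on $[a,b]$, $a<b$, with values in $[K_1,K_2]$, $0<K_1\le K_2<\infty$ (B). Fix a degree $q\ge1$. For each $n$ let $\Psi_1,\dots,\Psi_{d_n}$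 ($d_n>q$) be the normalized B-spline basis of degree $q$ (each end point of $[a,b]$ being a knot of multiplicity $q+1$) on a partition of $[a,b]$ into $d_n-q$ intervals whose lengths have pairwise ratios at most $\rho$. Put $\mathbf\Psi_j=(\Psi_1(X_j),\dots,\Psi_{d_n}(X_j))^T$, let $\mathbf\Psi_{ij}$ be the same vector for the observation $\mathbf X_i$, and let $$\beta_j^M=\operatorname{argmin}_{\beta\in\mathbb R^{d_n}}E\,l(\mathbf\Psi_j^T\beta,Y),\qquad \widehat\beta_j^M=\operatorname{argmin}_{\beta\in\mathbb R^{d_n}}\frac1n\sum_{i=1}^n l(\mathbf\Psi_{ij}^T\beta,Y_i),$$ where $\widehat\beta_j^M$ is any minimizer if there is one, and arbitrary otherwise. Let $0<\kappa<1/2$. **Conditions.** (C) There is $\theta(\mathbf X)$ which minimizes $\omega\mapsto E[l(\omega,Y)\mid\mathbf X]$ and satisfies $|\theta(\mathbf X)|\le M$ almost surely. (F) $d_n=o(n^{1/3})$ and $d_n=O(n^{2\kappa})$. (G) $E[l'(\omega,Y)\mid\mathbf X]$ exists and is bounded, uniformly over $|\omega|\le R$, for every $R$. (H1) For every $R$,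 $l'(\omega,Y)$ is almost surely bounded, uniformly over $|\omega|\le R$. (H2) For every $R$ there is $\sigma>0$ such that for $|\omega|\le R$, almost surely, $E[\exp(\lambda(l'(\omega,Y)-E[l'(\omega,Y)\mid\mathbf X]))\mid\mathbf X]\le\exp(\lambda^2\sigma^2/2)$ for all $\lambda\in\mathbb R$. (H3) For every $R$ there are $c_0>0$ and $C<\infty$ such that for $|\omega|\le R$, almost surely, $E[\exp(\lambda l'(\omega,Y))\mid\mathbf X]\le C$ for all $|\lambda|\le c_0$. **Theorem.** Assume C, F and G. For every constant $c_3>0$ there are positive constants $c_4$ and $c_5$ such that for all sufficiently large $n$ and all $j=1,\dots,p_n$: * if H1 holds and $d_n=o(n^{1-2\kappa})$, then $$P\big(\|\widehat\beta_j^M-\beta_j^M\|^2\ge c_3d_nn^{-2\kappa}\big)\le\exp(-c_4n^{1-2\kappa}d_n^{-1});$$ * if H2 holds and $d_n=o(n^{(1-2\kappa)/2})$, then $$P\big(\|\widehat\beta_j^M-\beta_j^M\|^2\ge c_3d_nn^{-2\kappa}\big)\le\exp(-c_4n^{1-2\kappa}d_n^{-1})+\exp(-c_5n^{1-2\kappa}d_n^{-2});$$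 * if H3 holds and $d_n=o(n^{(1-2\kappa)/3})$, then $$P\big(\|\widehat\beta_j^M-\beta_j^M\|^2\ge c_3d_nn^{-2\kappa}\big)\le\exp(-c_4n^{1-2\kappa}d_n^{-1})+2\exp(-c_5n^{1/2-\kappa}d_n^{-3/2}).$$ Here $P$ is read as outer probability if $\widehat\beta_j^M$ is not measurable. -/

import Mathlib

open MeasureTheory ProbabilityTheory Filter Asymptotics

namespace Screening

noncomputable section

/-! ### B-splines on an interval -/

/-- Knot number `i` of the clamped knot sequence of degree `q` with breakpoints
`ξ 0 < ξ 1 < ... < ξ N`: each of the two end points is repeated `q + 1` times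
(truncated subtraction gives `ξ 0` for `i ≤ q`, the minimum gives `ξ N` for `N + q ≤ i`). -/
def knot (q N : ℕ) (ξ : ℕ → ℝ) (i : ℕ) : ℝ := ξ (min (i - q) N)

open Classical in
/-- Normalized B-splines by the Cox - de Boor recursion, for a knot sequence `τ` ending at `b`.
A quotient with denominator `0` is `0`, which is the usual convention for repeated knots.
The last nonempty knot interval is closed, so that the basis is defined up to `b`. -/
def bsplineRec (τ : ℕ → ℝ) (b : ℝ) : ℕ → ℕ → ℝ → ℝ
  | 0, i, x =>
      if (τ i ≤ x ∧ x < τ (i + 1)) ∨ (x = b ∧ τ i < b ∧ τ (i + 1) = b) then 1 else 0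
  | m + 1, i, x =>
      (x - τ i) / (τ (i + m + 1) - τ i) * bsplineRec τ b m i x +
        (τ (i + m + 2) - x) / (τ (i + m + 2) - τ (i + 1)) * bsplineRec τ b m (i + 1) x

/-- The `k`-th of the `d` normalized B-splines of degree `q` with breakpoints
`ξ 0 < ... < ξ (d - q)`. -/
def bspline (q d : ℕ) (ξ : ℕ → ℝ) (k : ℕ) (x : ℝ) : ℝ :=
  bsplineRec (knot q (d - q) ξ) (ξ (d - q)) q k x

/-- The spline with coefficient vector `β`. -/
def splineFun (q d : ℕ) (ξ : ℕ → ℝ) (β : EuclideanSpace ℝ (Fin d)) (x : ℝ) : ℝ :=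
  ∑ k : Fin d, bspline q d ξ k x * β k

/-- `ξ 0 < ... < ξ N` is a partition of `[a, b]` with mesh ratio at most `ρ`. -/
structure IsQuasiUniformMesh (a b ρ : ℝ) (N : ℕ) (ξ : ℕ → ℝ) : Prop where
  left : ξ 0 = a
  right : ξ N = b
  lt_succ : ∀ i < N, ξ i < ξ (i + 1)
  ratio : ∀ i < N, ∀ k < N, ξ (i + 1) - ξ i ≤ ρ * (ξ (k + 1) - ξ k)

/-! ### Population and empirical risk of the marginal regression -/

/-- `E[l(f(X_j), Y)]` for the spline `f` with coefficients `β`; `μ` is the law of `(X, Y)`. -/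
def popRisk {p : ℕ} (l : ℝ → ℝ → ℝ) (μ : Measure ((Fin p → ℝ) × ℝ)) (q d : ℕ) (ξ : ℕ → ℝ)
    (j : Fin p) (β : EuclideanSpace ℝ (Fin d)) : ℝ :=
  ∫ z, l (splineFun q d ξ β (z.1 j)) z.2 ∂μ

/-- `n⁻¹ ∑ i, l(f(X_{ij}), Y_i)` for the spline `f` with coefficients `β`. -/
def empRisk {p n : ℕ} (l : ℝ → ℝ → ℝ) (z : Fin n → (Fin p → ℝ) × ℝ) (q d : ℕ) (ξ : ℕ → ℝ)
    (j : Fin p) (β : EuclideanSpace ℝ (Fin d)) : ℝ :=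
  (n : ℝ)⁻¹ * ∑ i : Fin n, l (splineFun q d ξ β ((z i).1 j)) (z i).2

/-! ### The loss -/

/-- `E[g(Y) | X = x]`, through the regular conditional law of `Y` given `X`. -/
def condMean {p : ℕ} (μ : Measure ((Fin p → ℝ) × ℝ)) [IsFiniteMeasure μ] (g : ℝ → ℝ)
    (x : Fin p → ℝ) : ℝ :=
  ∫ y, g y ∂(μ.condKernel x)

/-- `l'` is a generalized partial derivative of `l` in its first argument. -/
structure IsGenDeriv (l l' : ℝ → ℝ → ℝ) : Prop where
  measurable : Measurable (Function.uncurry l')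
  intervalIntegrable : ∀ y x₂ x₁, x₂ < x₁ → IntervalIntegrable (fun s => l' s y) volume x₂ x₁
  integral_eq : ∀ y x₂ x₁, x₂ < x₁ → l x₁ y - l x₂ y = ∫ s in x₂..x₁, l' s y

/-- A measurable loss, convex in the first argument. -/
structure IsConvexLoss (l : ℝ → ℝ → ℝ) : Prop where
  measurable : Measurable (Function.uncurry l)
  convex : ∀ y, ConvexOn ℝ Set.univ (fun w => l w y)

variable {p : ℕ → ℕ} (μ : ∀ n, Measure ((Fin (p n) → ℝ) × ℝ)) [∀ n, IsProbabilityMeasure (μ n)]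

/-- Conditional strictly convex loss, for the laws `μ n` of `(X, Y)`: the conditional risk
`E[l(w, Y) | X]` exists, is twice continuously differentiable in `w`, and its second derivative
is positive, with a positive lower bound on bounded sets of `w` that depends neither on the value
of `X` nor on `n`. -/
structure IsCondStrictlyConvex (l : ℝ → ℝ → ℝ) : Prop where
  integrable : ∀ n w, Integrable (fun z : (Fin (p n) → ℝ) × ℝ => l w z.2) (μ n)
  contDiff : ∀ n, ∀ᵐ x ∂(μ n).fst, ContDiff ℝ 2 (fun w => condMean (μ n) (l w) x)
  pos : ∀ R : ℝ, ∃ c : ℝ, 0 < c ∧ ∀ n, ∀ᵐ x ∂(μ n).fst, ∀ w : ℝ, |w| ≤ R →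
    c ≤ deriv (deriv (fun v => condMean (μ n) (l v) x)) w

/-! ### Regularity conditions -/

/-- Every covariate has support `[a, b]` and a density there with values in `[K₁, K₂]`. -/
def CondB (a b K₁ K₂ : ℝ) : Prop :=
  ∀ n (j : Fin (p n)), ∃ g : ℝ → ℝ, Measurable g ∧ (∀ x ∈ Set.Icc a b, K₁ ≤ g x ∧ g x ≤ K₂) ∧
    (μ n).map (fun z => z.1 j) =
      (volume.restrict (Set.Icc a b)).withDensity (fun x => ENNReal.ofReal (g x))

/-- The true functions `θ n`, minimizers of the conditional risk, are bounded by `M`. -/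
def CondC (l : ℝ → ℝ → ℝ) (θ : ∀ n, (Fin (p n) → ℝ) → ℝ) (M : ℝ) : Prop :=
  ∀ n, ∀ᵐ x ∂(μ n).fst,
    IsMinOn (fun w => condMean (μ n) (l w) x) Set.univ (θ n x) ∧ |θ n x| ≤ M

/-- `d n = o(n ^ (1/3))` and `d n = O(n ^ (2κ))`. -/
def CondF (d : ℕ → ℕ) (κ : ℝ) : Prop :=
  (fun n : ℕ => (d n : ℝ)) =o[atTop] (fun n : ℕ => (n : ℝ) ^ (1 / 3 : ℝ)) ∧
    (fun n : ℕ => (d n : ℝ)) =O[atTop] (fun n : ℕ => (n : ℝ) ^ (2 * κ))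

/-- `E[l'(w, Y) | X]` exists and is bounded for bounded `w`. -/
def CondG (l' : ℝ → ℝ → ℝ) : Prop :=
  ∀ R : ℝ, ∃ B : ℝ, ∀ n, ∀ w : ℝ, |w| ≤ R → ∀ᵐ x ∂(μ n).fst,
    Integrable (l' w) ((μ n).condKernel x) ∧ |condMean (μ n) (l' w) x| ≤ B

/-- `l'(w, Y)` is bounded for bounded `w`. -/
def CondH1 (l' : ℝ → ℝ → ℝ) : Prop :=
  ∀ R : ℝ, ∃ B : ℝ, ∀ n, ∀ w : ℝ, |w| ≤ R → ∀ᵐ z ∂(μ n), |l' w z.2| ≤ B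

/-- For bounded `w`, `l'(w, Y)` is `σ`-subgaussian conditionally on `X`, where `σ` does not
depend on `X`. -/
def CondH2 (l' : ℝ → ℝ → ℝ) : Prop :=
  ∀ R : ℝ, ∃ σ : ℝ, 0 < σ ∧ ∀ n, ∀ w : ℝ, |w| ≤ R → ∀ᵐ x ∂(μ n).fst, ∀ t : ℝ,
    Integrable (fun y => Real.exp (t * (l' w y - condMean (μ n) (l' w) x)))
      ((μ n).condKernel x) ∧
    condMean (μ n) (fun y => Real.exp (t * (l' w y - condMean (μ n) (l' w) x))) x
      ≤ Real.exp (t ^ 2 * σ ^ 2 / 2)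

/-- For bounded `w`, the conditional moment generating function of `l'(w, Y)` given `X` is finite
on `[-c₀, c₀]`, with a bound that does not depend on `X`. -/
def CondH3 (l' : ℝ → ℝ → ℝ) : Prop :=
  ∀ R : ℝ, ∃ c₀ : ℝ, 0 < c₀ ∧ ∃ B : ℝ, ∀ n, ∀ w : ℝ, |w| ≤ R → ∀ᵐ x ∂(μ n).fst, ∀ t : ℝ,
    |t| ≤ c₀ →
      Integrable (fun y => Real.exp (t * l' w y)) ((μ n).condKernel x) ∧
      condMean (μ n) (fun y => Real.exp (t * l' w y)) x ≤ B

/-! ### The estimators -/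

/-- For every `n`, `Z n 0, ..., Z n (n - 1)` are independent copies of `(X, Y)`. -/
def IsSample {Ω : ℕ → Type*} [∀ n, MeasurableSpace (Ω n)] (P : ∀ n, Measure (Ω n))
    (Z : ∀ n, Fin n → Ω n → (Fin (p n) → ℝ) × ℝ) : Prop :=
  ∀ n, (∀ i, Measurable (Z n i)) ∧ iIndepFun (Z n) (P n) ∧ ∀ i, (P n).map (Z n i) = μ n

/-- `P(‖β̂_j - β_j‖² ≥ r) ≤ B` for every minimizer `β_j` of the population risk and every version
`β̂_j` of the minimizer of the empirical risk.  On samples for which the empirical risk has no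
minimizer, the value of `β̂_j` is arbitrary. -/
def TailBound {p n : ℕ} {Ω : Type*} [MeasurableSpace Ω] (P : Measure Ω) (l : ℝ → ℝ → ℝ)
    (μ : Measure ((Fin p → ℝ) × ℝ)) (Z : Fin n → Ω → (Fin p → ℝ) × ℝ)
    (q d : ℕ) (ξ : ℕ → ℝ) (j : Fin p) (r B : ℝ) : Prop :=
  ∀ (β : EuclideanSpace ℝ (Fin d)) (βhat : Ω → EuclideanSpace ℝ (Fin d)),
    IsMinOn (popRisk l μ q d ξ j) Set.univ β →
    (∀ᵐ ω ∂P, (∃ b, IsMinOn (empRisk l (fun i => Z i ω) q d ξ j) Set.univ b) →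
      IsMinOn (empRisk l (fun i => Z i ω) q d ξ j) Set.univ (βhat ω)) →
    P.real {ω | r ≤ ‖βhat ω - β‖ ^ 2} ≤ B

end

end Screening

namespace Screening

/-! ### B-splines: local support, positivity, Marsden's identity -/

/-! The engine is convexity. Let `β₀` minimize the population risk and put `δ² = d r` with `r` of
order `n ^ (-2κ)`. If the empirical risk is larger on the whole sphere `‖β - β₀‖ = δ` than at `β₀`,
then it has a minimizer, and all its minimizers lie inside the sphere (`isMinOn_of_lt_on_sphere`).
On the sphere the population risk exceeds its minimum by a constant times `r`: strong convexity of
the conditional risk bounds the excess below by the squared `L²` norm of the spline with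
coefficients `β - β₀`, and the Gram matrix of the B-splines has eigenvalues of exact order `1 / d`
(`popRisk_growth`, `exists_gram_lower`). It remains to keep the centred empirical process below a
small multiple of `r` on the ball.

Strong convexity is available only on bounded sets of `ω`, so the coefficients of `β₀` must be
bounded independently of `d`; an `L²` bound would lose a factor `√d`. The argument is local
(`exists_coeff_bound`). The conditional risk grows linearly, and the B-spline basis is `L¹`-stable
on each cell by Marsden's identity. Around a large coefficient one finds a block of cells fenced by
`q` consecutive cells with moderate coefficients on each side. Setting the coefficients of the block
to zero gains an amount linear in the large coefficient and costs a bounded amount on the fences.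
Since `β₀` is a minimizer, the coefficient cannot be large.

For the empirical process, convexity bounds all increments of the loss on `[-R, R]` through the
generalized derivative at two fixed points outside the interval (`exists_slope_bounds`), so there is
a random Lipschitz constant with a conditional exponential moment. This gives a Bernstein bound
whose variance term has the small order `‖β - β'‖² / d` (`mgf_increment_le`). Dyadic chaining over
nets with `5 ^ d` points per step costs only an exponent of order `d`, negligible against `n ^ (1 -
2κ)`.

The resulting tail is `exp (-c n ^ (1 - 2κ))`, stronger than each of the three claims. H1 implies
H3, and so does H2 together with G; one argument therefore covers all cases. -/

theorem bsplineRec_eq_zero {τ : ℕ → ℝ} (hτ : Monotone τ) {b x : ℝ} (hxb : x ≠ b) {m : ℕ}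
    (h₁ : τ m ≤ x) (h₂ : x < τ (m + 1)) (k : ℕ) :
    ∀ i, (m < i ∨ i + k < m) → bsplineRec τ b k i x = 0 := by
  induction k with
  | zero =>
    intro i hi
    have : ¬ ((τ i ≤ x ∧ x < τ (i + 1)) ∨ (x = b ∧ τ i < b ∧ τ (i + 1) = b)) := by
      rintro (⟨h3, h4⟩ | ⟨h3, -⟩)
      · rcases hi with hi | hi
        · have := hτ (show m + 1 ≤ i by omega); linarith
        · have := hτ (show i + 1 ≤ m by omega); linarith
      · exact hxb h3
    simp [bsplineRec, this]
  | succ k ih =>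
    intro i hi
    rw [bsplineRec, ih i (by omega), ih (i + 1) (by omega)]
    simp

/-- A weight of the recursion can be negative only where the B-spline that it multiplies vanishes by
local support. -/
theorem bsplineRec_nonneg {τ : ℕ → ℝ} (hτ : Monotone τ) {b x : ℝ} (hxb : x ≠ b) {m : ℕ}
    (h₁ : τ m ≤ x) (h₂ : x < τ (m + 1)) (k : ℕ) : ∀ i, 0 ≤ bsplineRec τ b k i x := by
  induction k with
  | zero =>
    intro i
    rw [bsplineRec]
    split_ifs <;> norm_num
  | succ k ih =>
    intro i
    rw [bsplineRec]
    refine add_nonneg ?_ ?_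
    · by_cases hi : m < i ∨ i + k < m
      · rw [bsplineRec_eq_zero hτ hxb h₁ h₂ k i hi]; simp
      · have := hτ (show i ≤ m by omega)
        have h3 := hτ (show i ≤ i + k + 1 by omega)
        exact mul_nonneg (div_nonneg (by linarith) (by linarith)) (ih i)
    · by_cases hi : m < i + 1 ∨ i + 1 + k < m
      · rw [bsplineRec_eq_zero hτ hxb h₁ h₂ k (i + 1) hi]; simp
      · have := hτ (show m + 1 ≤ i + k + 2 by omega)
        have h3 := hτ (show i + 1 ≤ i + k + 2 by omega)
        exact mul_nonneg (div_nonneg (by linarith) (by linarith)) (ih (i + 1))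

/-- One step of de Boor's algorithm. -/
theorem sum_bsplineRec_succ {R : Type*} [CommRing R] [Algebra ℝ R] {τ : ℕ → ℝ} (hτ : Monotone τ)
    {b x : ℝ} (hxb : x ≠ b) {m : ℕ} (h₁ : τ m ≤ x) (h₂ : x < τ (m + 1)) (k D : ℕ) (hk : k < m)
    (hD : m < D) (c : ℕ → R) :
    ∑ i ∈ Finset.range D, bsplineRec τ b (k + 1) i x • c i =
      ∑ i ∈ Finset.range D, bsplineRec τ b k i x •
        (((x - τ i) / (τ (i + k + 1) - τ i)) • c i +
          ((τ (i + k + 1) - x) / (τ (i + k + 1) - τ i)) • c (i - 1)) := by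
  -- Both ends of the index shift are harmless: `k < m` kills the term with the truncated index `0 -
  -- 1`, and `m < D` kills the term with index `D` that the shift creates.
  have h0 : bsplineRec τ b k 0 x = 0 := bsplineRec_eq_zero hτ hxb h₁ h₂ k 0 (by omega)
  have hDz : bsplineRec τ b k D x = 0 := bsplineRec_eq_zero hτ hxb h₁ h₂ k D (by omega)
  have key : ∑ i ∈ Finset.range D, bsplineRec τ b k (i + 1) x •
        (((τ (i + 1 + k + 1) - x) / (τ (i + 1 + k + 1) - τ (i + 1))) • c i) =
      ∑ i ∈ Finset.range D, bsplineRec τ b k i x •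
        (((τ (i + k + 1) - x) / (τ (i + k + 1) - τ i)) • c (i - 1)) := by
    have h3 := Finset.sum_range_succ' (fun i => bsplineRec τ b k i x •
        (((τ (i + k + 1) - x) / (τ (i + k + 1) - τ i)) • c (i - 1))) D
    have h4 := Finset.sum_range_succ (fun i => bsplineRec τ b k i x •
        (((τ (i + k + 1) - x) / (τ (i + k + 1) - τ i)) • c (i - 1))) D
    simp only [h0, hDz, zero_smul, add_zero, Nat.add_sub_cancel] at h3 h4
    rw [← h3, h4]
  simp only [smul_add, Finset.sum_add_distrib]
  rw [← key, ← Finset.sum_add_distrib]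
  refine Finset.sum_congr rfl fun i _ => ?_
  rw [bsplineRec, add_smul, smul_smul, smul_smul]
  congr 2
  · ring
  · rw [show i + k + 2 = i + 1 + k + 1 by ring]; ring

theorem sum_bsplineRec_zero {R : Type*} [CommRing R] [Algebra ℝ R] {τ : ℕ → ℝ} (hτ : Monotone τ)
    {b x : ℝ} (hxb : x ≠ b) {m : ℕ} (h₁ : τ m ≤ x) (h₂ : x < τ (m + 1)) (D : ℕ)
    (hD : m < D) (c : ℕ → R) :
    ∑ i ∈ Finset.range D, bsplineRec τ b 0 i x • c i = c m := by
  rw [Finset.sum_eq_single m]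
  · simp [bsplineRec, h₁, h₂]
  · intro i _ hi
    rw [bsplineRec_eq_zero hτ hxb h₁ h₂ 0 i (by omega), zero_smul]
  · intro h; exact absurd (Finset.mem_range.2 hD) h

/-- Constant coefficients survive a de Boor step, because its two weights add up to one on the
support. -/
theorem sum_bsplineRec_eq_one {τ : ℕ → ℝ} (hτ : Monotone τ)
    {b x : ℝ} (hxb : x ≠ b) {m : ℕ} (h₁ : τ m ≤ x) (h₂ : x < τ (m + 1)) (k D : ℕ) (hk : k ≤ m)
    (hD : m < D) : ∑ i ∈ Finset.range D, bsplineRec τ b k i x = 1 := by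
  induction k with
  | zero => simpa using sum_bsplineRec_zero hτ hxb h₁ h₂ D hD (fun _ => (1 : ℝ))
  | succ k ih =>
    have := sum_bsplineRec_succ hτ hxb h₁ h₂ k D (by omega) hD (fun _ => (1 : ℝ))
    simp only [smul_eq_mul, mul_one] at this
    rw [this, ← ih (by omega)]
    refine Finset.sum_congr rfl fun i _ => ?_
    by_cases hi : m < i ∨ i + k < m
    · rw [bsplineRec_eq_zero hτ hxb h₁ h₂ k i hi]; simp
    · have h3 := hτ (show i ≤ m by omega)
      have h4 := hτ (show m + 1 ≤ i + k + 1 by omega)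
      rw [← add_div, div_eq_one_iff_eq (by linarith) |>.2 (by ring), mul_one]

open Polynomial in
/-- Marsden's identity, after an affine change of the variable. -/
theorem marsden {τ : ℕ → ℝ} (hτ : Monotone τ)
    {b x : ℝ} (hxb : x ≠ b) {m : ℕ} (h₁ : τ m ≤ x) (h₂ : x < τ (m + 1)) (A x₀ : ℝ)
    (k D : ℕ) (hk : k ≤ m) (hD : m < D) :
    ∑ i ∈ Finset.range D, bsplineRec τ b k i x •
      ∏ r ∈ Finset.range k, (C (A * (τ (i + 1 + r) - x₀)) - X : ℝ[X]) =
        (C (A * (x - x₀)) - X) ^ k := by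
  induction k with
  | zero => simpa using sum_bsplineRec_zero hτ hxb h₁ h₂ D hD (fun _ => (1 : ℝ[X]))
  | succ k ih =>
    rw [sum_bsplineRec_succ hτ hxb h₁ h₂ k D (by omega) hD, pow_succ, ← ih (by omega),
      Finset.sum_mul]
    refine Finset.sum_congr rfl fun i _ => ?_
    by_cases hi : m < i ∨ i + k < m
    · rw [bsplineRec_eq_zero hτ hxb h₁ h₂ k i hi]; simp
    · have h3 := hτ (show i ≤ m by omega)
      have h4 := hτ (show m + 1 ≤ i + k + 1 by omega)
      rw [smul_mul_assoc]
      congr 1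
      -- The index is positive because `k < m ≤ i + k`. The products of two neighbouring indices
      -- share the factor `Q`; the remaining factors are affine in the knots `v` and `u`, and the de
      -- Boor weights interpolate them to the factor at `x`.
      obtain ⟨i, rfl⟩ : ∃ i', i = i' + 1 := ⟨i - 1, by omega⟩
      rw [Finset.prod_range_succ, Finset.prod_range_succ' _ k, Nat.add_sub_cancel]
      have e : ∏ r ∈ Finset.range k, (C (A * (τ (i + 1 + (r + 1)) - x₀)) - X : ℝ[X]) =
          ∏ r ∈ Finset.range k, (C (A * (τ (i + 1 + 1 + r) - x₀)) - X : ℝ[X]) :=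
        Finset.prod_congr rfl fun r _ => by rw [show i + 1 + (r + 1) = i + 1 + 1 + r by ring]
      rw [e, add_zero]
      have e2 : i + 1 + 1 + k = i + 1 + k + 1 := by ring
      rw [e2]
      set Q := ∏ r ∈ Finset.range k, (C (A * (τ (i + 1 + 1 + r) - x₀)) - X : ℝ[X])
      set u := τ (i + 1)
      set v := τ (i + 1 + k + 1)
      have huv : v - u ≠ 0 := by linarith
      simp only [smul_eq_C_mul]
      have e3 : (C ((x - u) / (v - u)) : ℝ[X]) + C ((v - x) / (v - u)) = 1 := by
        rw [← C_add, ← add_div, show x - u + (v - x) = v - u by ring, div_self huv, C_1]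
      have e4 : (C ((x - u) / (v - u)) : ℝ[X]) * C (A * (v - x₀)) +
          C ((v - x) / (v - u)) * C (A * (u - x₀)) = C (A * (x - x₀)) := by
        rw [← C_mul, ← C_mul, ← C_add]
        congr 1
        field_simp
        ring
      linear_combination Q * e4 - Q * X * e3

open Polynomial in
theorem abs_coeff_prod_le (s : ℕ → ℝ) {S : ℝ} (k : ℕ) (hs : ∀ r < k, |s r| ≤ S) (j : ℕ) :
    |(∏ r ∈ Finset.range k, (C (s r) - X : ℝ[X])).coeff j| ≤ (1 + S) ^ k := by
  induction k generalizing j with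
  | zero =>
    simp only [Finset.range_zero, Finset.prod_empty, pow_zero, coeff_one]
    split_ifs <;> norm_num
  | succ k ih =>
    have ih := ih (fun r hr => hs r (by omega))
    have hk := hs k (by omega)
    have hS : 0 ≤ S := (abs_nonneg _).trans hk
    rw [Finset.prod_range_succ, mul_sub, coeff_sub, coeff_mul_C, pow_succ]
    have hP : (0 : ℝ) ≤ (1 + S) ^ k := by positivity
    have h1 : |(∏ r ∈ Finset.range k, (C (s r) - X : ℝ[X])).coeff j * s k| ≤ (1 + S) ^ k * S := by
      rw [abs_mul]; exact mul_le_mul (ih j) hk (abs_nonneg _) hP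
    have h2 : |((∏ r ∈ Finset.range k, (C (s r) - X : ℝ[X])) * X).coeff j| ≤ (1 + S) ^ k := by
      cases j with
      | zero => simpa using hP
      | succ j => rw [coeff_mul_X]; exact ih j
    refine (abs_sub _ _).trans ?_
    linarith

open Polynomial in
/-- On a knot interval, scaled monomials are splines with bounded coefficients. -/
theorem exists_monomial_coeff {τ : ℕ → ℝ} (hτ : Monotone τ) {b : ℝ} (m q D : ℕ) (hq : q ≤ m)
    (hD : m < D) (A x₀ S : ℝ)
    (hS : ∀ i, m - q + 1 ≤ i → i ≤ m + q → |A * (τ i - x₀)| ≤ S) (hS0 : 0 ≤ S) :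
    ∃ e : ℕ → ℕ → ℝ, (∀ i r, |e i r| ≤ (1 + S) ^ q) ∧
      ∀ r ≤ q, ∀ x, x ≠ b → τ m ≤ x → x < τ (m + 1) →
        ∑ i ∈ Finset.range D, bsplineRec τ b q i x * e i r = (A * (x - x₀)) ^ r := by
  classical
  set P : ℕ → ℝ[X] := fun i => ∏ r ∈ Finset.range q, (C (A * (τ (i + 1 + r) - x₀)) - X)
  -- Comparing coefficients of `X ^ (q - r)` in Marsden's identity isolates the `r`-th monomial, up
  -- to a sign and a binomial coefficient. Indices whose B-spline vanishes on the interval get the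
  -- value zero, so that only the knots from `m - q + 1` to `m + q` enter the bound.
  refine ⟨fun i r => if i ≤ m ∧ m ≤ i + q ∧ r ≤ q then
    (P i).coeff (q - r) * ((-1) ^ (q - r) / (q.choose r : ℝ)) else 0, ?_, ?_⟩
  · intro i r
    dsimp only
    split_ifs with h
    · have h1 : |(P i).coeff (q - r)| ≤ (1 + S) ^ q :=
        abs_coeff_prod_le _ q (fun r hr => hS _ (by omega) (by omega)) _
      have h2 : (1 : ℝ) ≤ (q.choose r : ℝ) := by
        exact_mod_cast Nat.choose_pos h.2.2
      rw [abs_mul, abs_div, abs_pow, abs_neg, abs_one, one_pow, Nat.abs_cast]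
      calc _ ≤ (1 + S) ^ q * 1 := by
            refine mul_le_mul h1 ?_ (by positivity) (by positivity)
            rw [div_le_one (by linarith)]; exact h2
        _ = _ := mul_one _
    · simp; positivity
  · intro r hr x hxb h₁ h₂
    have h := congrArg (fun p : ℝ[X] => p.coeff (q - r) * ((-1) ^ (q - r) / (q.choose r : ℝ)))
      (marsden hτ hxb h₁ h₂ A x₀ q D hq hD)
    simp only [finsetSum_coeff, coeff_smul, smul_eq_mul, Finset.sum_mul] at h
    have h3 : ((C (A * (x - x₀)) - X : ℝ[X]) ^ q).coeff (q - r) =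
        (A * (x - x₀)) ^ r * ((-1) ^ (q - r) * q.choose r) := by
      have : (C (A * (x - x₀)) - X : ℝ[X]) ^ q = (-1) ^ q * (X + C (-(A * (x - x₀)))) ^ q := by
        rw [← mul_pow, C_neg]; ring
      rw [this, show ((-1 : ℝ[X]) ^ q) = C ((-1 : ℝ) ^ q) by simp, coeff_C_mul, coeff_X_add_C_pow,
        Nat.sub_sub_self hr, Nat.choose_symm hr, neg_pow (A * (x - x₀))]
      have : ((-1 : ℝ)) ^ q * (-1) ^ r = (-1) ^ (q - r) := by
        rw [← pow_add, show q + r = (q - r) + 2 * r by omega, pow_add, pow_mul]; simp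
      rw [← this]; ring
    have hc : (q.choose r : ℝ) ≠ 0 := by exact_mod_cast (Nat.choose_pos hr).ne'
    rw [h3] at h
    have h4 : (A * (x - x₀)) ^ r * ((-1) ^ (q - r) * (q.choose r : ℝ)) *
        ((-1) ^ (q - r) / (q.choose r : ℝ)) = (A * (x - x₀)) ^ r := by
      have : ((-1 : ℝ)) ^ (q - r) * (-1) ^ (q - r) = 1 := by
        rw [← mul_pow]; simp
      field_simp
      rw [sq, this, mul_one]
    rw [h4] at h
    rw [← h]
    refine Finset.sum_congr rfl fun i _ => ?_
    by_cases hi : i ≤ m ∧ m ≤ i + q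
    · simp only [if_pos (show i ≤ m ∧ m ≤ i + q ∧ r ≤ q from ⟨hi.1, hi.2, hr⟩)]
      exact (mul_assoc _ _ _).symm
    · rw [bsplineRec_eq_zero hτ hxb h₁ h₂ q i (by omega)]; simp

/-- Coefficients of a polynomial are controlled by its `L¹` norm on `[0, 1]`. -/
theorem exists_norm_le_integral_abs (q : ℕ) : ∃ C : ℝ, 0 < C ∧ ∀ a : Fin (q + 1) → ℝ,
    ‖a‖ ≤ C * ∫ t in (0 : ℝ)..1, |∑ r, a r * t ^ (r : ℕ)| := by
  -- Equivalence of norms in finite dimension: `N` is continuous, homogeneous and positive off zero,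
  -- so it has a positive minimum on the unit sphere. The reciprocal of this minimum is the
  -- constant.
  set N : (Fin (q + 1) → ℝ) → ℝ := fun a => ∫ t in (0 : ℝ)..1, |∑ r, a r * t ^ (r : ℕ)|
  have hcont : Continuous N :=
    intervalIntegral.continuous_parametric_intervalIntegral_of_continuous'
      (by fun_prop) _ _
  have hpos : ∀ a, a ≠ 0 → 0 < N a := by
    intro a ha
    have hc : Continuous fun t : ℝ => |∑ r, a r * t ^ (r : ℕ)| := by fun_prop
    rw [show N a = ∫ t in (0 : ℝ)..1, |∑ r, a r * t ^ (r : ℕ)| from rfl]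
    refine intervalIntegral.integral_pos one_pos hc.continuousOn (fun _ _ => abs_nonneg _) ?_
    by_contra! h
    apply ha
    set p : Polynomial ℝ := ∑ r : Fin (q + 1), Polynomial.monomial (r : ℕ) (a r)
    have hp : ∀ t, p.eval t = ∑ r, a r * t ^ (r : ℕ) := by
      intro t; simp [p, Polynomial.eval_finsetSum]
    have hp0 : p = 0 := by
      refine Polynomial.eq_zero_of_infinite_isRoot p ((Set.Icc_infinite (zero_lt_one' ℝ)).mono ?_)
      intro t ht
      have := h t ht
      simpa [Polynomial.IsRoot, hp] using abs_nonpos_iff.1 this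
    funext r
    have := congrArg (fun p => Polynomial.coeff p (r : ℕ)) hp0
    simpa [p, Polynomial.finsetSum_coeff, Polynomial.coeff_monomial, Fin.val_inj] using this
  have hsm : ∀ (c : ℝ) a, N (c • a) = |c| * N a := by
    intro c a
    simp only [N, ← intervalIntegral.integral_const_mul]
    congr 1; ext t
    rw [← abs_mul, Finset.mul_sum]
    simp [mul_assoc]
  obtain ⟨a₀, ha₀, hmin⟩ := (isCompact_sphere (0 : Fin (q + 1) → ℝ) 1).exists_isMinOn
    (NormedSpace.sphere_nonempty.2 zero_le_one) hcont.continuousOn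
  have hN0 : 0 < N a₀ := hpos a₀ (by rintro rfl; simp at ha₀)
  refine ⟨(N a₀)⁻¹, inv_pos.2 hN0, fun a => ?_⟩
  change ‖a‖ ≤ (N a₀)⁻¹ * N a
  by_cases ha : a = 0
  · subst ha; simp only [norm_zero]
    exact mul_nonneg (inv_pos.2 hN0).le
      (intervalIntegral.integral_nonneg zero_le_one fun _ _ => abs_nonneg _)
  have hn : 0 < ‖a‖ := norm_pos_iff.2 ha
  have h1 : N a₀ ≤ N (‖a‖⁻¹ • a) := hmin (by simp [norm_smul, hn.ne'])
  rw [hsm, abs_of_pos (inv_pos.2 hn)] at h1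
  rw [← div_eq_inv_mul, le_div_iff₀ hN0]
  calc ‖a‖ * N a₀ ≤ ‖a‖ * (‖a‖⁻¹ * N a) := by gcongr
    _ = N a := by field_simp

end Screening

namespace Screening

/-! ### Quasi-uniform meshes -/

namespace IsQuasiUniformMesh

variable {a b ρ : ℝ} {N : ℕ} {ξ : ℕ → ℝ}

theorem le_of_le (h : IsQuasiUniformMesh a b ρ N ξ) {i j : ℕ} (hij : i ≤ j) (hj : j ≤ N) :
    ξ i ≤ ξ j := by
  induction j, hij using Nat.le_induction with
  | base => exact le_rfl
  | succ j _ ih => exact (ih (by omega)).trans (h.lt_succ j (by omega)).le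

theorem monotone_knot (h : IsQuasiUniformMesh a b ρ N ξ) (q : ℕ) : Monotone (knot q N ξ) :=
  fun i j hij => h.le_of_le (by omega) (by omega)

theorem one_le_ratio (h : IsQuasiUniformMesh a b ρ N ξ) (hN : 0 < N) : 1 ≤ ρ := by
  have h1 := h.lt_succ 0 hN
  have h2 := h.ratio 0 hN 0 hN
  by_contra! h3
  nlinarith

theorem sub_le (h : IsQuasiUniformMesh a b ρ N ξ) {k i j : ℕ} (hk : k < N) (hij : i ≤ j)
    (hj : j ≤ N) : ξ j - ξ i ≤ (j - i : ℕ) * (ρ * (ξ (k + 1) - ξ k)) := by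
  induction j, hij using Nat.le_induction with
  | base => simp
  | succ j hij ih =>
    have h1 := ih (by omega)
    have h2 := h.ratio j (by omega) k hk
    rw [show j + 1 - i = (j - i) + 1 by omega]
    push_cast
    linarith

theorem le_mul_length (h : IsQuasiUniformMesh a b ρ N ξ) {k : ℕ} (hk : k < N) :
    b - a ≤ N * (ρ * (ξ (k + 1) - ξ k)) := by
  have := h.sub_le hk (Nat.zero_le N) le_rfl
  rwa [h.left, h.right, Nat.sub_zero] at this

theorem mul_length_le (h : IsQuasiUniformMesh a b ρ N ξ) {k : ℕ} (hk : k < N) :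
    N * (ξ (k + 1) - ξ k) ≤ ρ * (b - a) := by
  have h1 : ∑ i ∈ Finset.range N, (ξ (i + 1) - ξ i) = b - a := by
    rw [Finset.sum_range_sub, h.left, h.right]
  rw [← h1, Finset.mul_sum]
  calc N * (ξ (k + 1) - ξ k) = ∑ i ∈ Finset.range N, (ξ (k + 1) - ξ k) := by
        rw [Finset.sum_const, Finset.card_range, nsmul_eq_mul]
    _ ≤ _ := Finset.sum_le_sum fun i hi => h.ratio k hk i (Finset.mem_range.1 hi)

theorem exists_cell (h : IsQuasiUniformMesh a b ρ N ξ) {x : ℝ} (hx : x ∈ Set.Ico a b) :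
    ∃ i < N, x ∈ Set.Ico (ξ i) (ξ (i + 1)) := by
  classical
  have hex : ∃ i, x < ξ i := ⟨N, by rw [h.right]; exact hx.2⟩
  have h1 := Nat.find_spec hex
  have h0 : Nat.find hex ≠ 0 := by
    intro h0; rw [h0, h.left] at h1; exact absurd hx.1 (not_le.2 h1)
  have hN : Nat.find hex ≤ N := Nat.find_min' hex (by rw [h.right]; exact hx.2)
  refine ⟨Nat.find hex - 1, by omega, ?_, ?_⟩
  · exact not_lt.1 (Nat.find_min hex (show Nat.find hex - 1 < Nat.find hex by omega))
  · rwa [show Nat.find hex - 1 + 1 = Nat.find hex by omega]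

end IsQuasiUniformMesh

/-! ### Splines on a mesh cell -/

theorem measurable_bsplineRec (τ : ℕ → ℝ) (b : ℝ) (k : ℕ) :
    ∀ i, Measurable (bsplineRec τ b k i) := by
  classical
  induction k with
  | zero =>
    intro i
    have : bsplineRec τ b 0 i = fun x =>
        if (τ i ≤ x ∧ x < τ (i + 1)) ∨ (x = b ∧ τ i < b ∧ τ (i + 1) = b) then (1 : ℝ) else 0 := by
      funext x; rw [bsplineRec]
    rw [this]
    refine Measurable.ite ?_ measurable_const measurable_const
    refine MeasurableSet.union (measurableSet_Ico (a := τ i) (b := τ (i + 1))) ?_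
    exact (measurableSet_singleton b).inter (MeasurableSet.const _)
  | succ k ih =>
    intro i
    have : bsplineRec τ b (k + 1) i = fun x =>
        (x - τ i) / (τ (i + k + 1) - τ i) * bsplineRec τ b k i x +
        (τ (i + k + 2) - x) / (τ (i + k + 2) - τ (i + 1)) * bsplineRec τ b k (i + 1) x := by
      funext x; rw [bsplineRec]
    rw [this]
    have h1 := ih i
    have h2 := ih (i + 1)
    fun_prop

theorem measurable_splineFun (q d : ℕ) (ξ : ℕ → ℝ) (β : EuclideanSpace ℝ (Fin d)) :
    Measurable (splineFun q d ξ β) := by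
  unfold splineFun bspline
  exact Finset.measurable_sum _ fun k _ => (measurable_bsplineRec _ _ _ _).mul_const _

section Cell

variable {a b ρ : ℝ} {q d : ℕ} {ξ : ℕ → ℝ}

theorem knot_add {N i : ℕ} (hi : i ≤ N) : knot q N ξ (i + q) = ξ i := by
  rw [knot, Nat.add_sub_cancel, min_eq_left hi]

theorem knot_add_succ {N i : ℕ} (hi : i < N) : knot q N ξ (i + q + 1) = ξ (i + 1) := by
  rw [show i + q + 1 = (i + 1) + q by ring, knot_add hi]

variable (h : IsQuasiUniformMesh a b ρ (d - q) ξ) {i : ℕ} (hi : i < d - q) {x : ℝ}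
  (hx : x ∈ Set.Ico (ξ i) (ξ (i + 1)))
include h hi hx

/-- The left end point is repeated `q + 1` times, which makes cell `i` the knot interval number `i +
q`. Half-open cells avoid `b`, where the special clause of the recursion is active; that point has
measure zero under the laws considered. -/
theorem cell_data : x ≠ ξ (d - q) ∧ knot q (d - q) ξ (i + q) ≤ x ∧
    x < knot q (d - q) ξ (i + q + 1) := by
  refine ⟨?_, ?_, ?_⟩
  · have := h.le_of_le (show i + 1 ≤ d - q by omega) le_rfl
    have := hx.2
    intro h3; linarith
  · rw [knot_add hi.le]; exact hx.1
  · rw [knot_add_succ hi]; exact hx.2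

theorem bspline_eq_zero {k : ℕ} (hk : k < i ∨ i + q < k) : bspline q d ξ k x = 0 := by
  obtain ⟨h0, h1, h2⟩ := cell_data h hi hx
  exact bsplineRec_eq_zero (h.monotone_knot q) h0 h1 h2 q k (by omega)

theorem bspline_nonneg (k : ℕ) : 0 ≤ bspline q d ξ k x := by
  obtain ⟨h0, h1, h2⟩ := cell_data h hi hx
  exact bsplineRec_nonneg (h.monotone_knot q) h0 h1 h2 q k

theorem sum_bspline : ∑ k : Fin d, bspline q d ξ k x = 1 := by
  obtain ⟨h0, h1, h2⟩ := cell_data h hi hx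
  rw [Fin.sum_univ_eq_sum_range (fun k => bspline q d ξ k x)]
  exact sum_bsplineRec_eq_one (h.monotone_knot q) h0 h1 h2 q d (by omega) (by omega)

theorem splineFun_congr {β β' : EuclideanSpace ℝ (Fin d)}
    (hβ : ∀ k : Fin d, i ≤ k → (k : ℕ) ≤ i + q → β k = β' k) :
    splineFun q d ξ β x = splineFun q d ξ β' x := by
  refine Finset.sum_congr rfl fun k _ => ?_
  by_cases hk : (k : ℕ) < i ∨ i + q < k
  · rw [bspline_eq_zero h hi hx hk]; simp
  · rw [hβ k (by omega) (by omega)]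

/-- On a cell the spline is a convex combination of the `q + 1` coefficients that are active there.
-/
theorem abs_splineFun_le {β : EuclideanSpace ℝ (Fin d)} {M : ℝ}
    (hβ : ∀ k : Fin d, i ≤ k → (k : ℕ) ≤ i + q → |β k| ≤ M) :
    |splineFun q d ξ β x| ≤ M := by
  calc |splineFun q d ξ β x| ≤ ∑ k : Fin d, |bspline q d ξ k x * β k| :=
        Finset.abs_sum_le_sum_abs _ _
    _ ≤ ∑ k : Fin d, bspline q d ξ k x * M := by
        refine Finset.sum_le_sum fun k _ => ?_
        rw [abs_mul, abs_of_nonneg (bspline_nonneg h hi hx k)]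
        by_cases hk : (k : ℕ) < i ∨ i + q < k
        · rw [bspline_eq_zero h hi hx hk]; simp
        · exact mul_le_mul_of_nonneg_left (hβ k (by omega) (by omega))
            (bspline_nonneg h hi hx k)
    _ = M := by rw [← Finset.sum_mul, sum_bspline h hi hx, one_mul]

theorem splineFun_sq_le (β : EuclideanSpace ℝ (Fin d)) :
    splineFun q d ξ β x ^ 2 ≤
      ∑ k : Fin d, if i ≤ (k : ℕ) ∧ (k : ℕ) ≤ i + q then β k ^ 2 else 0 := by
  have h1 : splineFun q d ξ β x ^ 2 ≤ ∑ k : Fin d, bspline q d ξ k x * β k ^ 2 := by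
    -- Jensen's inequality for the weights `bspline q d ξ k x`, in the form of Cauchy-Schwarz with
    -- square roots of the weights.
    have h2 := Finset.sum_mul_sq_le_sq_mul_sq Finset.univ
      (fun k : Fin d => √(bspline q d ξ k x)) (fun k : Fin d => √(bspline q d ξ k x) * β k)
    have e : ∀ k : Fin d, √(bspline q d ξ k x) ^ 2 = bspline q d ξ k x := fun k =>
      Real.sq_sqrt (bspline_nonneg h hi hx k)
    simp only [← mul_assoc, ← sq, mul_pow, e] at h2
    rwa [sum_bspline h hi hx, one_mul] at h2
  refine h1.trans (Finset.sum_le_sum fun k _ => ?_)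
  have hb := bspline_nonneg h hi hx k
  have hb1 : bspline q d ξ k x ≤ 1 := by
    rw [← sum_bspline h hi hx]
    exact Finset.single_le_sum (f := fun k : Fin d => bspline q d ξ k x)
      (fun k _ => bspline_nonneg h hi hx k) (Finset.mem_univ k)
  split_ifs with hk
  · nlinarith [sq_nonneg (β k)]
  · rw [bspline_eq_zero h hi hx (by omega)]; simp

end Cell

/-- Local `L¹` stability of the B-spline basis. -/
theorem exists_coeff_le_integral (q : ℕ) (ρ : ℝ) : ∃ C : ℝ, 0 < C ∧
    ∀ (a b : ℝ) (d : ℕ) (ξ : ℕ → ℝ), IsQuasiUniformMesh a b ρ (d - q) ξ →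
    ∀ i < d - q, ∀ (β : EuclideanSpace ℝ (Fin d)) (k : Fin d), i ≤ (k : ℕ) → (k : ℕ) ≤ i + q →
      |β k| * (ξ (i + 1) - ξ i) ≤ C * ∫ x in ξ i..ξ (i + 1), |splineFun q d ξ β x| := by
  obtain ⟨C, hC, hnorm⟩ := exists_norm_le_integral_abs q
  -- For `ρ < 1` there is no mesh with a cell, as a cell compared with itself shows, and any
  -- constant serves.
  by_cases hρ : 1 ≤ ρ
  swap
  · exact ⟨1, one_pos, fun a b d ξ h i hi => absurd (h.one_le_ratio (by omega)) hρ⟩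
  -- The knots that matter on a cell of length `δ` are at most `q` cells away, each of length at
  -- most `ρ * δ`.
  set S : ℝ := q * ρ
  have hS : 0 ≤ S := by positivity
  refine ⟨(q + 1) * (1 + S) ^ q * C, by positivity, ?_⟩
  intro a b d ξ h i hi β k hk1 hk2
  set δ := ξ (i + 1) - ξ i
  have hδ : 0 < δ := sub_pos.2 (h.lt_succ i hi)
  obtain ⟨e, he, hmon⟩ := exists_monomial_coeff (h.monotone_knot q) (b := ξ (d - q)) (i + q) q d
    (by omega) (by omega) δ⁻¹ (ξ i) S (by
      intro j hj1 hj2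
      rw [abs_mul, abs_of_pos (inv_pos.2 hδ), ← div_eq_inv_mul, div_le_iff₀ hδ, knot]
      set j' := min (j - q) (d - q)
      rcases le_total j' i with hji | hji
      · have h1 := h.sub_le hi hji (by omega)
        have h2 := h.le_of_le hji (by omega)
        rw [abs_of_nonpos (by linarith)]
        have h3 : ((i - j' : ℕ) : ℝ) ≤ q := by exact_mod_cast (by omega)
        have : ((i - j' : ℕ) : ℝ) * (ρ * δ) ≤ q * (ρ * δ) := by gcongr
        simp only [S]; linarith
      · have h1 := h.sub_le hi hji (by omega)
        have h2 := h.le_of_le hji (by omega)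
        rw [abs_of_nonneg (by linarith)]
        have h3 : ((j' - i : ℕ) : ℝ) ≤ q := by exact_mod_cast (by omega)
        have : ((j' - i : ℕ) : ℝ) * (ρ * δ) ≤ q * (ρ * δ) := by gcongr
        simp only [S]; linarith) hS
  -- `E` maps the coefficients of a polynomial in the scaled variable to the B-spline coefficients
  -- that represent it on the cell. It is square, and injective because a polynomial that vanishes
  -- on the cell is zero. Hence it is surjective: every vector of active coefficients comes from a
  -- polynomial, whose coefficients are controlled by its `L¹` norm.
  let E : (Fin (q + 1) → ℝ) →ₗ[ℝ] (Fin (q + 1) → ℝ) :=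
    { toFun := fun c s => ∑ r, c r * e (i + s) r
      map_add' := fun c c' => by ext s; simp [add_mul, Finset.sum_add_distrib]
      map_smul' := fun t c => by ext s; simp [Finset.mul_sum, mul_assoc] }
  have hE : ∀ (c : Fin (q + 1) → ℝ) (β' : EuclideanSpace ℝ (Fin d)),
      (∀ s : Fin (q + 1), ∀ k : Fin d, (k : ℕ) = i + s → β' k = E c s) →
      ∀ x ∈ Set.Ico (ξ i) (ξ (i + 1)),
      splineFun q d ξ β' x = ∑ r, c r * (δ⁻¹ * (x - ξ i)) ^ (r : ℕ) := by
    intro c β' hβ' x hx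
    obtain ⟨h0, h1, h2⟩ := cell_data h hi hx
    have : ∀ r : Fin (q + 1), c r * (δ⁻¹ * (x - ξ i)) ^ (r : ℕ) =
        ∑ k : Fin d, bspline q d ξ k x * (c r * e k r) := by
      intro r
      rw [← hmon r (by omega) x h0 h1 h2, ← Fin.sum_univ_eq_sum_range
        (fun j => bsplineRec (knot q (d - q) ξ) (ξ (d - q)) q j x * e j r) d, Finset.mul_sum]
      refine Finset.sum_congr rfl fun k _ => ?_
      rw [bspline]; ring
    rw [Finset.sum_congr rfl fun r _ => this r, Finset.sum_comm]
    refine Finset.sum_congr rfl fun k _ => ?_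
    rw [← Finset.mul_sum]
    by_cases hk : (k : ℕ) < i ∨ i + q < k
    · rw [bspline_eq_zero h hi hx hk]; simp
    · rw [hβ' ⟨k - i, by omega⟩ k (by simp; omega)]
      simp only [E, LinearMap.coe_mk, AddHom.coe_mk]
      rw [show i + (k - i) = (k : ℕ) by omega]
  have hint : ∀ (c : Fin (q + 1) → ℝ) (f : ℝ → ℝ), (∀ x ∈ Set.Ico (ξ i) (ξ (i + 1)),
      f x = ∑ r, c r * (δ⁻¹ * (x - ξ i)) ^ (r : ℕ)) →
      δ * ∫ t in (0 : ℝ)..1, |∑ r, c r * t ^ (r : ℕ)| = ∫ x in ξ i..ξ (i + 1), |f x| := by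
    intro c f hf
    have h1 : ∫ x in ξ i..ξ (i + 1), |f x| = ∫ x in ξ i..ξ (i + 1),
        (fun t => |∑ r, c r * t ^ (r : ℕ)|) (δ⁻¹ * x - δ⁻¹ * ξ i) := by
      refine intervalIntegral.integral_congr_ae ?_
      have : ∀ᵐ x : ℝ, x ≠ ξ (i + 1) := by simp [ae_iff]
      filter_upwards [this] with x hx hx2
      rw [Set.uIoc_of_le (h.lt_succ i hi).le] at hx2
      rw [hf x ⟨hx2.1.le, lt_of_le_of_ne hx2.2 hx⟩, mul_sub]
    rw [h1, intervalIntegral.integral_comp_mul_sub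
      (fun t : ℝ => |∑ r, c r * t ^ (r : ℕ)|) (inv_ne_zero hδ.ne'), inv_inv, smul_eq_mul,
      sub_self, ← mul_sub, inv_mul_cancel₀ hδ.ne']
  have hinj : Function.Injective E := by
    rw [← LinearMap.ker_eq_bot, LinearMap.ker_eq_bot']
    intro c hc
    have h1 := hint c 0 (fun x hx => by
      have := hE c 0 (fun s k _ => by rw [hc]; simp) x hx
      rw [← this]; simp [splineFun])
    simp only [Pi.zero_apply, abs_zero, intervalIntegral.integral_zero, mul_eq_zero, hδ.ne',
      false_or] at h1
    have h2 := hnorm c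
    rw [h1, mul_zero] at h2
    exact norm_le_zero_iff.1 h2
  have hsurj : Function.Surjective E := LinearMap.injective_iff_surjective.1 hinj
  obtain ⟨c, hc⟩ := hsurj fun s => β ⟨i + s, by omega⟩
  have h1 := hint c _ (hE c β (fun s k hk => by
    rw [hc, show k = ⟨i + s, by omega⟩ from Fin.ext hk]))
  have h2 : β k = E c ⟨k - i, by omega⟩ := by
    rw [hc]
    exact congrArg (fun j => β j) (Fin.ext (by dsimp only; omega))
  have h3 : |β k| ≤ (q + 1) * (1 + S) ^ q * ‖c‖ := by
    rw [h2]
    calc _ ≤ ∑ r, |c r * e (i + (k - i)) r| := Finset.abs_sum_le_sum_abs _ _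
      _ ≤ ∑ r : Fin (q + 1), ‖c‖ * (1 + S) ^ q := by
          refine Finset.sum_le_sum fun r _ => ?_
          rw [abs_mul]
          exact mul_le_mul (norm_le_pi_norm c r) (he _ _) (abs_nonneg _) (norm_nonneg _)
      _ = _ := by simp; ring
  calc |β k| * δ ≤ (q + 1) * (1 + S) ^ q * ‖c‖ * δ := by gcongr
    _ ≤ (q + 1) * (1 + S) ^ q * (C * ∫ t in (0 : ℝ)..1, |∑ r, c r * t ^ (r : ℕ)|) * δ := by
        gcongr; exact hnorm c
    _ = (q + 1) * (1 + S) ^ q * C * (δ * ∫ t in (0 : ℝ)..1, |∑ r, c r * t ^ (r : ℕ)|) := by ring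
    _ = _ := by rw [h1]

end Screening

/-! ### A block of cells with moderate boundary, and integrals of splines -/

namespace Screening

/-- A block around `m₀` that is delimited by `q` consecutive small cells on both sides, and on which
the sum of `E` is almost as large as `E m₀`. -/
theorem exists_block (E : ℕ → ℝ) (big : ℕ → Prop) (N q : ℕ) (e : ℝ) (he : 0 ≤ e)
    (hE : ∀ i < N, -e ≤ E i) (hbig : ∀ i < N, big i → q * e ≤ E i) (m₀ : ℕ) (hm₀ : m₀ < N) :
    ∃ k₁ k₂, k₁ ≤ m₀ ∧ m₀ < k₂ ∧ k₂ ≤ N ∧ (∀ i, i < k₁ → k₁ ≤ i + q → ¬ big i) ∧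
      (∀ i < N, k₂ ≤ i → i < k₂ + q → ¬ big i) ∧
      E m₀ - 2 * (q * e) ≤ ∑ i ∈ Finset.Ico k₁ k₂, E i := by
  classical
  have hqe : 0 ≤ q * e := by positivity
  have short : ∀ s t, s ≤ t → t ≤ N → t ≤ s + q → -(q * e) ≤ ∑ i ∈ Finset.Ico s t, E i := by
    intro s t hst htN hts
    have h1 : ∑ i ∈ Finset.Ico s t, -e ≤ ∑ i ∈ Finset.Ico s t, E i :=
      Finset.sum_le_sum fun i hi => hE i (by rw [Finset.mem_Ico] at hi; omega)
    rw [Finset.sum_const, Nat.card_Ico, nsmul_eq_mul] at h1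
    have h2 : ((t - s : ℕ) : ℝ) ≤ q := by exact_mod_cast (by omega)
    nlinarith
  -- A single big cell compensates the possible loss on the other cells of a window of length `q`.
  have window : ∀ s, s + q ≤ N → (∃ i, s ≤ i ∧ i < s + q ∧ big i) →
      0 ≤ ∑ i ∈ Finset.Ico s (s + q), E i := by
    rintro s hs ⟨i, h1, h2, h3⟩
    have h4 := short s i h1 (by omega) (by omega)
    have hmem : i ∈ Finset.Ico s (s + q) := Finset.mem_Ico.2 ⟨h1, h2⟩
    have h5 : ∑ j ∈ (Finset.Ico s (s + q)).erase i, -e ≤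
        ∑ j ∈ (Finset.Ico s (s + q)).erase i, E j :=
      Finset.sum_le_sum fun j hj => hE j (by
        have := Finset.mem_of_mem_erase hj; rw [Finset.mem_Ico] at this; omega)
    rw [Finset.sum_const, Finset.card_erase_of_mem hmem, Nat.card_Ico, nsmul_eq_mul] at h5
    rw [← Finset.add_sum_erase _ _ hmem]
    have h6 := hbig i (by omega) h3
    have h7 : ((s + q - s - 1 : ℕ) : ℝ) ≤ q := by exact_mod_cast (by omega)
    nlinarith
  -- The cuts `k₁` and `k₂` are the admissible ones nearest to `m₀`; the two ends of the mesh are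
  -- always admissible. By this choice every window of `q` cells between a cut and `m₀` contains a
  -- big cell and has a nonnegative sum, so on each side only a remainder of at most `q` cells can
  -- contribute negatively.
  set p₁ : ℕ → Prop := fun k => ∀ i, i < k → k ≤ i + q → ¬ big i
  set k₁ := Nat.findGreatest p₁ m₀
  have hk₁ : p₁ k₁ := Nat.findGreatest_spec (P := p₁) (Nat.zero_le m₀) (by
    intro i hi; omega)
  have hk₁m : k₁ ≤ m₀ := Nat.findGreatest_le m₀
  have hp₁ : ∀ k, k₁ < k → k ≤ m₀ → ∃ i, i < k ∧ k ≤ i + q ∧ big i := by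
    intro k h1 h2
    have := Nat.findGreatest_is_greatest (P := p₁) h1 h2
    simpa [p₁] using this
  have hex : ∃ k, m₀ < k ∧ ∀ i < N, k ≤ i → i < k + q → ¬ big i :=
    ⟨N, hm₀, fun i h1 h2 => by omega⟩
  set k₂ := Nat.find hex
  have hk₂ := Nat.find_spec hex
  have hk₂N : k₂ ≤ N := Nat.find_min' hex ⟨hm₀, fun i h1 h2 => by omega⟩
  have hp₂ : ∀ k, m₀ < k → k < k₂ → ∃ i < N, k ≤ i ∧ i < k + q ∧ big i := by
    intro k h1 h2
    have := Nat.find_min hex h2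
    simpa [h1] using this
  refine ⟨k₁, k₂, hk₁m, hk₂.1, hk₂N, hk₁, hk₂.2, ?_⟩
  have left : ∀ n k, k - k₁ ≤ n → k₁ ≤ k → k ≤ m₀ →
      -(q * e) ≤ ∑ i ∈ Finset.Ico k₁ k, E i := by
    intro n
    induction n with
    | zero =>
      intro k h1 h2 h3
      exact short _ _ h2 (by omega) (by omega)
    | succ n ih =>
      intro k h1 h2 h3
      by_cases hkq : k ≤ k₁ + q
      · exact short _ _ h2 (by omega) hkq
      · obtain ⟨i, hi1, hi2, hi3⟩ := hp₁ k (by omega) h3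
        have h4 := window (k - q) (by omega) ⟨i, by omega, by omega, hi3⟩
        have h5 := ih (k - q) (by omega) (by omega) (by omega)
        rw [show k - q + q = k by omega] at h4
        rw [← Finset.sum_Ico_consecutive E (show k₁ ≤ k - q by omega) (by omega)]
        linarith
  have right : ∀ n k, k₂ - k ≤ n → m₀ < k → k ≤ k₂ →
      -(q * e) ≤ ∑ i ∈ Finset.Ico k k₂, E i := by
    intro n
    induction n with
    | zero =>
      intro k h1 h2 h3
      exact short _ _ h3 (by omega) (by omega)
    | succ n ih =>
      intro k h1 h2 h3
      by_cases hkq : k₂ ≤ k + q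
      · exact short _ _ h3 (by omega) hkq
      · obtain ⟨i, hi0, hi1, hi2, hi3⟩ := hp₂ k h2 (by omega)
        have h4 := window k (by omega) ⟨i, hi1, hi2, hi3⟩
        have h5 := ih (k + q) (by omega) (by omega) (by omega)
        rw [← Finset.sum_Ico_consecutive E (show k ≤ k + q by omega) (by omega)]
        linarith
  have h1 := left _ m₀ le_rfl hk₁m le_rfl
  have h2 := right _ (m₀ + 1) le_rfl (by omega) hk₂.1
  rw [← Finset.sum_Ico_consecutive E hk₁m hk₂.1.le, Finset.sum_eq_sum_Ico_succ_bot hk₂.1]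
  linarith

/-! ### Integrals with respect to a density that is bounded from above and below -/

theorem smul_le_withDensity {a b K₁ K₂ : ℝ} {g : ℝ → ℝ}
    (hg : ∀ x ∈ Set.Icc a b, K₁ ≤ g x ∧ g x ≤ K₂) :
    ENNReal.ofReal K₁ • volume.restrict (Set.Icc a b) ≤
      (volume.restrict (Set.Icc a b)).withDensity (fun x => ENNReal.ofReal (g x)) ∧
    (volume.restrict (Set.Icc a b)).withDensity (fun x => ENNReal.ofReal (g x)) ≤
      ENNReal.ofReal K₂ • volume.restrict (Set.Icc a b) := by
  rw [← withDensity_const, ← withDensity_const]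
  constructor <;> refine withDensity_mono ?_ <;>
    filter_upwards [ae_restrict_mem measurableSet_Icc] with x hx
  · exact ENNReal.ofReal_le_ofReal (hg x hx).1
  · exact ENNReal.ofReal_le_ofReal (hg x hx).2

/-- The measure `ν` lives on `[a, b]` and has a density with values in `[K₁, K₂]` there. -/
structure DensityBounds (a b K₁ K₂ : ℝ) (ν : Measure ℝ) : Prop where
  lower : ENNReal.ofReal K₁ • volume.restrict (Set.Icc a b) ≤ ν
  upper : ν ≤ ENNReal.ofReal K₂ • volume.restrict (Set.Icc a b)

namespace DensityBounds

variable {a b K₁ K₂ : ℝ} {ν : Measure ℝ}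

theorem ae_mem (h : DensityBounds a b K₁ K₂ ν) : ∀ᵐ x ∂ν, x ∈ Set.Ico a b := by
  have h1 : ∀ᵐ x ∂(volume.restrict (Set.Icc a b)), x ∈ Set.Ico a b := by
    have : ∀ᵐ x : ℝ ∂(volume.restrict (Set.Icc a b)), x ≠ b := by
      refine ae_restrict_of_ae ?_
      simp [ae_iff]
    filter_upwards [this, ae_restrict_mem measurableSet_Icc] with x hx hx2
    exact ⟨hx2.1, lt_of_le_of_ne hx2.2 hx⟩
  have h2 : ν ≪ volume.restrict (Set.Icc a b) :=
    (Measure.absolutelyContinuous_of_le h.upper).trans (Measure.smul_absolutelyContinuous)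
  exact h2.ae_le h1

theorem setIntegral_le (h : DensityBounds a b K₁ K₂ ν) (hK₂ : 0 ≤ K₂) {s : Set ℝ}
    (hsm : s ⊆ Set.Icc a b) (hsM : MeasurableSet s) {F : ℝ → ℝ} (hF0 : ∀ x, 0 ≤ F x)
    (hF : IntegrableOn F s volume) :
    ∫ x in s, F x ∂ν ≤ K₂ * ∫ x in s, F x := by
  have h1 : ν.restrict s ≤ ENNReal.ofReal K₂ • volume.restrict s := by
    have := Measure.restrict_mono (le_refl s) h.upper
    rwa [Measure.restrict_smul, Measure.restrict_restrict hsM, Set.inter_eq_left.2 hsm] at this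
  have := integral_mono_measure h1 (Eventually.of_forall hF0)
    (hF.smul_measure ENNReal.ofReal_ne_top)
  rwa [integral_smul_measure, ENNReal.toReal_ofReal hK₂, smul_eq_mul] at this

theorem le_setIntegral (h : DensityBounds a b K₁ K₂ ν) (hK₁ : 0 ≤ K₁) {s : Set ℝ}
    (hsm : s ⊆ Set.Icc a b) (hsM : MeasurableSet s) {F : ℝ → ℝ} (hF0 : ∀ x, 0 ≤ F x)
    (hF : IntegrableOn F s ν) :
    K₁ * ∫ x in s, F x ≤ ∫ x in s, F x ∂ν := by
  have h1 : ENNReal.ofReal K₁ • volume.restrict s ≤ ν.restrict s := by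
    have := Measure.restrict_mono (le_refl s) h.lower
    rwa [Measure.restrict_smul, Measure.restrict_restrict hsM, Set.inter_eq_left.2 hsm] at this
  have := integral_mono_measure h1 (Eventually.of_forall hF0) hF
  rwa [integral_smul_measure, ENNReal.toReal_ofReal hK₁, smul_eq_mul] at this

theorem measureReal_Ico_le (h : DensityBounds a b K₁ K₂ ν) (hK₂ : 0 ≤ K₂) {u v : ℝ}
    (hu : a ≤ u) (hv : v ≤ b) (huv : u ≤ v) : ν.real (Set.Ico u v) ≤ K₂ * (v - u) := by
  have := h.setIntegral_le hK₂ (s := Set.Ico u v) (F := fun _ => 1)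
    (fun x hx => ⟨hu.trans hx.1, hx.2.le.trans hv⟩) measurableSet_Ico (fun _ => zero_le_one)
    (by simp)
  simpa [huv] using this

end DensityBounds

/-! ### Integrability of splines and summation over cells -/

section Integrals

variable {a b ρ : ℝ} {q d : ℕ} {ξ : ℕ → ℝ}

theorem abs_splineFun_le_of_mem (h : IsQuasiUniformMesh a b ρ (d - q) ξ)
    {β : EuclideanSpace ℝ (Fin d)} {M : ℝ} (hβ : ∀ k, |β k| ≤ M) {x : ℝ}
    (hx : x ∈ Set.Ico a b) : |splineFun q d ξ β x| ≤ M := by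
  obtain ⟨i, hi, hx⟩ := h.exists_cell hx
  exact abs_splineFun_le h hi hx fun k _ _ => hβ k

theorem EuclideanSpace.abs_le_norm {d : ℕ} (β : EuclideanSpace ℝ (Fin d)) (k : Fin d) :
    |β k| ≤ ‖β‖ := by
  simpa using PiLp.norm_apply_le β k

theorem intervalIntegrable_splineFun (h : IsQuasiUniformMesh a b ρ (d - q) ξ)
    (β : EuclideanSpace ℝ (Fin d)) {u v : ℝ} (hau : a ≤ u) (hvb : v ≤ b) (huv : u ≤ v) :
    IntervalIntegrable (splineFun q d ξ β) volume u v := by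
  rw [intervalIntegrable_iff_integrableOn_Ico_of_le huv]
  refine Measure.integrableOn_of_bounded (M := ‖β‖) (by simp)
    (measurable_splineFun q d ξ β).aestronglyMeasurable ?_
  filter_upwards [ae_restrict_mem measurableSet_Ico] with x hx
  exact abs_splineFun_le_of_mem h (EuclideanSpace.abs_le_norm β) ⟨hau.trans hx.1, hx.2.trans_le hvb⟩

theorem intervalIntegrable_splineFun_sq (h : IsQuasiUniformMesh a b ρ (d - q) ξ)
    (β : EuclideanSpace ℝ (Fin d)) {u v : ℝ} (hau : a ≤ u) (hvb : v ≤ b) (huv : u ≤ v) :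
    IntervalIntegrable (fun x => splineFun q d ξ β x ^ 2) volume u v := by
  rw [intervalIntegrable_iff_integrableOn_Ico_of_le huv]
  refine Measure.integrableOn_of_bounded (M := ‖β‖ ^ 2) (by simp)
    ((measurable_splineFun q d ξ β).pow_const 2).aestronglyMeasurable ?_
  filter_upwards [ae_restrict_mem measurableSet_Ico] with x hx
  rw [Real.norm_eq_abs, abs_pow]
  gcongr
  exact abs_splineFun_le_of_mem h (EuclideanSpace.abs_le_norm β) ⟨hau.trans hx.1, hx.2.trans_le hvb⟩

theorem sum_integral_cells (h : IsQuasiUniformMesh a b ρ (d - q) ξ) {F : ℝ → ℝ}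
    {k₁ k₂ : ℕ} (hk : k₁ ≤ k₂) (hk₂ : k₂ ≤ d - q)
    (hF : ∀ u v, a ≤ u → v ≤ b → u ≤ v → IntervalIntegrable F volume u v) :
    ∑ i ∈ Finset.Ico k₁ k₂, ∫ x in ξ i..ξ (i + 1), F x = ∫ x in ξ k₁..ξ k₂, F x := by
  refine intervalIntegral.sum_integral_adjacent_intervals_Ico hk fun i hi => hF _ _ ?_ ?_ ?_
  · rw [← h.left]; exact h.le_of_le (Nat.zero_le i) (by have := hi.2; omega)
  · rw [← h.right]; exact h.le_of_le (by have := hi.2; omega) le_rfl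
  · exact (h.lt_succ i (by have := hi.2; omega)).le

end Integrals

end Screening

/-! ### Eigenvalues of the Gram matrix -/

namespace Screening

/-- The integral of the square of `|f|` minus its mean is nonnegative. -/
theorem sq_integral_abs_le {f : ℝ → ℝ} {u v : ℝ} (huv : u < v)
    (hf : IntervalIntegrable f volume u v)
    (hf2 : IntervalIntegrable (fun x => f x ^ 2) volume u v) :
    (∫ x in u..v, |f x|) ^ 2 ≤ (v - u) * ∫ x in u..v, f x ^ 2 := by
  set I := ∫ x in u..v, |f x|
  set J := ∫ x in u..v, f x ^ 2
  have hd : 0 < v - u := sub_pos.2 huv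
  have h1 : 0 ≤ ∫ x in u..v, (|f x| - I / (v - u)) ^ 2 :=
    intervalIntegral.integral_nonneg huv.le fun _ _ => sq_nonneg _
  have h2 : ∫ x in u..v, (|f x| - I / (v - u)) ^ 2 =
      J - 2 * (I / (v - u)) * I + (v - u) * (I / (v - u)) ^ 2 := by
    have : ∀ x, (|f x| - I / (v - u)) ^ 2 =
        f x ^ 2 - 2 * (I / (v - u)) * |f x| + (I / (v - u)) ^ 2 := by
      intro x; rw [sub_sq, sq_abs]; ring
    simp only [this]
    rw [intervalIntegral.integral_add (hf2.sub (hf.abs.const_mul _)) (by simp),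
      intervalIntegral.integral_sub hf2 (hf.abs.const_mul _),
      intervalIntegral.integral_const_mul, intervalIntegral.integral_const, smul_eq_mul]
  rw [h2] at h1
  have h3 : J - 2 * (I / (v - u)) * I + (v - u) * (I / (v - u)) ^ 2 = J - I ^ 2 / (v - u) := by
    field_simp; ring
  rw [h3, sub_nonneg, div_le_iff₀ hd] at h1
  linarith

section L2

variable {a b : ℝ}

theorem norm_sq_eq_sum {d : ℕ} (β : EuclideanSpace ℝ (Fin d)) : ‖β‖ ^ 2 = ∑ k, β k ^ 2 := by
  simp [EuclideanSpace.norm_sq_eq]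

theorem integrable_splineFun_sq {K₁ K₂ ρ : ℝ} {ν : Measure ℝ} [IsFiniteMeasure ν]
    (hν : DensityBounds a b K₁ K₂ ν)
    {q d : ℕ} {ξ : ℕ → ℝ} (h : IsQuasiUniformMesh a b ρ (d - q) ξ)
    (β : EuclideanSpace ℝ (Fin d)) : Integrable (fun x => splineFun q d ξ β x ^ 2) ν := by
  refine Integrable.of_bound ((measurable_splineFun q d ξ β).pow_const 2).aestronglyMeasurable
    (‖β‖ ^ 2) ?_
  filter_upwards [hν.ae_mem] with x hx
  rw [Real.norm_eq_abs, abs_pow]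
  gcongr
  exact abs_splineFun_le_of_mem h (EuclideanSpace.abs_le_norm β) hx

/-- The smallest eigenvalue of the Gram matrix of the B-splines is at least of order `1 / d`. -/
theorem exists_gram_lower (hab : a < b) (q : ℕ) (ρ K₁ K₂ : ℝ) (hK₁ : 0 < K₁) :
    ∃ c : ℝ, 0 < c ∧ ∀ (d : ℕ) (ξ : ℕ → ℝ) (ν : Measure ℝ) [IsFiniteMeasure ν], q < d →
      IsQuasiUniformMesh a b ρ (d - q) ξ → DensityBounds a b K₁ K₂ ν →
      ∀ β : EuclideanSpace ℝ (Fin d), c * ‖β‖ ^ 2 / d ≤ ∫ x, splineFun q d ξ β x ^ 2 ∂ν := by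
  obtain ⟨C, hC, hstab⟩ := exists_coeff_le_integral q ρ
  by_cases hρ : 1 ≤ ρ
  swap
  · exact ⟨1, one_pos, fun d ξ ν _ hd h => absurd (h.one_le_ratio (by omega)) hρ⟩
  have hba : 0 < b - a := sub_pos.2 hab
  refine ⟨K₁ * (b - a) / (C ^ 2 * ρ * (q + 1)), by positivity, ?_⟩
  intro d ξ ν _ hd h hν β
  have hd0 : (0 : ℝ) < d := by exact_mod_cast (by omega : 0 < d)
  set J : ℕ → ℝ := fun i => ∫ x in ξ i..ξ (i + 1), splineFun q d ξ β x ^ 2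
  have hJ0 : ∀ i < d - q, 0 ≤ J i := fun i hi =>
    intervalIntegral.integral_nonneg (h.lt_succ i hi).le fun _ _ => sq_nonneg _
  have hsum : ∑ i ∈ Finset.range (d - q), J i = ∫ x in a..b, splineFun q d ξ β x ^ 2 := by
    rw [Finset.range_eq_Ico, sum_integral_cells h (Nat.zero_le _) le_rfl
      fun u v => intervalIntegrable_splineFun_sq h β, h.left, h.right]
  have hcoef : ∀ i < d - q, ∀ k : Fin d, i ≤ (k : ℕ) → (k : ℕ) ≤ i + q →
      β k ^ 2 ≤ C ^ 2 * ρ * d / (b - a) * J i := by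
    intro i hi k hk1 hk2
    have hδ : 0 < ξ (i + 1) - ξ i := sub_pos.2 (h.lt_succ i hi)
    have hai : a ≤ ξ i := by rw [← h.left]; exact h.le_of_le (Nat.zero_le i) hi.le
    have hib : ξ (i + 1) ≤ b := by rw [← h.right]; exact h.le_of_le hi le_rfl
    have h1 := hstab a b d ξ h i hi β k hk1 hk2
    have h2 := sq_integral_abs_le (h.lt_succ i hi)
      (intervalIntegrable_splineFun h β hai hib (h.lt_succ i hi).le)
      (intervalIntegrable_splineFun_sq h β hai hib (h.lt_succ i hi).le)
    have h3 : (|β k| * (ξ (i + 1) - ξ i)) ^ 2 ≤ C ^ 2 * ((ξ (i + 1) - ξ i) * J i) := by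
      calc _ ≤ (C * ∫ x in ξ i..ξ (i + 1), |splineFun q d ξ β x|) ^ 2 := by gcongr
        _ ≤ _ := by rw [mul_pow]; gcongr
    rw [mul_pow, sq_abs] at h3
    have h4 : β k ^ 2 * (ξ (i + 1) - ξ i) ≤ C ^ 2 * J i := by
      nlinarith
    have h5 : b - a ≤ d * ρ * (ξ (i + 1) - ξ i) := by
      refine (h.le_mul_length hi).trans ?_
      rw [mul_assoc]
      have : ((d - q : ℕ) : ℝ) ≤ d := by exact_mod_cast Nat.sub_le d q
      gcongr
    rw [div_mul_eq_mul_div, le_div_iff₀ hba]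
    calc β k ^ 2 * (b - a) ≤ β k ^ 2 * (d * ρ * (ξ (i + 1) - ξ i)) := by gcongr
      _ = d * ρ * (β k ^ 2 * (ξ (i + 1) - ξ i)) := by ring
      _ ≤ d * ρ * (C ^ 2 * J i) := by gcongr
      _ = _ := by ring
  have hnorm : ‖β‖ ^ 2 ≤ C ^ 2 * ρ * d / (b - a) * ((q + 1) * ∑ i ∈ Finset.range (d - q), J i) := by
    rw [norm_sq_eq_sum]
    -- Coefficient `k` is charged to cell `k - q`, on which it is active. By truncated subtraction
    -- cell `0` is charged `q + 1` times and every other cell once, whence the factor `q + 1`.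
    calc ∑ k, β k ^ 2 ≤ ∑ k : Fin d, C ^ 2 * ρ * d / (b - a) * J (k - q) :=
          Finset.sum_le_sum fun k _ => hcoef _ (by omega) k (by omega) (by omega)
      _ = C ^ 2 * ρ * d / (b - a) * ∑ k ∈ Finset.range (q + (d - q)), J (k - q) := by
          rw [Fin.sum_univ_eq_sum_range (fun k => C ^ 2 * ρ * d / (b - a) * J (k - q)),
            Finset.mul_sum, show q + (d - q) = d by omega]
      _ ≤ _ := by
          refine mul_le_mul_of_nonneg_left ?_ (by positivity)
          have e : ∀ k ∈ Finset.range q, J (k - q) = J 0 := fun k hk => by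
            rw [Finset.mem_range] at hk
            rw [show k - q = 0 by omega]
          have hJ0' : J 0 ≤ ∑ i ∈ Finset.range (d - q), J i :=
            Finset.single_le_sum (f := J) (fun i hi => hJ0 i (Finset.mem_range.1 hi))
              (Finset.mem_range.2 (by omega))
          rw [Finset.sum_range_add, Finset.sum_congr rfl e]
          simp only [Finset.sum_const, Finset.card_range, nsmul_eq_mul, Nat.add_sub_cancel_left]
          have : (q : ℝ) * J 0 ≤ q * ∑ i ∈ Finset.range (d - q), J i := by gcongr
          linarith
  have hint : K₁ * ∫ x in a..b, splineFun q d ξ β x ^ 2 ≤ ∫ x, splineFun q d ξ β x ^ 2 ∂ν := by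
    have h1 := hν.le_setIntegral hK₁.le (s := Set.Ioc a b) Set.Ioc_subset_Icc_self measurableSet_Ioc
      (F := fun x => splineFun q d ξ β x ^ 2) (fun _ => sq_nonneg _)
      (integrable_splineFun_sq hν h β).integrableOn
    rw [intervalIntegral.integral_of_le hab.le]
    exact h1.trans (setIntegral_le_integral (integrable_splineFun_sq hν h β)
      (Eventually.of_forall fun _ => sq_nonneg _))
  refine le_trans ?_ hint
  rw [← hsum, div_le_iff₀ hd0]
  calc _ ≤ K₁ * (b - a) / (C ^ 2 * ρ * (q + 1)) *
        (C ^ 2 * ρ * d / (b - a) * ((q + 1) * ∑ i ∈ Finset.range (d - q), J i)) := by gcongr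
    _ = _ := by field_simp

/-- The largest eigenvalue of the Gram matrix of the B-splines is at most of order `1 / d`. -/
theorem exists_gram_upper (hab : a < b) (q : ℕ) (ρ K₁ K₂ : ℝ) (hK₂ : 0 < K₂) :
    ∃ C : ℝ, 0 < C ∧ ∀ (d : ℕ) (ξ : ℕ → ℝ) (ν : Measure ℝ) [IsFiniteMeasure ν], q < d →
      IsQuasiUniformMesh a b ρ (d - q) ξ → DensityBounds a b K₁ K₂ ν →
      ∀ β : EuclideanSpace ℝ (Fin d), ∫ x, splineFun q d ξ β x ^ 2 ∂ν ≤ C * ‖β‖ ^ 2 / d := by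
  by_cases hρ : 1 ≤ ρ
  swap
  · exact ⟨1, one_pos, fun d ξ ν _ hd h => absurd (h.one_le_ratio (by omega)) hρ⟩
  have hba : 0 < b - a := sub_pos.2 hab
  refine ⟨K₂ * (ρ * (b - a) * (q + 1) * (q + 1)), by positivity, ?_⟩
  intro d ξ ν _ hd h hν β
  have hd0 : (0 : ℝ) < d := by exact_mod_cast (by omega : 0 < d)
  have hint : ∫ x, splineFun q d ξ β x ^ 2 ∂ν ≤ K₂ * ∫ x in a..b, splineFun q d ξ β x ^ 2 := by
    have h1 := hν.setIntegral_le hK₂.le (s := Set.Ico a b) Set.Ico_subset_Icc_self measurableSet_Ico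
      (F := fun x => splineFun q d ξ β x ^ 2) (fun _ => sq_nonneg _)
      ((intervalIntegrable_iff_integrableOn_Ico_of_le hab.le).1
        (intervalIntegrable_splineFun_sq h β le_rfl le_rfl hab.le))
    rw [intervalIntegral.integral_of_le hab.le, ← integral_Ico_eq_integral_Ioc]
    rwa [Measure.restrict_eq_self_of_ae_mem hν.ae_mem] at h1
  refine hint.trans ?_
  rw [mul_assoc, mul_div_assoc]
  refine mul_le_mul_of_nonneg_left ?_ hK₂.le
  rw [← h.left, ← h.right, ← sum_integral_cells h (Nat.zero_le _) le_rfl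
      fun u v => intervalIntegrable_splineFun_sq h β, ← Finset.range_eq_Ico, h.left, h.right]
  have hcell : ∀ i ∈ Finset.range (d - q), ∫ x in ξ i..ξ (i + 1), splineFun q d ξ β x ^ 2 ≤
      ∑ k : Fin d, if i ≤ (k : ℕ) ∧ (k : ℕ) ≤ i + q then
        ρ * (b - a) * (q + 1) / d * β k ^ 2 else 0 := by
    intro i hi
    rw [Finset.mem_range] at hi
    have hδ : 0 < ξ (i + 1) - ξ i := sub_pos.2 (h.lt_succ i hi)
    have hai : a ≤ ξ i := by rw [← h.left]; exact h.le_of_le (Nat.zero_le i) hi.le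
    have hib : ξ (i + 1) ≤ b := by rw [← h.right]; exact h.le_of_le hi le_rfl
    set S := ∑ k : Fin d, if i ≤ (k : ℕ) ∧ (k : ℕ) ≤ i + q then β k ^ 2 else 0
    have hS0 : 0 ≤ S := Finset.sum_nonneg fun k _ => by split_ifs <;> positivity
    have h1 : ∫ x in ξ i..ξ (i + 1), splineFun q d ξ β x ^ 2 ≤ (ξ (i + 1) - ξ i) * S := by
      have := intervalIntegral.integral_mono_on_of_le_Ioo (h.lt_succ i hi).le
        (intervalIntegrable_splineFun_sq h β hai hib (h.lt_succ i hi).le)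
        (intervalIntegrable_const (c := S))
        (fun x hx => splineFun_sq_le h hi (Set.Ioo_subset_Ico_self hx) β)
      simpa using this
    have h2 : (ξ (i + 1) - ξ i) ≤ ρ * (b - a) * (q + 1) / d := by
      rw [le_div_iff₀ hd0]
      have h3 := h.mul_length_le hi
      have h4 : (d : ℝ) ≤ (q + 1) * (d - q : ℕ) := by
        have : d ≤ (q + 1) * (d - q) := by
          obtain ⟨N, rfl⟩ : ∃ N, d = q + (N + 1) := ⟨d - q - 1, by omega⟩
          rw [Nat.add_sub_cancel_left]; nlinarith
        exact_mod_cast this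
      calc (ξ (i + 1) - ξ i) * d ≤ (ξ (i + 1) - ξ i) * ((q + 1) * (d - q : ℕ)) := by gcongr
        _ = (q + 1) * ((d - q : ℕ) * (ξ (i + 1) - ξ i)) := by ring
        _ ≤ (q + 1) * (ρ * (b - a)) := by gcongr
        _ = _ := by ring
    refine h1.trans ((mul_le_mul_of_nonneg_right h2 hS0).trans (le_of_eq ?_))
    rw [Finset.mul_sum]
    exact Finset.sum_congr rfl fun k _ => by split_ifs <;> simp
  refine (Finset.sum_le_sum hcell).trans ?_
  rw [Finset.sum_comm, norm_sq_eq_sum, Finset.mul_sum, Finset.sum_div]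
  refine Finset.sum_le_sum fun k _ => ?_
  -- After the exchange of the sums, each coefficient is counted once for every cell on which it is
  -- active, at most `q + 1` times.
  rw [← Finset.sum_filter, Finset.sum_const, nsmul_eq_mul]
  have hcard : ((Finset.range (d - q)).filter
      fun i => i ≤ (k : ℕ) ∧ (k : ℕ) ≤ i + q).card ≤ q + 1 := by
    calc _ ≤ (Finset.Icc ((k : ℕ) - q) k).card := Finset.card_le_card fun i hi => by
          simp only [Finset.mem_filter, Finset.mem_Icc] at hi ⊢; omega
      _ ≤ q + 1 := by rw [Nat.card_Icc]; omega
  have hcard' : ((((Finset.range (d - q)).filter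
      fun i => i ≤ (k : ℕ) ∧ (k : ℕ) ≤ i + q).card : ℕ) : ℝ) ≤ q + 1 := by exact_mod_cast hcard
  calc _ ≤ ((q : ℝ) + 1) * (ρ * (b - a) * (q + 1) / d * β k ^ 2) := by gcongr
    _ = _ := by ring

end L2

/-! ### A bound for the coefficients that does not depend on the dimension -/

/-- A uniform bound for the coefficients of splines whose risk cannot be decreased by setting
blocks of coefficients to zero. The risk enters only through lower bounds of the pointwise
difference of risks. -/
theorem exists_coeff_bound {a b : ℝ} (q : ℕ) (ρ K₁ K₂ c K : ℝ) (hK₁ : 0 < K₁)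
    (hK₂ : 0 < K₂) (hc : 0 < c) (hK : 0 ≤ K) (L : ℝ → ℝ) (hL : ∀ R, 0 ≤ L R) :
    ∃ R : ℝ, 0 ≤ R ∧ ∀ (d : ℕ) (ξ : ℕ → ℝ) (ν : Measure ℝ) [IsFiniteMeasure ν], q < d →
      IsQuasiUniformMesh a b ρ (d - q) ξ → DensityBounds a b K₁ K₂ ν →
      ∀ β : EuclideanSpace ℝ (Fin d),
      (∀ (M : ℝ) (β' : EuclideanSpace ℝ (Fin d)) (v : ℝ → ℝ), 0 ≤ M → (∃ B, ∀ t ∈ Set.Ico a b, |v t| ≤ B) →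
        Measurable v →
        (∀ t ∈ Set.Ico a b,
          (splineFun q d ξ β t = splineFun q d ξ β' t ∧ v t ≤ 0) ∨
          (splineFun q d ξ β' t = 0 ∧ v t ≤ c * |splineFun q d ξ β t| - K) ∨
          (|splineFun q d ξ β t| ≤ M ∧ |splineFun q d ξ β' t| ≤ M ∧ v t ≤ - L M * (2 * M))) →
        ∫ t, v t ∂ν ≤ 0) → ∀ k, |β k| ≤ R := by
  obtain ⟨C, hC, hstab⟩ := exists_coeff_le_integral q ρ
  by_cases hρ : 1 ≤ ρ
  swap
  · exact ⟨1, zero_le_one, fun d ξ ν _ hd h => absurd (h.one_le_ratio (by omega)) hρ⟩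
  -- Chosen such that one coefficient above `M` makes the gain on its cell at least `q` times the
  -- largest possible loss on a cell, even after lengths are compared through the mesh ratio.
  set M : ℝ := C * (K * K₂ * (1 + q * ρ ^ 2)) / (K₁ * c)
  have hM : 0 ≤ M := by positivity
  set T : ℝ := L M * (2 * M)
  have hT : 0 ≤ T := mul_nonneg (hL M) (by positivity)
  set R : ℝ := C * (K * K₂ + 2 * (q * (K * K₂ * ρ)) + T * (K₂ * (2 * (q * ρ)))) / (K₁ * c)
  refine ⟨R ⊔ M, le_sup_of_le_right hM, ?_⟩
  intro d ξ ν _ hd h hν β hmin k₀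
  refine le_sup_iff.2 (or_iff_not_imp_right.2 fun hk₀ => ?_)
  rw [not_le] at hk₀
  classical
  set N := d - q
  set m₀ : ℕ := k₀ - q
  have hm₀ : m₀ < N := by omega
  set δ := ξ (m₀ + 1) - ξ m₀
  have hδ : 0 < δ := sub_pos.2 (h.lt_succ m₀ hm₀)
  set f := splineFun q d ξ β
  -- A lower bound for the integral of `c * |f| - K` over cell `i`, that is, for the gain from
  -- replacing the spline by zero there. The positive part takes the lower density bound, the
  -- negative part the upper one.
  set E : ℕ → ℝ := fun i => K₁ * c * (∫ x in ξ i..ξ (i + 1), |f x|) -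
    K * K₂ * (ξ (i + 1) - ξ i)
  set big : ℕ → Prop := fun i => ∃ k : Fin d, i ≤ (k : ℕ) ∧ (k : ℕ) ≤ i + q ∧ M < |β k|
  have hEcoef : ∀ i < N, ∀ k : Fin d, i ≤ (k : ℕ) → (k : ℕ) ≤ i + q →
      K₁ * c * |β k| / C * (ξ (i + 1) - ξ i) - K * K₂ * (ξ (i + 1) - ξ i) ≤ E i := by
    intro i hi k h1 h2
    have h3 := hstab a b d ξ h i hi β k h1 h2
    have h4 : K₁ * c / C * (|β k| * (ξ (i + 1) - ξ i)) ≤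
      K₁ * c / C * (C * ∫ x in ξ i..ξ (i + 1), |f x|) := by gcongr
    have h5 : K₁ * c / C * (C * ∫ x in ξ i..ξ (i + 1), |f x|) =
      K₁ * c * (∫ x in ξ i..ξ (i + 1), |f x|) := by field_simp
    have h6 : K₁ * c / C * (|β k| * (ξ (i + 1) - ξ i)) =
      K₁ * c * |β k| / C * (ξ (i + 1) - ξ i) := by ring
    simp only [E]
    linarith
  have hElow : ∀ i < N, -(K * K₂ * ρ * δ) ≤ E i := by
    intro i hi
    have h1 : 0 ≤ ∫ x in ξ i..ξ (i + 1), |f x| :=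
      intervalIntegral.integral_nonneg (h.lt_succ i hi).le fun _ _ => abs_nonneg _
    have h2 : K * K₂ * (ξ (i + 1) - ξ i) ≤ K * K₂ * (ρ * δ) := by
      have := h.ratio i hi m₀ hm₀
      gcongr
    have h3 : 0 ≤ K₁ * c * (∫ x in ξ i..ξ (i + 1), |f x|) := by positivity
    simp only [E]
    linarith
  have hEbig : ∀ i < N, big i → q * (K * K₂ * ρ * δ) ≤ E i := by
    rintro i hi ⟨k, h1, h2, h3⟩
    refine le_trans ?_ (hEcoef i hi k h1 h2)
    have hδi : 0 < ξ (i + 1) - ξ i := sub_pos.2 (h.lt_succ i hi)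
    have h4 : K₁ * c * M / C * (ξ (i + 1) - ξ i) ≤ K₁ * c * |β k| / C * (ξ (i + 1) - ξ i) := by
      gcongr
    have h5 : K₁ * c * M / C = K * K₂ * (1 + q * ρ ^ 2) := by
      simp only [M]; field_simp
    have h6 : q * (K * K₂ * ρ * δ) ≤ q * (K * K₂ * ρ * (ρ * (ξ (i + 1) - ξ i))) := by
      have := h.ratio m₀ hm₀ i hi
      gcongr
    rw [h5] at h4
    linarith
  obtain ⟨k₁, k₂, hk₁m, hmk₂, hk₂N, hsm₁, hsm₂, hsum⟩ := exists_block E big N q (K * K₂ * ρ * δ)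
    (by positivity) hElow hEbig m₀ hm₀
  set k₃ := min (k₂ + q) N
  have hmono : ∀ {i j}, i ≤ j → j ≤ N → ξ i ≤ ξ j := fun h1 h2 => h.le_of_le h1 h2
  have haξ : ∀ i ≤ N, a ≤ ξ i := fun i hi => by rw [← h.left]; exact hmono (Nat.zero_le _) hi
  have hξb : ∀ i ≤ N, ξ i ≤ b := fun i hi => by rw [← h.right]; exact hmono hi le_rfl
  -- the competitor
  set β' : EuclideanSpace ℝ (Fin d) :=
    WithLp.toLp 2 fun k => if k₁ ≤ (k : ℕ) ∧ (k : ℕ) < k₂ + q then 0 else β k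
  have hβ' : ∀ k, β' k = if k₁ ≤ (k : ℕ) ∧ (k : ℕ) < k₂ + q then 0 else β k := fun k => rfl
  -- On `A` the competitor vanishes. `B₁` and `B₂` are the fences, where zeroed and kept
  -- coefficients meet: no coefficient active there exceeds `M`, so both splines stay below `M` and
  -- the loss is at most `T`. Elsewhere the splines coincide. Fences are cut off at the ends of the
  -- mesh.
  set A := Set.Ico (ξ k₁) (ξ k₂)
  set B₁ := Set.Ico (ξ (k₁ - q)) (ξ k₁)
  set B₂ := Set.Ico (ξ k₂) (ξ k₃)
  set v : ℝ → ℝ := fun t => A.indicator (fun t => c * |f t| - K) t -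
    (B₁.indicator (fun _ => T) t + B₂.indicator (fun _ => T) t)
  have hfm : Measurable f := measurable_splineFun q d ξ β
  have hAm : MeasurableSet A := measurableSet_Ico
  have hB₁m : MeasurableSet B₁ := measurableSet_Ico
  have hB₂m : MeasurableSet B₂ := measurableSet_Ico
  have hfb : ∀ t ∈ Set.Ico a b, |f t| ≤ ‖β‖ := fun t ht =>
    abs_splineFun_le_of_mem h (EuclideanSpace.abs_le_norm β) ht
  have hvm : Measurable v := by
    refine Measurable.sub ?_ (Measurable.add ?_ ?_)
    · exact ((hfm.norm.const_mul c).sub_const K).indicator hAm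
    · exact measurable_const.indicator hB₁m
    · exact measurable_const.indicator hB₂m
  have hgF : ∀ t ∈ Set.Ico a b, |A.indicator (fun t => c * |f t| - K) t| ≤ c * ‖β‖ + K := by
    intro t ht
    rw [Set.indicator_apply]
    have := hfb t ht
    split_ifs
    · have h1 : c * |f t| ≤ c * ‖β‖ := by gcongr
      have h2 : 0 ≤ c * |f t| := by positivity
      rw [abs_le]; constructor <;> linarith [norm_nonneg β]
    · rw [abs_zero]; positivity
  have hgB : ∀ (B : Set ℝ) t, |B.indicator (fun _ => T) t| ≤ T := by
    intro B t
    rw [Set.indicator_apply]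
    split_ifs
    · rw [abs_of_nonneg hT]
    · simpa using hT
  have key := hmin M β' v hM ⟨c * ‖β‖ + K + (T + T), fun t ht => by
      have h1 := hgF t ht
      have h2 := hgB B₁ t
      have h3 := hgB B₂ t
      rw [abs_le] at *
      simp only [v]
      constructor <;> linarith⟩ hvm (by
    intro t ht
    obtain ⟨i, hi, hit⟩ := h.exists_cell ht
    have cell_mem : ∀ {s u}, s ≤ N → u ≤ N → (t ∈ Set.Ico (ξ s) (ξ u) ↔ s ≤ i ∧ i < u) := by
      intro s u hs hu
      constructor
      · rintro ⟨h1, h2⟩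
        constructor
        · by_contra! h3
          have := hmono (show i + 1 ≤ s by omega) hs
          linarith [hit.2]
        · by_contra! h3
          have := hmono h3 hi.le
          linarith [hit.1]
      · rintro ⟨h1, h2⟩
        exact ⟨(hmono h1 hi.le).trans hit.1, hit.2.trans_le (hmono (show i + 1 ≤ u by omega) hu)⟩
    have hA : t ∈ A ↔ k₁ ≤ i ∧ i < k₂ := cell_mem (by omega) hk₂N
    have hB₁ : t ∈ B₁ ↔ k₁ - q ≤ i ∧ i < k₁ := cell_mem (by omega) (by omega)
    have hB₂ : t ∈ B₂ ↔ k₂ ≤ i ∧ i < k₃ := cell_mem hk₂N (min_le_right _ _)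
    have small : ¬ big i → |f t| ≤ M ∧ |splineFun q d ξ β' t| ≤ M ∧ -T ≤ - L M * (2 * M) := by
      intro hb
      have hb' : ∀ k : Fin d, i ≤ (k : ℕ) → (k : ℕ) ≤ i + q → |β k| ≤ M := by
        intro k h1 h2
        by_contra! h3
        exact hb ⟨k, h1, h2, h3⟩
      refine ⟨abs_splineFun_le h hi hit hb', abs_splineFun_le h hi hit fun k h1 h2 => ?_,
        by simp only [T]; linarith⟩
      rw [hβ']
      split_ifs
      · simpa using hM
      · exact hb' k h1 h2
    by_cases h1 : k₁ ≤ i ∧ i < k₂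
    · right; left
      constructor
      · rw [splineFun_congr h hi hit (β' := 0) fun k h2 h3 => by
          rw [hβ', if_pos ⟨by omega, by omega⟩]; rfl]
        simp [splineFun]
      · have : t ∉ B₁ := fun h2 => by have := hB₁.1 h2; omega
        have h3 : t ∉ B₂ := fun h2 => by have := hB₂.1 h2; omega
        simp [v, hA.2 h1, this, h3, f]
    · have hnA : t ∉ A := fun h2 => h1 (hA.1 h2)
      by_cases h2 : k₁ - q ≤ i ∧ i < k₁
      · right; right
        have h3 : t ∉ B₂ := fun h3 => by have := hB₂.1 h3; omega
        obtain ⟨hM1, hM2, hM3⟩ := small (hsm₁ i h2.2 (by omega))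
        refine ⟨hM1, hM2, ?_⟩
        simpa [v, hnA, hB₁.2 h2, h3] using hM3
      · have hnB₁ : t ∉ B₁ := fun h3 => h2 (hB₁.1 h3)
        by_cases h3 : k₂ ≤ i ∧ i < k₂ + q
        · right; right
          obtain ⟨hM1, hM2, hM3⟩ := small (hsm₂ i hi h3.1 h3.2)
          refine ⟨hM1, hM2, ?_⟩
          simpa [v, hnA, hnB₁, hB₂.2 ⟨h3.1, by omega⟩] using hM3
        · left
          have hnB₂ : t ∉ B₂ := fun h4 => by have := hB₂.1 h4; omega
          constructor
          · refine splineFun_congr h hi hit fun k h4 h5 => ?_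
            rw [hβ', if_neg (by omega)]
          · simp [v, hnA, hnB₁, hnB₂])
  have hiF : Integrable (fun t => A.indicator (fun t => c * |f t| - K) t) ν := by
    refine Integrable.of_bound
      (((hfm.norm.const_mul c).sub_const K).indicator hAm).aestronglyMeasurable (c * ‖β‖ + K) ?_
    filter_upwards [hν.ae_mem] with t ht using hgF t ht
  have hiT : ∀ B, MeasurableSet B → Integrable (fun t => B.indicator (fun _ => T) t) ν :=
    fun B hB => (integrable_const T).indicator hB
  have hABsub : ∀ {i j}, i ≤ N → j ≤ N → Set.Ico (ξ i) (ξ j) ⊆ Set.Icc a b := fun h1 h2 x hx =>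
    ⟨(haξ _ h1).trans hx.1, hx.2.le.trans (hξb _ h2)⟩
  have hfi : Integrable (fun t => |f t|) ν := by
    refine Integrable.of_bound hfm.norm.aestronglyMeasurable ‖β‖ ?_
    filter_upwards [hν.ae_mem] with t ht
    simpa using hfb t ht
  have hk₁₂ : k₁ ≤ k₂ := by omega
  have h1 : ∫ t, v t ∂ν = (∫ t in A, (c * |f t| - K) ∂ν) - (ν.real B₁ * T + ν.real B₂ * T) := by
    simp only [v]
    have hiTT : Integrable (fun t => B₁.indicator (fun _ => T) t + B₂.indicator (fun _ => T) t) ν :=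
      (hiT B₁ hB₁m).add (hiT B₂ hB₂m)
    rw [integral_sub hiF hiTT, integral_add (hiT B₁ hB₁m) (hiT B₂ hB₂m), integral_indicator hAm,
      integral_indicator_const _ hB₁m, integral_indicator_const _ hB₂m, smul_eq_mul, smul_eq_mul]
  have h2 : ∫ t in A, (c * |f t| - K) ∂ν = c * (∫ t in A, |f t| ∂ν) - ν.real A * K := by
    rw [integral_sub (hfi.integrableOn.const_mul c) (integrable_const K), integral_const_mul]
    simp
  have h3 : K₁ * ∫ t in ξ k₁..ξ k₂, |f t| ≤ ∫ t in A, |f t| ∂ν := by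
    have := hν.le_setIntegral hK₁.le (hABsub (by omega) hk₂N) hAm (F := fun t => |f t|)
      (fun _ => abs_nonneg _) hfi.integrableOn
    rwa [intervalIntegral.integral_of_le (hmono hk₁₂ hk₂N), ← integral_Ico_eq_integral_Ioc]
  have h4 : ν.real A ≤ K₂ * (ξ k₂ - ξ k₁) :=
    hν.measureReal_Ico_le hK₂.le (haξ _ (by omega)) (hξb _ hk₂N) (hmono hk₁₂ hk₂N)
  have h5 : ν.real B₁ ≤ K₂ * (q * (ρ * δ)) := by
    refine (hν.measureReal_Ico_le hK₂.le (haξ _ (by omega)) (hξb _ (by omega))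
      (hmono (by omega) (by omega))).trans ?_
    gcongr
    refine (h.sub_le hm₀ (Nat.sub_le k₁ q) (by omega)).trans ?_
    have : ((k₁ - (k₁ - q) : ℕ) : ℝ) ≤ q := by exact_mod_cast (by omega)
    gcongr
  have h6 : ν.real B₂ ≤ K₂ * (q * (ρ * δ)) := by
    refine (hν.measureReal_Ico_le hK₂.le (haξ _ (by omega)) (hξb _ (by omega))
      (hmono (by omega) (by omega))).trans ?_
    gcongr
    refine (h.sub_le hm₀ (show k₂ ≤ k₃ by omega) (by omega)).trans ?_
    have : ((k₃ - k₂ : ℕ) : ℝ) ≤ q := by exact_mod_cast (by omega)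
    gcongr
  have h7 : ∑ i ∈ Finset.Ico k₁ k₂, E i =
      K₁ * c * (∫ t in ξ k₁..ξ k₂, |f t|) - K * K₂ * (ξ k₂ - ξ k₁) := by
    simp only [E]
    rw [Finset.sum_sub_distrib, ← Finset.mul_sum, ← Finset.mul_sum,
      sum_integral_cells h hk₁₂ hk₂N fun u w h1 h2 h3 => (intervalIntegrable_splineFun h β h1 h2 h3).abs,
      Finset.sum_Ico_eq_sub _ hk₁₂, Finset.sum_range_sub, Finset.sum_range_sub]
    ring
  have h8 : ∑ i ∈ Finset.Ico k₁ k₂, E i ≤ T * (K₂ * (2 * (q * ρ))) * δ := by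
    rw [h7]
    have e1 : c * (K₁ * ∫ t in ξ k₁..ξ k₂, |f t|) ≤ c * ∫ t in A, |f t| ∂ν := by gcongr
    have e2 : ν.real A * K ≤ K₂ * (ξ k₂ - ξ k₁) * K := by gcongr
    have e3 : ν.real B₁ * T ≤ K₂ * (q * (ρ * δ)) * T := by gcongr
    have e4 : ν.real B₂ * T ≤ K₂ * (q * (ρ * δ)) * T := by gcongr
    rw [h1, h2] at key
    linarith
  have h9 := hEcoef m₀ hm₀ k₀ (by omega) (by omega)
  -- Gain and cost are both proportional to the local mesh width `δ`. It cancels, which is why `R`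
  -- does not depend on `d`.
  have h10 : K₁ * c * |β k₀| / C * δ ≤
      (K * K₂ + 2 * (q * (K * K₂ * ρ)) + T * (K₂ * (2 * (q * ρ)))) * δ := by
    simp only [δ] at *
    linarith
  have h11 := le_of_mul_le_mul_right h10 hδ
  rw [div_le_iff₀ hC] at h11
  simp only [R]
  rw [le_div_iff₀ (by positivity)]
  linarith

end Screening

namespace Screening

/-! ### Convex functions of one real variable -/

/-- The upper bound is attained at the end points; the lower one follows by reflection, since `2 * f
0 ≤ f w + f (-w)`. It dominates the loss at random bounded arguments by its values at three fixed
ones. -/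
theorem ConvexOn.abs_le_of_abs_le {f : ℝ → ℝ} (hf : ConvexOn ℝ Set.univ f) {R w : ℝ}
    (hw : |w| ≤ R) : |f w| ≤ |f R| + |f (-R)| + 2 * |f 0| := by
  have hR : 0 ≤ R := (abs_nonneg w).trans hw
  have up : ∀ w, |w| ≤ R → f w ≤ |f R| + |f (-R)| := by
    intro w hw
    have h1 := hf.le_max_of_mem_Icc (x := -R) (y := R) (z := w) trivial trivial (abs_le.1 hw)
    refine h1.trans (max_le ?_ ?_)
    · linarith [le_abs_self (f (-R)), abs_nonneg (f R)]
    · linarith [le_abs_self (f R), abs_nonneg (f (-R))]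
  have h1 := up w hw
  have h2 := up (-w) (by rwa [abs_neg])
  have h3 := hf.2 (Set.mem_univ w) (Set.mem_univ (-w)) (by norm_num : (0 : ℝ) ≤ 1 / 2)
    (by norm_num : (0 : ℝ) ≤ 1 / 2) (by norm_num)
  simp only [smul_eq_mul] at h3
  rw [show 1 / 2 * w + 1 / 2 * -w = 0 by ring] at h3
  have h4 := neg_abs_le (f 0)
  have h5 := abs_nonneg (f 0)
  rw [abs_le]
  constructor <;> linarith

/-- Slopes of a convex function increase, so every slope to the left of `R` is at most the slope
from `R` to `w`, and this is at most the subgradient at `w`. One good point `w` thus controls the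
whole interval. -/
theorem ConvexOn.sub_le_of_subgradient {f : ℝ → ℝ} (hf : ConvexOn ℝ Set.univ f) {R w g : ℝ}
    (hw : R < w) (hg : f w + g * (R - w) ≤ f R) {u v : ℝ} (huv : u ≤ v) (hv : v ≤ R) :
    f v - f u ≤ g * (v - u) := by
  rcases huv.eq_or_lt with rfl | huv
  · simp
  have h1 : (f w - f R) / (w - R) ≤ g := by
    rw [div_le_iff₀ (by linarith)]; linarith
  have h2 : (f v - f u) / (v - u) ≤ g := by
    rcases hv.eq_or_lt with rfl | hv
    · exact (hf.slope_mono_adjacent trivial trivial huv hw).trans h1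
    · exact (hf.slope_mono_adjacent trivial trivial huv hv).trans
        ((hf.slope_mono_adjacent trivial trivial hv hw).trans h1)
  rwa [div_le_iff₀ (by linarith)] at h2

theorem ConvexOn.le_sub_of_subgradient {f : ℝ → ℝ} (hf : ConvexOn ℝ Set.univ f) {R w g : ℝ}
    (hw : w < R) (hg : f w + g * (R - w) ≤ f R) {u v : ℝ} (huv : u ≤ v) (hu : R ≤ u) :
    g * (v - u) ≤ f v - f u := by
  rcases huv.eq_or_lt with rfl | huv
  · simp
  have h1 : g ≤ (f R - f w) / (R - w) := by
    rw [le_div_iff₀ (by linarith)]; linarith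
  have h2 : g ≤ (f v - f u) / (v - u) := by
    rcases hu.eq_or_lt with rfl | hu
    · exact h1.trans (hf.slope_mono_adjacent trivial trivial hw huv)
    · exact h1.trans ((hf.slope_mono_adjacent trivial trivial hw hu).trans
        (hf.slope_mono_adjacent trivial trivial hu huv))
  rwa [le_div_iff₀ (by linarith)] at h2

theorem strongConvexOn_of_le_deriv2 {r : ℝ → ℝ} (hr : ContDiff ℝ 2 r) {R c : ℝ}
    (hc : ∀ w, |w| ≤ R → c ≤ deriv (deriv r) w) : StrongConvexOn (Set.Icc (-R) R) c r := by
  rw [strongConvexOn_iff_convex]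
  have hd1 : Differentiable ℝ r := hr.differentiable (by norm_num)
  have hd2 : Differentiable ℝ (deriv r) :=
    ((contDiff_succ_iff_deriv (n := 1)).1 hr).2.2.differentiable (by norm_num)
  have e1 : (fun x : ℝ => r x - c / 2 * ‖x‖ ^ 2) = fun x => r x - c / 2 * x ^ 2 := by
    ext x; simp
  have h1 : ∀ x, HasDerivAt (fun x : ℝ => r x - c / 2 * x ^ 2) (deriv r x - c * x) x := by
    intro x
    have := (hd1 x).hasDerivAt.sub (((hasDerivAt_id x).pow 2).const_mul (c / 2))
    convert! this using 1
    simp; ring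
  have e2 : deriv (fun x : ℝ => r x - c / 2 * x ^ 2) = fun x => deriv r x - c * x :=
    funext fun x => (h1 x).deriv
  have h2 : ∀ x, HasDerivAt (fun x : ℝ => deriv r x - c * x) (deriv (deriv r) x - c) x := by
    intro x
    have := (hd2 x).hasDerivAt.sub ((hasDerivAt_id x).const_mul c)
    convert! this using 1
    simp
  rw [e1]
  refine convexOn_of_deriv2_nonneg (convex_Icc _ _)
    (fun x _ => (h1 x).continuousAt.continuousWithinAt)
    (fun x _ => (h1 x).differentiableAt.differentiableWithinAt) ?_ ?_
  · rw [e2]; exact fun x _ => (h2 x).differentiableAt.differentiableWithinAt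
  · intro x hx
    rw [Function.iterate_succ, Function.iterate_one, Function.comp_apply, e2, (h2 x).deriv]
    rw [interior_Icc] at hx
    linarith [hc x (abs_le.2 ⟨hx.1.le, hx.2.le⟩)]

/-- Linear growth of a convex function that is strongly convex around its minimizer. -/
theorem growth_of_isMinOn {r : ℝ → ℝ} {M c θ : ℝ} (hr : ConvexOn ℝ Set.univ r)
    (hs : StrongConvexOn (Set.Icc (-(M + 1)) (M + 1)) c r) (hc : 0 ≤ c)
    (hθ : IsMinOn r Set.univ θ) (hM : |θ| ≤ M) (w : ℝ) :
    c / 4 * (|w| - M - 1) ≤ r w - r θ := by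
  have hmin : ∀ w, r θ ≤ r w := fun w => hθ (Set.mem_univ w)
  by_cases hw : |w - θ| ≤ 1
  · have h1 : |w| ≤ |w - θ| + |θ| := by simpa using abs_add_le (w - θ) θ
    have := hmin w
    nlinarith
  · rw [not_le] at hw
    -- `y` is the point at distance one from `θ` in the direction of `w`. Strong convexity at the
    -- midpoint of `θ` and `y` gives a gain of `c / 4` at `y`, and convexity extends it linearly to
    -- `w`.
    set t := |w - θ|⁻¹
    have ht : 0 < t := inv_pos.2 (by linarith)
    have ht1 : t ≤ 1 := inv_le_one_of_one_le₀ hw.le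
    set y := θ + t * (w - θ)
    have hy1 : |y - θ| = 1 := by
      simp only [y, add_sub_cancel_left, abs_mul, abs_of_pos ht]
      exact inv_mul_cancel₀ (by linarith)
    have hyM : |y| ≤ M + 1 := by
      have h1 : |y| ≤ |y - θ| + |θ| := by simpa using abs_add_le (y - θ) θ
      linarith
    have h1 := hs.2 (abs_le.1 (hM.trans (by linarith : M ≤ M + 1))) (abs_le.1 hyM)
      (by norm_num : (0 : ℝ) ≤ 1 / 2) (by norm_num : (0 : ℝ) ≤ 1 / 2) (by norm_num)
    have h2 := hmin ((1 / 2 : ℝ) • θ + (1 / 2 : ℝ) • y)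
    rw [norm_sub_rev, Real.norm_eq_abs, hy1] at h1
    simp only [smul_eq_mul] at h1 h2
    have h3 := hr.2 (Set.mem_univ θ) (Set.mem_univ w) (by linarith : 0 ≤ 1 - t) ht.le
      (by ring)
    simp only [smul_eq_mul] at h3
    rw [show (1 - t) * θ + t * w = y by simp only [y]; ring] at h3
    have h4 : c / 4 ≤ t * (r w - r θ) := by nlinarith
    have h5 : c / 4 * |w - θ| ≤ r w - r θ := by
      have : |w - θ| * t = 1 := mul_inv_cancel₀ (by linarith)
      calc c / 4 * |w - θ| ≤ t * (r w - r θ) * |w - θ| := by gcongr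
        _ = (|w - θ| * t) * (r w - r θ) := by ring
        _ = _ := by rw [this, one_mul]
    refine le_trans ?_ h5
    gcongr
    have h1 : |w| ≤ |w - θ| + |θ| := by simpa using abs_add_le (w - θ) θ
    linarith

theorem exp_le_one_add_add_sq_mul_exp_abs (u : ℝ) :
    Real.exp u ≤ 1 + u + u ^ 2 * Real.exp |u| := by
  have h1 : Real.exp u * (1 - u) ≤ 1 := by
    have := Real.add_one_le_exp (-u)
    calc Real.exp u * (1 - u) ≤ Real.exp u * Real.exp (-u) := by gcongr; linarith
      _ = 1 := by rw [← Real.exp_add]; simp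
  rcases le_total 0 u with hu | hu
  · rw [abs_of_nonneg hu]
    nlinarith
  · have h2 := Real.add_one_le_exp u
    have h3 := Real.one_le_exp (abs_nonneg u)
    nlinarith [sq_nonneg u]

/-! ### Subgradients of the loss -/

section Loss

variable {l l' : ℝ → ℝ → ℝ}

theorem IsConvexLoss.measurable_left (hl : IsConvexLoss l) (w : ℝ) : Measurable (l w) :=
  hl.measurable.comp measurable_prodMk_left

/-- By Lebesgue's differentiation theorem `l'` is the derivative almost everywhere, and the
derivative of a convex function is a subgradient. -/
theorem ae_subgradient (hl : IsConvexLoss l) (hl' : IsGenDeriv l l') (y : ℝ) :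
    ∀ᵐ w : ℝ, ∀ v, l w y + l' w y * (v - w) ≤ l v y := by
  have hder : ∀ k : ℕ, ∀ᵐ w : ℝ, w ∈ Set.Ioo (-(k : ℝ) - 1) (k + 1) →
      HasDerivAt (fun v => l v y) (l' w y) w := by
    intro k
    have hk : (0 : ℝ) ≤ k := Nat.cast_nonneg k
    have hint := hl'.intervalIntegrable y (-(k : ℝ) - 1) (k + 1) (by linarith)
    filter_upwards [hint.ae_hasDerivAt_integral] with w hw hmem
    have hmem' : w ∈ Set.uIcc (-(k : ℝ) - 1) (k + 1) := by
      rw [Set.uIcc_of_le (by linarith)]; exact Set.Ioo_subset_Icc_self hmem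
    have h1 := hw hmem' (-(k : ℝ) - 1) Set.left_mem_uIcc
    have h2 := h1.add_const (l (-(k : ℝ) - 1) y)
    refine h2.congr_of_eventuallyEq ?_
    filter_upwards [isOpen_Ioo.mem_nhds hmem] with v hv
    rw [← hl'.integral_eq y _ _ hv.1]
    ring
  filter_upwards [ae_all_iff.2 hder] with w hw v
  obtain ⟨k, hk⟩ := exists_nat_ge |w|
  have hd := hw k (by
    have := abs_le.1 hk
    exact ⟨by linarith, by linarith⟩)
  have hc := hl.convex y
  rcases lt_trichotomy w v with hwv | rfl | hvw
  · have := hc.le_slope_of_hasDerivAt trivial trivial hwv hd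
    rw [slope_def_field, le_div_iff₀ (by linarith)] at this
    linarith
  · simp
  · have := hc.slope_le_of_hasDerivAt trivial trivial hvw hd
    rw [slope_def_field, div_le_iff₀ (by linarith)] at this
    linarith

variable {p : ℕ → ℕ} (μ : ∀ n, Measure ((Fin (p n) → ℝ) × ℝ)) [∀ n, IsProbabilityMeasure (μ n)]

/-- Fubini: the exceptional set of `ω` depends on `y`, but almost every fixed `ω` is good for almost
all observations, and for all `n` at once. -/
theorem ae_ae_subgradient (hl : IsConvexLoss l) (hl' : IsGenDeriv l l') (v : ℝ) :
    ∀ᵐ w : ℝ, ∀ n, ∀ᵐ z ∂(μ n), l w z.2 + l' w z.2 * (v - w) ≤ l v z.2 := by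
  rw [ae_all_iff]
  intro n
  have hm : MeasurableSet {q : ℝ × ((Fin (p n) → ℝ) × ℝ) |
      l q.1 q.2.2 + l' q.1 q.2.2 * (v - q.1) ≤ l v q.2.2} := by
    have h1 : Measurable fun q : ℝ × ((Fin (p n) → ℝ) × ℝ) => l q.1 q.2.2 :=
      hl.measurable.comp (measurable_fst.prodMk (measurable_snd.comp measurable_snd))
    have h2 : Measurable fun q : ℝ × ((Fin (p n) → ℝ) × ℝ) => l' q.1 q.2.2 :=
      hl'.measurable.comp (measurable_fst.prodMk (measurable_snd.comp measurable_snd))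
    have h3 : Measurable fun q : ℝ × ((Fin (p n) → ℝ) × ℝ) => l v q.2.2 :=
      (hl.measurable_left v).comp (measurable_snd.comp measurable_snd)
    exact measurableSet_le (h1.add (h2.mul (measurable_const.sub measurable_fst))) h3
  refine (Measure.ae_ae_comm (p := fun (w : ℝ) (z : (Fin (p n) → ℝ) × ℝ) => l w z.2 + l' w z.2 * (v - w) ≤ l v z.2) hm).2 ?_
  refine Eventually.of_forall fun z => ?_
  filter_upwards [ae_subgradient hl hl' z.2] with w hw using hw v

/-- Both unit intervals next to `[-R, R]` have positive length and so contain a good `ω`. The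
conditions on `l' ω` hold for each fixed `ω` outside a null set of its own; two deterministic points
suffice to turn them into bounds that are uniform on `[-R, R]`. -/
theorem exists_slope_bounds (hl : IsConvexLoss l) (hl' : IsGenDeriv l l') (R : ℝ) (hR : 0 ≤ R) :
    ∃ w₁ w₂ : ℝ, |w₁| ≤ R + 1 ∧ |w₂| ≤ R + 1 ∧ ∀ n, ∀ᵐ z ∂(μ n), ∀ u v, -R ≤ u → u ≤ v → v ≤ R →
      l' w₂ z.2 * (v - u) ≤ l v z.2 - l u z.2 ∧ l v z.2 - l u z.2 ≤ l' w₁ z.2 * (v - u) := by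
  have ex : ∀ s t : ℝ, s < t → ∀ v, ∃ w ∈ Set.Ioo s t,
      ∀ n, ∀ᵐ z ∂(μ n), l w z.2 + l' w z.2 * (v - w) ≤ l v z.2 := by
    intro s t hst v
    have : NeBot (ae (volume.restrict (Set.Ioo s t))) := by
      rw [ae_neBot]
      intro h0
      rw [Measure.restrict_eq_zero, Real.volume_Ioo, ENNReal.ofReal_eq_zero] at h0
      linarith
    obtain ⟨w, h1, h2⟩ := ((ae_restrict_mem (measurableSet_Ioo (a := s) (b := t))).and
      (ae_restrict_of_ae (ae_ae_subgradient μ hl hl' v))).exists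
    exact ⟨w, h1, h2⟩
  obtain ⟨w₁, h1, h2⟩ := ex R (R + 1) (by linarith) R
  obtain ⟨w₂, h3, h4⟩ := ex (-R - 1) (-R) (by linarith) (-R)
  refine ⟨w₁, w₂, ?_, ?_, fun n => ?_⟩
  · rw [abs_le]; constructor <;> linarith [h1.1, h1.2]
  · rw [abs_le]; constructor <;> linarith [h3.1, h3.2]
  · filter_upwards [h2 n, h4 n] with z hz1 hz2 u v hu huv hv
    exact ⟨ConvexOn.le_sub_of_subgradient (hl.convex z.2) h3.2 hz2 huv hu,
      ConvexOn.sub_le_of_subgradient (hl.convex z.2) h1.1 hz1 huv hv⟩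

/-! ### The conditional risk -/

theorem ae_ae_condKernel {n : ℕ} {φ : (Fin (p n) → ℝ) × ℝ → Prop} (h : ∀ᵐ z ∂(μ n), φ z) :
    ∀ᵐ x ∂(μ n).fst, ∀ᵐ y ∂((μ n).condKernel x), φ (x, y) := by
  refine Measure.ae_ae_of_ae_compProd ?_
  rwa [(μ n).disintegrate]

variable {μ}

/-- A common null set is found for integer arguments; convexity dominates the loss at all other
arguments. -/
theorem IsCondStrictlyConvex.ae_integrable (hlμ : IsCondStrictlyConvex μ l) (hl : IsConvexLoss l)
    (n : ℕ) : ∀ᵐ x ∂(μ n).fst, ∀ w, Integrable (l w) ((μ n).condKernel x) := by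
  have h1 : ∀ w, ∀ᵐ x ∂(μ n).fst, Integrable (l w) ((μ n).condKernel x) := fun w =>
    (hlμ.integrable n w).condKernel_ae
  have h2 : ∀ᵐ x ∂(μ n).fst, ∀ k : ℤ, Integrable (l k) ((μ n).condKernel x) :=
    ae_all_iff.2 fun k => h1 k
  filter_upwards [h2] with x hx w
  obtain ⟨k, hk⟩ := exists_nat_ge |w|
  have e1 := hx k
  have e2 := hx (-k)
  have e3 := hx 0
  push_cast at e1 e2 e3
  refine Integrable.mono' ((e1.abs.add e2.abs).add (e3.abs.const_mul 2))
    (hl.measurable_left w).aestronglyMeasurable (Eventually.of_forall fun y => ?_)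
  exact ConvexOn.abs_le_of_abs_le (hl.convex y) hk

theorem convexOn_condMean {n : ℕ} {x : Fin (p n) → ℝ} (hl : IsConvexLoss l)
    (hx : ∀ w, Integrable (l w) ((μ n).condKernel x)) :
    ConvexOn ℝ Set.univ (fun w => condMean (μ n) (l w) x) := by
  refine ⟨convex_univ, fun u _ v _ s t hs ht hst => ?_⟩
  simp only [condMean, smul_eq_mul]
  rw [← integral_const_mul, ← integral_const_mul,
    ← integral_add ((hx u).const_mul s) ((hx v).const_mul t)]
  refine integral_mono (hx _) (((hx u).const_mul s).add ((hx v).const_mul t)) fun y => ?_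
  exact (hl.convex y).2 trivial trivial hs ht hst

theorem exists_lipschitz_condMean (hlμ : IsCondStrictlyConvex μ l) (hl : IsConvexLoss l)
    (hl' : IsGenDeriv l l') (hG : CondG μ l') (R : ℝ) (hR : 0 ≤ R) :
    ∃ B : ℝ, 0 ≤ B ∧ ∀ n, ∀ᵐ x ∂(μ n).fst, ∀ u v, |u| ≤ R → |v| ≤ R →
      |condMean (μ n) (l v) x - condMean (μ n) (l u) x| ≤ B * |v - u| := by
  obtain ⟨w₁, w₂, hw₁, hw₂, hs⟩ := exists_slope_bounds μ hl hl' R hR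
  obtain ⟨B, hB⟩ := hG (R + 1)
  refine ⟨|B|, abs_nonneg B, fun n => ?_⟩
  filter_upwards [hB n w₁ hw₁, hB n w₂ hw₂, ae_ae_condKernel μ (hs n),
    hlμ.ae_integrable hl n] with x h1 h2 h3 h4
  have key : ∀ u v, -R ≤ u → u ≤ v → v ≤ R →
      |condMean (μ n) (l v) x - condMean (μ n) (l u) x| ≤ |B| * (v - u) := by
    intro u v hu huv hv
    have e : condMean (μ n) (l v) x - condMean (μ n) (l u) x =
        ∫ y, (l v y - l u y) ∂((μ n).condKernel x) := (integral_sub (h4 v) (h4 u)).symm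
    have hi := (h4 v).sub (h4 u)
    have up : ∫ y, (l v y - l u y) ∂((μ n).condKernel x) ≤
        ∫ y, l' w₁ y * (v - u) ∂((μ n).condKernel x) :=
      integral_mono_ae hi (h1.1.mul_const _) (by
        filter_upwards [h3] with y hy using (hy u v hu huv hv).2)
    have lo : ∫ y, l' w₂ y * (v - u) ∂((μ n).condKernel x) ≤
        ∫ y, (l v y - l u y) ∂((μ n).condKernel x) :=
      integral_mono_ae (h2.1.mul_const _) hi (by
        filter_upwards [h3] with y hy using (hy u v hu huv hv).1)
    rw [integral_mul_const] at up lo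
    have a1 : condMean (μ n) (l' w₁) x ≤ |B| := (le_abs_self _).trans (h1.2.trans (le_abs_self B))
    have a2 : -|B| ≤ condMean (μ n) (l' w₂) x :=
      (neg_le_neg (h2.2.trans (le_abs_self B))).trans (neg_abs_le _)
    have hvu : 0 ≤ v - u := by linarith
    rw [e, abs_le]
    unfold condMean at a1 a2
    constructor
    · calc -(|B| * (v - u)) = -|B| * (v - u) := by ring
        _ ≤ _ := by gcongr
        _ ≤ _ := lo
    · refine up.trans ?_
      gcongr
  intro u v hu hv
  rw [abs_le] at hu hv
  rcases le_total u v with huv | huv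
  · rw [abs_of_nonneg (by linarith : 0 ≤ v - u)]
    exact key u v hu.1 huv hv.2
  · rw [abs_sub_comm, abs_of_nonpos (by linarith : v - u ≤ 0), neg_sub]
    exact key v u hv.1 huv hu.2

theorem exists_strongConvexOn_condMean (hlμ : IsCondStrictlyConvex μ l) (R : ℝ) :
    ∃ c : ℝ, 0 < c ∧ ∀ n, ∀ᵐ x ∂(μ n).fst,
      StrongConvexOn (Set.Icc (-R) R) c (fun w => condMean (μ n) (l w) x) := by
  obtain ⟨c, hc, h⟩ := hlμ.pos R
  refine ⟨c, hc, fun n => ?_⟩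
  filter_upwards [h n, hlμ.contDiff n] with x h1 h2
  exact strongConvexOn_of_le_deriv2 h2 h1

/-- Linear growth away from the bounded minimizer, with the reference point moved to `0` at a
bounded cost by the Lipschitz property. The value `0` is that of the competitor spline on the block.
-/
theorem exists_growth_condMean (hlμ : IsCondStrictlyConvex μ l) (hl : IsConvexLoss l)
    (hl' : IsGenDeriv l l') (hG : CondG μ l') {θ : ∀ n, (Fin (p n) → ℝ) → ℝ} {M : ℝ}
    (hC : CondC μ l θ M) :
    ∃ c K : ℝ, 0 < c ∧ 0 ≤ K ∧ ∀ n, ∀ᵐ x ∂(μ n).fst, ∀ w,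
      c * |w| - K ≤ condMean (μ n) (l w) x - condMean (μ n) (l 0) x := by
  obtain ⟨c, hc, h1⟩ := exists_strongConvexOn_condMean hlμ (|M| + 1)
  obtain ⟨B, hB, h2⟩ := exists_lipschitz_condMean hlμ hl hl' hG |M| (abs_nonneg M)
  refine ⟨c / 4, c / 4 * (|M| + 1) + B * |M|, by positivity, by positivity, fun n => ?_⟩
  filter_upwards [h1 n, h2 n, hC n, hlμ.ae_integrable hl n] with x h1 h2 h3 h4 w
  have hM : |θ n x| ≤ |M| := h3.2.trans (le_abs_self M)
  have h5 := growth_of_isMinOn (convexOn_condMean hl h4) h1 hc.le h3.1 hM w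
  have h6 := h2 0 (θ n x) (by simp) hM
  rw [sub_zero] at h6
  have h7 := (abs_le.1 h6).1
  have h8 : B * |θ n x| ≤ B * |M| := by gcongr
  linarith

end Loss

end Screening

/-! ### Exponential moments of the loss increments -/

namespace Screening

section Moments

variable {l l' : ℝ → ℝ → ℝ}
variable {p : ℕ → ℕ} {μ : ∀ n, Measure ((Fin (p n) → ℝ) × ℝ)} [∀ n, IsProbabilityMeasure (μ n)]

theorem CondH1.condH3 (hl' : IsGenDeriv l l') (h : CondH1 μ l') : CondH3 μ l' := by
  intro R
  obtain ⟨B, hB⟩ := h R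
  refine ⟨1, one_pos, Real.exp |B|, fun n w hw => ?_⟩
  filter_upwards [ae_ae_condKernel μ (hB n w hw)] with x hx t ht
  have hm : Measurable fun y => Real.exp (t * l' w y) :=
    ((hl'.measurable.comp measurable_prodMk_left).const_mul t).exp
  have hb : ∀ᵐ y ∂((μ n).condKernel x), Real.exp (t * l' w y) ≤ Real.exp |B| := by
    filter_upwards [hx] with y hy
    refine Real.exp_le_exp.2 ((le_abs_self _).trans ?_)
    rw [abs_mul]
    calc |t| * |l' w y| ≤ 1 * |B| :=
          mul_le_mul ht (hy.trans (le_abs_self B)) (abs_nonneg _) zero_le_one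
      _ = |B| := one_mul _
  have hi : Integrable (fun y => Real.exp (t * l' w y)) ((μ n).condKernel x) := by
    refine Integrable.of_bound hm.aestronglyMeasurable (Real.exp |B|) ?_
    filter_upwards [hb] with y hy
    rwa [Real.norm_eq_abs, abs_of_pos (Real.exp_pos _)]
  refine ⟨hi, ?_⟩
  calc condMean (μ n) (fun y => Real.exp (t * l' w y)) x
      ≤ ∫ _, Real.exp |B| ∂((μ n).condKernel x) := integral_mono_ae hi (integrable_const _) hb
    _ = Real.exp |B| := by simp

theorem CondH2.condH3 (hG : CondG μ l') (h : CondH2 μ l') : CondH3 μ l' := by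
  intro R
  obtain ⟨B, hB⟩ := hG R
  obtain ⟨σ, hσ, hs⟩ := h R
  refine ⟨1, one_pos, Real.exp (σ ^ 2 / 2) * Real.exp |B|, fun n w hw => ?_⟩
  filter_upwards [hB n w hw, hs n w hw] with x h1 h2 t ht
  set m := condMean (μ n) (l' w) x
  have e : ∀ y, Real.exp (t * l' w y) = Real.exp (t * (l' w y - m)) * Real.exp (t * m) := by
    intro y; rw [← Real.exp_add]; congr 1; ring
  simp only [e]
  refine ⟨(h2 t).1.mul_const _, ?_⟩
  have h3 := (h2 t).2
  simp only [condMean] at h3 ⊢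
  rw [integral_mul_const]
  refine mul_le_mul (h3.trans (Real.exp_le_exp.2 ?_)) (Real.exp_le_exp.2 ?_)
    (Real.exp_pos _).le (Real.exp_pos _).le
  · have : t ^ 2 ≤ 1 := by rw [← sq_abs]; exact pow_le_one₀ (abs_nonneg t) ht
    have := mul_le_mul_of_nonneg_right this (sq_nonneg σ)
    linarith
  · refine (le_abs_self _).trans ?_
    rw [abs_mul]
    calc |t| * |m| ≤ 1 * |B| :=
          mul_le_mul ht (h1.2.trans (le_abs_self B)) (abs_nonneg _) zero_le_one
      _ = |B| := one_mul _

end Moments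

/-- `l(·, y)` has the Lipschitz constant `W y` on `[-R, R]`, and `W` has a conditional exponential
moment. -/
structure LipMoment {p : ℕ} (l : ℝ → ℝ → ℝ) (μ : Measure ((Fin p → ℝ) × ℝ))
    [IsFiniteMeasure μ] (R c C : ℝ) (W : ℝ → ℝ) : Prop where
  lipschitz : ∀ᵐ z ∂μ, ∀ u v, |u| ≤ R → |v| ≤ R → |l v z.2 - l u z.2| ≤ W z.2 * |v - u|
  moment : ∀ᵐ x ∂μ.fst,
    ∫⁻ y, ENNReal.ofReal (W y ^ 2 * Real.exp (c * W y)) ∂(μ.condKernel x) ≤ ENNReal.ofReal C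

theorem exists_lipMoment {l l' : ℝ → ℝ → ℝ} {p : ℕ → ℕ}
    {μ : ∀ n, Measure ((Fin (p n) → ℝ) × ℝ)} [∀ n, IsProbabilityMeasure (μ n)]
    (hl : IsConvexLoss l) (hl' : IsGenDeriv l l') (h : CondH3 μ l') (R : ℝ) (hR : 0 ≤ R) :
    ∃ (c C : ℝ) (W : ℝ → ℝ), 0 < c ∧ 0 ≤ C ∧ Measurable W ∧ (∀ y, 0 ≤ W y) ∧
      ∀ n, LipMoment l (μ n) R c C W := by
  obtain ⟨w₁, w₂, hw₁, hw₂, hs⟩ := exists_slope_bounds μ hl hl' R hR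
  obtain ⟨c₀, hc₀, B, hB⟩ := h (R + 1)
  have hm : ∀ w, Measurable (l' w) := fun w => hl'.measurable.comp measurable_prodMk_left
  set W : ℝ → ℝ := fun y => |l' w₁ y| + |l' w₂ y|
  have hW0 : ∀ y, 0 ≤ W y := fun y => by positivity
  have hWm : Measurable W := (hm w₁).norm.add (hm w₂).norm
  -- One factor `exp (c * W)` absorbs the square of `W`. The remaining exponent `2 * c * W` is the
  -- mean of the two numbers `|c₀ * l' wᵢ|`, so its exponential is at most the larger of theirs and
  -- no joint moment is needed.
  set c := c₀ / 4
  have hc : 0 < c := by positivity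
  -- pointwise bound of the weight by exponentials of the generalized derivative
  have hpt : ∀ y, W y ^ 2 * Real.exp (c * W y) ≤ 2 / c ^ 2 *
      (Real.exp (c₀ * l' w₁ y) + Real.exp (-c₀ * l' w₁ y) + Real.exp (c₀ * l' w₂ y) +
        Real.exp (-c₀ * l' w₂ y)) := by
    intro y
    have h1 : (c * W y) ^ 2 ≤ 2 * Real.exp (c * W y) := by
      have := Real.quadratic_le_exp_of_nonneg (mul_nonneg hc.le (hW0 y))
      nlinarith [mul_nonneg hc.le (hW0 y)]
    have h2 : W y ^ 2 ≤ 2 / c ^ 2 * Real.exp (c * W y) := by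
      rw [mul_pow] at h1
      rw [div_mul_eq_mul_div, le_div_iff₀ (by positivity)]; linarith
    have h3 : ∀ s : ℝ, Real.exp |s| ≤ Real.exp s + Real.exp (-s) := by
      intro s
      rcases abs_cases s with ⟨h, _⟩ | ⟨h, _⟩ <;> rw [h] <;>
        linarith [Real.exp_pos s, Real.exp_pos (-s)]
    have h4 : Real.exp (c * W y) * Real.exp (c * W y) ≤
        Real.exp |c₀ * l' w₁ y| + Real.exp |c₀ * l' w₂ y| := by
      rw [← Real.exp_add]
      have e : c * W y + c * W y = (|c₀ * l' w₁ y| + |c₀ * l' w₂ y|) / 2 := by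
        rw [abs_mul, abs_mul, abs_of_pos hc₀]
        simp only [c, W]; ring
      rw [e]
      rcases le_total |c₀ * l' w₁ y| |c₀ * l' w₂ y| with h | h
      · have : Real.exp ((|c₀ * l' w₁ y| + |c₀ * l' w₂ y|) / 2) ≤ Real.exp |c₀ * l' w₂ y| :=
          Real.exp_le_exp.2 (by linarith)
        linarith [Real.exp_pos |c₀ * l' w₁ y|]
      · have : Real.exp ((|c₀ * l' w₁ y| + |c₀ * l' w₂ y|) / 2) ≤ Real.exp |c₀ * l' w₁ y| :=
          Real.exp_le_exp.2 (by linarith)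
        linarith [Real.exp_pos |c₀ * l' w₂ y|]
    have h5 := h3 (c₀ * l' w₁ y)
    have h6 := h3 (c₀ * l' w₂ y)
    calc W y ^ 2 * Real.exp (c * W y) ≤ 2 / c ^ 2 * Real.exp (c * W y) * Real.exp (c * W y) := by
          gcongr
      _ = 2 / c ^ 2 * (Real.exp (c * W y) * Real.exp (c * W y)) := by ring
      _ ≤ _ := by
          gcongr
          simp only [neg_mul]
          linarith
  refine ⟨c, 2 / c ^ 2 * (4 * |B|), W, hc, by positivity, hWm, hW0, fun n => ⟨?_, ?_⟩⟩
  · filter_upwards [hs n] with z hz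
    have key : ∀ u v, -R ≤ u → u ≤ v → v ≤ R → |l v z.2 - l u z.2| ≤ W z.2 * (v - u) := by
      intro u v hu huv hv
      obtain ⟨h1, h2⟩ := hz u v hu huv hv
      have hvu : 0 ≤ v - u := by linarith
      have a1 : l' w₁ z.2 ≤ W z.2 := by
        linarith [le_abs_self (l' w₁ z.2), abs_nonneg (l' w₂ z.2)]
      have a2 : -W z.2 ≤ l' w₂ z.2 := by
        linarith [neg_abs_le (l' w₂ z.2), abs_nonneg (l' w₁ z.2)]
      rw [abs_le]
      constructor
      · nlinarith
      · nlinarith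
    intro u v hu hv
    rw [abs_le] at hu hv
    rcases le_total u v with huv | huv
    · rw [abs_of_nonneg (by linarith : 0 ≤ v - u)]
      exact key u v hu.1 huv hv.2
    · rw [abs_sub_comm, abs_of_nonpos (by linarith : v - u ≤ 0), neg_sub]
      exact key v u hv.1 huv hu.2
  · filter_upwards [hB n w₁ hw₁, hB n w₂ hw₂] with x h1 h2
    have a0 : |c₀| ≤ c₀ := (abs_of_pos hc₀).le
    have a0' : |-c₀| ≤ c₀ := by rw [abs_neg]; exact a0
    have i1 := h1 c₀ a0
    have i2 := h1 (-c₀) a0'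
    have i3 := h2 c₀ a0
    have i4 := h2 (-c₀) a0'
    have hint : Integrable (fun y => 2 / c ^ 2 * (Real.exp (c₀ * l' w₁ y) +
        Real.exp (-c₀ * l' w₁ y) + Real.exp (c₀ * l' w₂ y) + Real.exp (-c₀ * l' w₂ y)))
        ((μ n).condKernel x) := (((i1.1.add i2.1).add i3.1).add i4.1).const_mul (2 / c ^ 2)
    refine (lintegral_mono fun y => ENNReal.ofReal_le_ofReal (hpt y)).trans ?_
    rw [← ofReal_integral_eq_lintegral_ofReal hint (Eventually.of_forall fun y => by positivity)]
    refine ENNReal.ofReal_le_ofReal ?_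
    rw [integral_const_mul]
    refine mul_le_mul_of_nonneg_left ?_ (by positivity)
    have e : ∫ y, (Real.exp (c₀ * l' w₁ y) + Real.exp (-c₀ * l' w₁ y) + Real.exp (c₀ * l' w₂ y) +
        Real.exp (-c₀ * l' w₂ y)) ∂((μ n).condKernel x) =
        condMean (μ n) (fun y => Real.exp (c₀ * l' w₁ y)) x +
        condMean (μ n) (fun y => Real.exp (-c₀ * l' w₁ y)) x +
        condMean (μ n) (fun y => Real.exp (c₀ * l' w₂ y)) x +
        condMean (μ n) (fun y => Real.exp (-c₀ * l' w₂ y)) x := by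
      have j12 : Integrable (fun y => Real.exp (c₀ * l' w₁ y) + Real.exp (-c₀ * l' w₁ y))
        ((μ n).condKernel x) := i1.1.add i2.1
      have j123 : Integrable (fun y => Real.exp (c₀ * l' w₁ y) + Real.exp (-c₀ * l' w₁ y) +
        Real.exp (c₀ * l' w₂ y)) ((μ n).condKernel x) := j12.add i3.1
      rw [integral_add j123 i4.1, integral_add j12 i3.1, integral_add i1.1 i2.1]
      rfl
    have hBB := le_abs_self B
    refine e.le.trans ?_
    linarith [i1.2, i2.2, i3.2, i4.2]

section Increments

variable {l : ℝ → ℝ → ℝ} {p : ℕ} {μ : Measure ((Fin p → ℝ) × ℝ)}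

theorem measurable_loss_comp (hl : IsConvexLoss l) {h : (Fin p → ℝ) → ℝ} (hm : Measurable h) :
    Measurable fun z : (Fin p → ℝ) × ℝ => l (h z.1) z.2 :=
  hl.measurable.comp ((hm.comp measurable_fst).prodMk measurable_snd)

theorem ae_of_ae_fst {φ : (Fin p → ℝ) → Prop} (h : ∀ᵐ x ∂μ.fst, φ x) : ∀ᵐ z ∂μ, φ z.1 :=
  ae_of_ae_map measurable_fst.aemeasurable h

theorem integrable_loss_comp (hl : IsConvexLoss l)
    (hi : ∀ w, Integrable (fun z : (Fin p → ℝ) × ℝ => l w z.2) μ) {h : (Fin p → ℝ) → ℝ}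
    (hm : Measurable h) {R : ℝ} (hR : ∀ᵐ x ∂μ.fst, |h x| ≤ R) :
    Integrable (fun z : (Fin p → ℝ) × ℝ => l (h z.1) z.2) μ := by
  refine Integrable.mono' (((hi R).abs.add (hi (-R)).abs).add ((hi 0).abs.const_mul 2))
    (measurable_loss_comp hl hm).aestronglyMeasurable ?_
  filter_upwards [ae_of_ae_fst hR] with z hz
  exact ConvexOn.abs_le_of_abs_le (hl.convex z.2) hz

variable [IsProbabilityMeasure μ]

theorem integral_loss_comp (hl : IsConvexLoss l)
    (hi : ∀ w, Integrable (fun z : (Fin p → ℝ) × ℝ => l w z.2) μ) {h : (Fin p → ℝ) → ℝ}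
    (hm : Measurable h) {R : ℝ} (hR : ∀ᵐ x ∂μ.fst, |h x| ≤ R) :
    Integrable (fun x => condMean μ (l (h x)) x) μ.fst ∧
      ∫ z, l (h z.1) z.2 ∂μ = ∫ x, condMean μ (l (h x)) x ∂μ.fst :=
  ⟨(integrable_loss_comp hl hi hm hR).integral_condKernel,
    (Measure.integral_condKernel (integrable_loss_comp hl hi hm hR)).symm⟩

/-- A Bernstein estimate. In `exp u ≤ 1 + u + u ^ 2 * exp |u|` with `u = t * U`, the restriction on
`t` keeps `|u|` below `c * W`. Conditioning on the covariates separates the squared difference of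
the predictors from the moment of `W`, and `1 + x ≤ exp x` concludes. -/
theorem mgf_increment_le {R c C : ℝ} {W : ℝ → ℝ} (hl : IsConvexLoss l)
    (hi : ∀ w, Integrable (fun z : (Fin p → ℝ) × ℝ => l w z.2) μ)
    (hW : LipMoment l μ R c C W) (hWm : Measurable W) (hW0 : ∀ y, 0 ≤ W y) (hC : 0 ≤ C)
    {h h' : (Fin p → ℝ) → ℝ} (hm : Measurable h) (hm' : Measurable h')
    (hR : ∀ᵐ x ∂μ.fst, |h x| ≤ R) (hR' : ∀ᵐ x ∂μ.fst, |h' x| ≤ R) {s V t : ℝ}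
    (hs : ∀ᵐ x ∂μ.fst, |h x - h' x| ≤ s) (hV : ∫ x, (h x - h' x) ^ 2 ∂μ.fst ≤ V)
    (ht : |t| * s ≤ c) :
    Integrable (fun z => Real.exp (t * (l (h z.1) z.2 - l (h' z.1) z.2))) μ ∧
      ∫ z, Real.exp (t * (l (h z.1) z.2 - l (h' z.1) z.2)) ∂μ ≤
        Real.exp (t * ∫ z, (l (h z.1) z.2 - l (h' z.1) z.2) ∂μ + t ^ 2 * (C * V)) := by
  set U : (Fin p → ℝ) × ℝ → ℝ := fun z => l (h z.1) z.2 - l (h' z.1) z.2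
  set Q : (Fin p → ℝ) × ℝ → ℝ := fun z =>
    (h z.1 - h' z.1) ^ 2 * (W z.2 ^ 2 * Real.exp (c * W z.2))
  have hUi : Integrable U μ :=
    (integrable_loss_comp hl hi hm hR).sub (integrable_loss_comp hl hi hm' hR')
  have hUm : Measurable U := (measurable_loss_comp hl hm).sub (measurable_loss_comp hl hm')
  have hdm : Measurable fun x => (h x - h' x) ^ 2 := (hm.sub hm').pow_const 2
  have hEm : Measurable fun y => W y ^ 2 * Real.exp (c * W y) :=
    (hWm.pow_const 2).mul (hWm.const_mul c).exp
  have hQm : Measurable Q := (hdm.comp measurable_fst).mul (hEm.comp measurable_snd)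
  have hQ0 : ∀ z, 0 ≤ Q z := fun z => by positivity
  have hsqi : Integrable (fun x => (h x - h' x) ^ 2) μ.fst := by
    refine Integrable.of_bound hdm.aestronglyMeasurable (s ^ 2) ?_
    filter_upwards [hs] with x hx
    rw [Real.norm_eq_abs, abs_pow]
    gcongr
  have hQl : ∫⁻ z, ENNReal.ofReal (Q z) ∂μ ≤ ENNReal.ofReal (C * V) := by
    rw [← Measure.lintegral_condKernel (ρ := μ) (f := fun z => ENNReal.ofReal (Q z))
      hQm.ennreal_ofReal]
    calc _ ≤ ∫⁻ x, ENNReal.ofReal C * ENNReal.ofReal ((h x - h' x) ^ 2) ∂μ.fst := by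
          refine lintegral_mono_ae ?_
          filter_upwards [hW.moment] with x hx
          have e : ∀ y, ENNReal.ofReal (Q (x, y)) = ENNReal.ofReal ((h x - h' x) ^ 2) *
              ENNReal.ofReal (W y ^ 2 * Real.exp (c * W y)) := fun y =>
            ENNReal.ofReal_mul (sq_nonneg _)
          simp only [e]
          rw [lintegral_const_mul _ hEm.ennreal_ofReal, mul_comm]
          gcongr
      _ = ENNReal.ofReal (C * ∫ x, (h x - h' x) ^ 2 ∂μ.fst) := by
          rw [lintegral_const_mul _ hdm.ennreal_ofReal, ENNReal.ofReal_mul hC,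
            ofReal_integral_eq_lintegral_ofReal hsqi (Eventually.of_forall fun _ => sq_nonneg _)]
      _ ≤ _ := ENNReal.ofReal_le_ofReal (by gcongr)
  have hQi : Integrable Q μ := by
    refine ⟨hQm.aestronglyMeasurable, ?_⟩
    rw [hasFiniteIntegral_iff_ofReal (Eventually.of_forall hQ0)]
    exact hQl.trans_lt ENNReal.ofReal_lt_top
  have hCV : 0 ≤ C * V := mul_nonneg hC ((integral_nonneg fun _ => sq_nonneg _).trans hV)
  have hQle : ∫ z, Q z ∂μ ≤ C * V := by
    rw [integral_eq_lintegral_of_nonneg_ae (Eventually.of_forall hQ0) hQm.aestronglyMeasurable]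
    exact ENNReal.toReal_le_of_le_ofReal hCV hQl
  have hbound : ∀ᵐ z ∂μ, Real.exp (t * U z) ≤ 1 + t * U z + t ^ 2 * Q z := by
    filter_upwards [hW.lipschitz, ae_of_ae_fst hR, ae_of_ae_fst hR', ae_of_ae_fst hs]
      with z h1 h2 h3 h4
    have h5 : |U z| ≤ W z.2 * |h z.1 - h' z.1| := h1 _ _ h3 h2
    have h6 : |t * U z| ≤ c * W z.2 := by
      rw [abs_mul]
      calc |t| * |U z| ≤ |t| * (W z.2 * s) := by
            gcongr
            exact h5.trans (mul_le_mul_of_nonneg_left h4 (hW0 _))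
        _ = |t| * s * W z.2 := by ring
        _ ≤ c * W z.2 := mul_le_mul_of_nonneg_right ht (hW0 _)
    have h7 : (t * U z) ^ 2 ≤ t ^ 2 * ((h z.1 - h' z.1) ^ 2 * W z.2 ^ 2) := by
      rw [mul_pow]
      refine mul_le_mul_of_nonneg_left ?_ (sq_nonneg t)
      calc U z ^ 2 = |U z| ^ 2 := (sq_abs _).symm
        _ ≤ (W z.2 * |h z.1 - h' z.1|) ^ 2 := by gcongr
        _ = _ := by rw [mul_pow, sq_abs]; ring
    refine (exp_le_one_add_add_sq_mul_exp_abs _).trans (add_le_add_right ?_ _)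
    calc (t * U z) ^ 2 * Real.exp |t * U z|
        ≤ t ^ 2 * ((h z.1 - h' z.1) ^ 2 * W z.2 ^ 2) * Real.exp (c * W z.2) := by gcongr
      _ = t ^ 2 * Q z := by simp only [Q]; ring
  have hbi : Integrable (fun z => 1 + t * U z + t ^ 2 * Q z) μ :=
    ((integrable_const 1).add (hUi.const_mul t)).add (hQi.const_mul (t ^ 2))
  have hei : Integrable (fun z => Real.exp (t * U z)) μ := by
    refine Integrable.mono' hbi (hUm.const_mul t).exp.aestronglyMeasurable ?_
    filter_upwards [hbound] with z hz
    rwa [Real.norm_eq_abs, abs_of_pos (Real.exp_pos _)]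
  refine ⟨hei, (integral_mono_ae hei hbi hbound).trans ?_⟩
  have e : ∫ z, (1 + t * U z + t ^ 2 * Q z) ∂μ = 1 + t * ∫ z, U z ∂μ + t ^ 2 * ∫ z, Q z ∂μ := by
    have i1 : Integrable (fun z => 1 + t * U z) μ := (integrable_const 1).add (hUi.const_mul t)
    rw [integral_add i1 (hQi.const_mul (t ^ 2)),
      integral_add (integrable_const 1) (hUi.const_mul t), integral_const_mul, integral_const_mul]
    simp
  rw [e]
  have h8 : t ^ 2 * ∫ z, Q z ∂μ ≤ t ^ 2 * (C * V) := by gcongr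
  have h9 := Real.add_one_le_exp (t * ∫ z, U z ∂μ + t ^ 2 * (C * V))
  linarith

end Increments

end Screening

namespace Screening

/-! ### Chernoff's bound for empirical means -/

section Chernoff

variable {Ω E : Type*} [MeasurableSpace Ω] [MeasurableSpace E] {P : Measure Ω}
  [IsProbabilityMeasure P] {μ : Measure E} {n : ℕ} {Z : Fin n → Ω → E}

theorem measureReal_mean_ge_le (hn : 0 < n) (hZ : ∀ i, Measurable (Z i)) (hind : iIndepFun Z P)
    (hlaw : ∀ i, P.map (Z i) = μ) {U : E → ℝ} (hU : Measurable U) {t v m τ : ℝ} (ht : 0 ≤ t)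
    (hi : Integrable (fun z => Real.exp (t * U z)) μ)
    (hle : ∫ z, Real.exp (t * U z) ∂μ ≤ Real.exp (t * m + v)) :
    P.real {ω | τ ≤ (n : ℝ)⁻¹ * ∑ i, U (Z i ω) - m} ≤ Real.exp (-(n * (t * τ - v))) := by
  have hn' : (0 : ℝ) < n := by exact_mod_cast hn
  have hind' : iIndepFun (fun i => U ∘ Z i) P := hind.comp (fun _ => U) fun _ => hU
  have hm : ∀ i, Measurable (U ∘ Z i) := fun i => hU.comp (hZ i)
  have hexp : ∀ i, Integrable (fun ω => Real.exp (t * (U ∘ Z i) ω)) P := by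
    intro i
    have h1 := hi
    rw [← hlaw i] at h1
    exact h1.comp_measurable (hZ i)
  have hmgf : ∀ i, mgf (U ∘ Z i) P t ≤ Real.exp (t * m + v) := by
    intro i
    have h1 : mgf (U ∘ Z i) P t = ∫ z, Real.exp (t * U z) ∂μ := by
      rw [← hlaw i, integral_map (hZ i).aemeasurable]
      · rfl
      · exact (hU.const_mul t).exp.aestronglyMeasurable
    rw [h1]; exact hle
  have h1 : {ω | τ ≤ (n : ℝ)⁻¹ * ∑ i, U (Z i ω) - m} =
      {ω | n * (τ + m) ≤ (∑ i, U ∘ Z i) ω} := by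
    ext ω
    simp only [Set.mem_ofPred_eq, Finset.sum_apply, Function.comp_apply]
    rw [le_sub_iff_add_le, inv_mul_eq_div, le_div_iff₀ hn', mul_comm]
  rw [h1]
  have h2 := measure_ge_le_exp_mul_mgf (μ := P) (X := ∑ i, U ∘ Z i) (n * (τ + m)) ht
    (hind'.integrable_exp_mul_sum hm (s := Finset.univ) fun i _ => hexp i)
  refine h2.trans ?_
  rw [hind'.mgf_sum hm Finset.univ]
  calc Real.exp (-t * (n * (τ + m))) * ∏ i, mgf (U ∘ Z i) P t
      ≤ Real.exp (-t * (n * (τ + m))) * ∏ i : Fin n, Real.exp (t * m + v) := by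
        gcongr
        · exact fun i _ => mgf_nonneg
        · exact hmgf _
    _ = Real.exp (-(n * (t * τ - v))) := by
        rw [Finset.prod_const, Finset.card_univ, Fintype.card_fin, ← Real.exp_nat_mul,
          ← Real.exp_add]
        congr 1; ring

theorem measureReal_abs_mean_ge_le (hn : 0 < n) (hZ : ∀ i, Measurable (Z i))
    (hind : iIndepFun Z P) (hlaw : ∀ i, P.map (Z i) = μ) {U : E → ℝ} (hU : Measurable U)
    {t v m τ : ℝ} (ht : 0 ≤ t)
    (h : ∀ s, |s| = t → Integrable (fun z => Real.exp (s * U z)) μ ∧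
      ∫ z, Real.exp (s * U z) ∂μ ≤ Real.exp (s * m + v)) :
    P.real {ω | τ ≤ |(n : ℝ)⁻¹ * ∑ i, U (Z i ω) - m|} ≤
      2 * Real.exp (-(n * (t * τ - v))) := by
  have h1 := h t (abs_of_nonneg ht)
  have h2 := h (-t) (by rw [abs_neg, abs_of_nonneg ht])
  have u1 := measureReal_mean_ge_le hn hZ hind hlaw hU (τ := τ) ht h1.1 h1.2
  have u2 := measureReal_mean_ge_le hn hZ hind hlaw hU.neg (m := -m) (v := v) (τ := τ) ht
    (by simpa using h2.1) (by simpa using h2.2)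
  calc _ ≤ P.real ({ω | τ ≤ (n : ℝ)⁻¹ * ∑ i, U (Z i ω) - m} ∪
        {ω | τ ≤ (n : ℝ)⁻¹ * ∑ i, (-U) (Z i ω) - -m}) := by
        refine measureReal_mono (fun ω hω => ?_)
        rcases le_abs.1 (Set.mem_ofPred_eq ▸ hω) with h3 | h3
        · exact Or.inl h3
        · refine Or.inr ?_
          simp only [Set.mem_ofPred_eq, Pi.neg_apply, Finset.sum_neg_distrib]
          linarith
    _ ≤ _ := measureReal_union_le _ _
    _ ≤ _ := by linarith

end Chernoff

/-! ### Chaining -/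

/-- A finite `1`-net of the ball with radius `2`. -/
theorem exists_net (d : ℕ) : ∃ F : Finset (EuclideanSpace ℝ (Fin d)), (∀ e ∈ F, ‖e‖ ≤ 2) ∧
    F.card ≤ 5 ^ d ∧ ∀ x : EuclideanSpace ℝ (Fin d), ‖x‖ ≤ 2 → ∃ e ∈ F, ‖x - e‖ ≤ 1 := by
  classical
  -- Without such a net, a `1`-separated subset of the ball could always be enlarged, against the
  -- packing bound `5 ^ d`.
  by_contra! hno
  have hcard : ∀ s : Finset (EuclideanSpace ℝ (Fin d)), (∀ c ∈ s, ‖c‖ ≤ 2) →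
      (∀ c ∈ s, ∀ e ∈ s, c ≠ e → 1 ≤ ‖c - e‖) → s.card ≤ 5 ^ d := by
    intro s h1 h2
    have := Besicovitch.card_le_of_separated s h1 h2
    simpa using this
  have hall : ∀ m : ℕ, ∃ s : Finset (EuclideanSpace ℝ (Fin d)), s.card = m ∧ (∀ c ∈ s, ‖c‖ ≤ 2) ∧
      ∀ c ∈ s, ∀ e ∈ s, c ≠ e → 1 ≤ ‖c - e‖ := by
    intro m
    induction m with
    | zero => exact ⟨∅, by simp⟩
    | succ m ih =>
      obtain ⟨s, rfl, h1, h2⟩ := ih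
      obtain ⟨x, hx, hxs⟩ := hno s h1 (hcard s h1 h2)
      have hxm : x ∉ s := by
        intro h
        have := hxs x h
        rw [sub_self, norm_zero] at this
        linarith
      refine ⟨insert x s, Finset.card_insert_of_notMem hxm, ?_, ?_⟩
      · intro c hc
        rcases Finset.mem_insert.1 hc with rfl | hc
        · exact hx
        · exact h1 c hc
      · intro c hc e he hce
        rcases Finset.mem_insert.1 hc with rfl | hc' <;>
          rcases Finset.mem_insert.1 he with rfl | he'
        · exact absurd rfl hce
        · exact (hxs e he').le
        · rw [norm_sub_rev]; exact (hxs c hc').le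
        · exact h2 c hc' e he' hce
  obtain ⟨s, hs, h1, h2⟩ := hall (5 ^ d + 1)
  have := hcard s h1 h2
  omega

theorem sum_geometric_three_quarters_le (m : ℕ) :
    ∑ k ∈ Finset.range m, (3 / 4 : ℝ) ^ k ≤ 4 := by
  rw [geom_sum_eq (by norm_num)]
  have : (0 : ℝ) ≤ (3 / 4) ^ m := by positivity
  rw [div_le_iff_of_neg (by norm_num)]
  linarith

/-- Each point of the tree has as children its translates by the rescaled net, so every point of the
ball is the limit of a path whose `k`-th link has length at most `δ / 2 ^ k`. The links add up to
less than `2 * δ`, the radius in `htail`. If no link is bad, the increments along the path sum to at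
most `4 * τ`, and continuity passes to the limit. Covering by countably many events requires no
measurability of the supremum. -/
theorem measureReal_chaining {Ω : Type*} [MeasurableSpace Ω] {P : Measure Ω}
    [IsProbabilityMeasure P] {d : ℕ} (D : Ω → EuclideanSpace ℝ (Fin d) → ℝ)
    (hD : ∀ ω, Continuous (D ω)) (β₀ : EuclideanSpace ℝ (Fin d)) (h0 : ∀ ω, D ω β₀ = 0)
    {δ τ A : ℝ} (hδ : 0 < δ) (hτ : 0 ≤ τ) (hA : 0 ≤ A) (π : ℕ → ℝ)
    (htail : ∀ k, ∀ b b', ‖b - β₀‖ ≤ 2 * δ → ‖b' - β₀‖ ≤ 2 * δ → ‖b - b'‖ ≤ δ / 2 ^ k →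
      P.real {ω | τ * (3 / 4) ^ k ≤ |D ω b - D ω b'|} ≤ π k)
    (hπ : ∀ k, (5 ^ d) ^ (k + 1) * π k ≤ A * (1 / 2) ^ (k + 1)) :
    P.real {ω | ∃ β, ‖β - β₀‖ ≤ δ ∧ 4 * τ < |D ω β|} ≤ A := by
  classical
  obtain ⟨F, hF2, hFc, hFnet⟩ := exists_net d
  -- the points of the `k`-th level of the tree
  let N : ℕ → Finset (EuclideanSpace ℝ (Fin d)) := fun k => Nat.rec {β₀}
    (fun k S => (S ×ˢ F).image fun x => x.1 + (δ / 2 / 2 ^ k) • x.2) k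
  have hNsucc : ∀ k, N (k + 1) = ((N k) ×ˢ F).image fun x => x.1 + (δ / 2 / 2 ^ k) • x.2 :=
    fun k => rfl
  have hNcard : ∀ k, (N k).card ≤ (5 ^ d) ^ k := by
    intro k
    induction k with
    | zero => simp [N]
    | succ k ih =>
      rw [hNsucc, pow_succ]
      refine Finset.card_image_le.trans ?_
      rw [Finset.card_product]
      exact Nat.mul_le_mul ih hFc
  have hstep : ∀ k, ∀ e ∈ F, ‖(δ / 2 / 2 ^ k) • e‖ ≤ δ / 2 ^ k := by
    intro k e he
    rw [norm_smul, Real.norm_of_nonneg (by positivity)]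
    calc δ / 2 / 2 ^ k * ‖e‖ ≤ δ / 2 / 2 ^ k * 2 := by gcongr; exact hF2 e he
      _ = _ := by ring
  have hNball : ∀ k, ∀ b ∈ N k, ‖b - β₀‖ ≤ 2 * δ - 2 * δ / 2 ^ k := by
    intro k
    induction k with
    | zero => intro b hb; simp [N] at hb; simp [hb]
    | succ k ih =>
      intro b hb
      rw [hNsucc, Finset.mem_image] at hb
      obtain ⟨⟨b', e⟩, hbe, rfl⟩ := hb
      rw [Finset.mem_product] at hbe
      have h1 := ih b' hbe.1
      have h2 := hstep k e hbe.2
      calc _ = ‖(b' - β₀) + (δ / 2 / 2 ^ k) • e‖ := by congr 1; dsimp only; abel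
        _ ≤ _ := norm_add_le _ _
        _ ≤ 2 * δ - 2 * δ / 2 ^ k + δ / 2 ^ k := by linarith
        _ = _ := by rw [pow_succ]; field_simp; ring
  set bad : ℕ → Set Ω := fun k => ⋃ x ∈ N k ×ˢ F,
    {ω | τ * (3 / 4) ^ k ≤ |D ω (x.1 + (δ / 2 / 2 ^ k) • x.2) - D ω x.1|}
  have hbad : ∀ k, P.real (bad k) ≤ A * (1 / 2) ^ (k + 1) := by
    intro k
    refine (measureReal_biUnion_finset_le _ _).trans (le_trans ?_ (hπ k))
    have h1 : ∀ x ∈ N k ×ˢ F,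
        P.real {ω | τ * (3 / 4) ^ k ≤ |D ω (x.1 + (δ / 2 / 2 ^ k) • x.2) - D ω x.1|} ≤ π k := by
      intro x hx
      have hx' := Finset.mem_product.1 hx
      refine htail k _ _ ?_ ?_ ?_
      · have := hNball (k + 1) (x.1 + (δ / 2 / 2 ^ k) • x.2) (by
          rw [hNsucc]; exact Finset.mem_image_of_mem _ hx)
        have h2 : 0 ≤ 2 * δ / 2 ^ (k + 1) := by positivity
        linarith
      · have := hNball k x.1 hx'.1
        have h2 : 0 ≤ 2 * δ / 2 ^ k := by positivity
        linarith
      · rw [add_sub_cancel_left]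
        exact hstep k x.2 hx'.2
    have hπ0 : 0 ≤ π k :=
      measureReal_nonneg.trans (htail k β₀ β₀ (by simpa using hδ.le) (by simpa using hδ.le)
        (by rw [sub_self, norm_zero]; positivity))
    refine (Finset.sum_le_sum h1).trans ?_
    rw [Finset.sum_const, nsmul_eq_mul]
    gcongr
    rw [Finset.card_product, pow_succ]
    exact_mod_cast Nat.mul_le_mul (hNcard k) hFc
  have hsub : {ω | ∃ β, ‖β - β₀‖ ≤ δ ∧ 4 * τ < |D ω β|} ⊆ ⋃ k, bad k := by
    rintro ω ⟨β, hβ, hlt⟩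
    by_contra hω
    simp only [bad, Set.mem_iUnion, not_exists, Set.mem_ofPred_eq, not_le] at hω
    -- approximating sequence in the tree
    have happ : ∀ k, ∃ b ∈ N k, ‖β - b‖ ≤ δ / 2 ^ k ∧
        |D ω b| ≤ τ * ∑ i ∈ Finset.range k, (3 / 4 : ℝ) ^ i := by
      intro k
      induction k with
      | zero => exact ⟨β₀, by simp [N], by simpa using hβ, by simp [h0]⟩
      | succ k ih =>
        obtain ⟨b, hb, h1, h2⟩ := ih
        have hc : 0 < δ / 2 / 2 ^ k := by positivity
        obtain ⟨e, he, h3⟩ := hFnet ((δ / 2 / 2 ^ k)⁻¹ • (β - b)) (by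
          rw [norm_smul, norm_inv, Real.norm_of_nonneg hc.le, ← div_eq_inv_mul, div_le_iff₀ hc]
          refine h1.trans (le_of_eq ?_)
          ring)
        have hmem : (b, e) ∈ N k ×ˢ F := Finset.mem_product.2 ⟨hb, he⟩
        refine ⟨b + (δ / 2 / 2 ^ k) • e, ?_, ?_, ?_⟩
        · rw [hNsucc]
          exact Finset.mem_image_of_mem (fun x : _ × _ => x.1 + (δ / 2 / 2 ^ k) • x.2) hmem
        · have h4 : β - (b + (δ / 2 / 2 ^ k) • e) =
              (δ / 2 / 2 ^ k) • ((δ / 2 / 2 ^ k)⁻¹ • (β - b) - e) := by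
            rw [smul_sub, smul_inv_smul₀ hc.ne']; abel
          rw [h4, norm_smul, Real.norm_of_nonneg hc.le]
          calc _ ≤ δ / 2 / 2 ^ k * 1 := by gcongr
            _ = _ := by rw [pow_succ]; field_simp
        · have h5 := hω k (b, e) hmem
          rw [Finset.sum_range_succ, mul_add]
          have h6 := abs_add_le (D ω (b + (δ / 2 / 2 ^ k) • e) - D ω b) (D ω b)
          rw [sub_add_cancel] at h6
          dsimp only at h5
          linarith
    choose b hb hb1 hb2 using happ
    have hlim : Tendsto b atTop (nhds β) := by
      rw [tendsto_iff_norm_sub_tendsto_zero]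
      have hz : Tendsto (fun k : ℕ => δ / 2 ^ k) atTop (nhds 0) := by
        have := (tendsto_pow_atTop_nhds_zero_of_lt_one (by norm_num : (0 : ℝ) ≤ 1 / 2)
          (by norm_num)).const_mul δ
        simpa [div_eq_mul_inv] using this
      refine squeeze_zero (fun _ => norm_nonneg _) (fun k => ?_) hz
      rw [norm_sub_rev]; exact hb1 k
    have hle : |D ω β| ≤ 4 * τ := by
      refine le_of_tendsto (((hD ω).tendsto β).comp hlim).abs (Eventually.of_forall fun k => ?_)
      refine (hb2 k).trans ?_
      have := mul_le_mul_of_nonneg_left (sum_geometric_three_quarters_le k) hτ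
      linarith
    linarith
  have htot : P (⋃ k, bad k) ≤ ENNReal.ofReal A := by
    refine (measure_iUnion_le _).trans ?_
    have h1 : ∀ k, P (bad k) ≤ ENNReal.ofReal (A * (1 / 2) ^ (k + 1)) := fun k => by
      rw [← ofReal_measureReal (h := measure_ne_top _ _)]
      exact ENNReal.ofReal_le_ofReal (hbad k)
    have h2 : HasSum (fun k : ℕ => A * (1 / 2 : ℝ) ^ (k + 1)) A := by
      have := (hasSum_geometric_two' (A)).congr_fun (fun k => rfl)
      convert! this using 2 with k
      rw [pow_succ, one_div, inv_pow]; field_simp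
    calc _ ≤ ∑' k, ENNReal.ofReal (A * (1 / 2) ^ (k + 1)) := ENNReal.tsum_le_tsum h1
      _ = ENNReal.ofReal A := by
          rw [← ENNReal.ofReal_tsum_of_nonneg (fun k => by positivity) h2.summable, h2.tsum_eq]
  calc _ ≤ P.real (⋃ k, bad k) := measureReal_mono hsub
    _ ≤ A := ENNReal.toReal_le_of_le_ofReal hA htot

/-! ### Minimizers of convex functions -/

/-- A convex function that is larger on a sphere than at the centre has a minimizer, and all its
minimizers lie inside the sphere. -/
theorem isMinOn_of_lt_on_sphere {d : ℕ} {L : EuclideanSpace ℝ (Fin d) → ℝ}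
    (hL : ConvexOn ℝ Set.univ L) (hLc : Continuous L) {β₀ : EuclideanSpace ℝ (Fin d)} {δ : ℝ}
    (hδ : 0 < δ) (hs : ∀ β, ‖β - β₀‖ = δ → L β₀ < L β) :
    (∃ b, IsMinOn L Set.univ b) ∧ ∀ b, IsMinOn L Set.univ b → ‖b - β₀‖ < δ := by
  have hout : ∀ β, δ ≤ ‖β - β₀‖ → L β₀ < L β := by
    intro β hβ
    have hpos : 0 < ‖β - β₀‖ := hδ.trans_le hβ
    set t := δ / ‖β - β₀‖
    have ht0 : 0 < t := by positivity
    have ht1 : t ≤ 1 := (div_le_one hpos).2 hβ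
    have h1 := hL.2 (Set.mem_univ β₀) (Set.mem_univ β) (by linarith : 0 ≤ 1 - t) ht0.le (by ring)
    have h2 : (1 - t) • β₀ + t • β = β₀ + t • (β - β₀) := by
      rw [sub_smul, one_smul, smul_sub]; abel
    have h3 := hs ((1 - t) • β₀ + t • β) (by
      rw [h2, add_sub_cancel_left, norm_smul, Real.norm_of_nonneg ht0.le]
      exact div_mul_cancel₀ _ hpos.ne')
    simp only [smul_eq_mul] at h1
    have h4 : 0 < t * (L β - L β₀) := by linarith
    have := (pos_iff_pos_of_mul_pos h4).1 ht0
    linarith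
  constructor
  · obtain ⟨b, hb, hmin⟩ := (isCompact_closedBall β₀ δ).exists_isMinOn
      (Metric.nonempty_closedBall.2 hδ.le) hLc.continuousOn
    refine ⟨b, fun β _ => ?_⟩
    by_cases hβ : β ∈ Metric.closedBall β₀ δ
    · exact hmin hβ
    · rw [mem_closedBall_iff_norm, not_le] at hβ
      exact (hmin (Metric.mem_closedBall_self hδ.le)).trans (hout β hβ.le).le
  · intro b hb
    by_contra! h
    exact absurd (hout b h) (not_lt.2 (hb (Set.mem_univ β₀)))

end Screening

/-! ### Population and empirical risk on the spline space -/

namespace Screening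

theorem splineFun_sub (q d : ℕ) (ξ : ℕ → ℝ) (β β' : EuclideanSpace ℝ (Fin d)) (x : ℝ) :
    splineFun q d ξ (β - β') x = splineFun q d ξ β x - splineFun q d ξ β' x := by
  simp [splineFun, mul_sub, Finset.sum_sub_distrib]

theorem splineFun_add_smul (q d : ℕ) (ξ : ℕ → ℝ) (β β' : EuclideanSpace ℝ (Fin d)) (s t x : ℝ) :
    splineFun q d ξ (s • β + t • β') x = s * splineFun q d ξ β x + t * splineFun q d ξ β' x := by
  simp only [splineFun, Finset.mul_sum, ← Finset.sum_add_distrib]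
  refine Finset.sum_congr rfl fun k _ => ?_
  simp only [PiLp.add_apply, PiLp.smul_apply, smul_eq_mul]
  ring

theorem CondB.densityBounds {p : ℕ → ℕ} {μ : ∀ n, Measure ((Fin (p n) → ℝ) × ℝ)}
    {a b K₁ K₂ : ℝ} (h : CondB μ a b K₁ K₂) (n : ℕ) (j : Fin (p n)) :
    DensityBounds a b K₁ (max K₁ K₂) ((μ n).fst.map fun x => x j) := by
  obtain ⟨g, -, hg, hmap⟩ := h n j
  have e : (μ n).fst.map (fun x => x j) = (μ n).map (fun z => z.1 j) := by
    rw [Measure.fst, Measure.map_map (measurable_pi_apply j) measurable_fst]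
    rfl
  have := smul_le_withDensity (a := a) (b := b) (K₁ := K₁) (K₂ := max K₁ K₂) (g := g)
    fun x hx => ⟨(hg x hx).1, (hg x hx).2.trans (le_max_right _ _)⟩
  -- --
  rw [e, hmap]
  exact ⟨this.1, this.2⟩

section Risk

variable {p : ℕ} {μ : Measure ((Fin p → ℝ) × ℝ)} [IsProbabilityMeasure μ] {l : ℝ → ℝ → ℝ}
  {a b ρ K₁ K₂ : ℝ} {q d : ℕ} {ξ : ℕ → ℝ} {j : Fin p}

theorem measurable_spline_coord (β : EuclideanSpace ℝ (Fin d)) :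
    Measurable fun x : Fin p → ℝ => splineFun q d ξ β (x j) :=
  (measurable_splineFun q d ξ β).comp (measurable_pi_apply j)

omit [IsProbabilityMeasure μ] in
theorem DensityBounds.ae_coord_mem (hν : DensityBounds a b K₁ K₂ (μ.fst.map fun x => x j)) :
    ∀ᵐ x ∂μ.fst, x j ∈ Set.Ico a b :=
  ae_of_ae_map (measurable_pi_apply j).aemeasurable hν.ae_mem

omit [IsProbabilityMeasure μ] in
theorem ae_abs_spline_coord_le (h : IsQuasiUniformMesh a b ρ (d - q) ξ)
    (hν : DensityBounds a b K₁ K₂ (μ.fst.map fun x => x j)) {β : EuclideanSpace ℝ (Fin d)} {R : ℝ}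
    (hβ : ∀ k, |β k| ≤ R) : ∀ᵐ x ∂μ.fst, |splineFun q d ξ β (x j)| ≤ R := by
  filter_upwards [hν.ae_coord_mem] with x hx using abs_splineFun_le_of_mem h hβ hx

variable (hl : IsConvexLoss l) (hi : ∀ w, Integrable (fun z : (Fin p → ℝ) × ℝ => l w z.2) μ)
  (h : IsQuasiUniformMesh a b ρ (d - q) ξ)
  (hν : DensityBounds a b K₁ K₂ (μ.fst.map fun x => x j))
include hl hi h hν

omit [IsProbabilityMeasure μ] in
theorem integrable_loss_spline (β : EuclideanSpace ℝ (Fin d)) :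
    Integrable (fun z : (Fin p → ℝ) × ℝ => l (splineFun q d ξ β (z.1 j)) z.2) μ :=
  integrable_loss_comp hl hi (measurable_spline_coord β)
    (ae_abs_spline_coord_le h hν (EuclideanSpace.abs_le_norm β))

theorem popRisk_eq (β : EuclideanSpace ℝ (Fin d)) :
    Integrable (fun x => condMean μ (l (splineFun q d ξ β (x j))) x) μ.fst ∧
      popRisk l μ q d ξ j β = ∫ x, condMean μ (l (splineFun q d ξ β (x j))) x ∂μ.fst :=
  integral_loss_comp hl hi (measurable_spline_coord β)
    (ae_abs_spline_coord_le h hν (EuclideanSpace.abs_le_norm β))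

omit [IsProbabilityMeasure μ] in
theorem convexOn_popRisk : ConvexOn ℝ Set.univ (popRisk l μ q d ξ j) := by
  refine ⟨convex_univ, fun β _ β' _ s t hs ht hst => ?_⟩
  have i1 := integrable_loss_spline hl hi h hν β
  have i2 := integrable_loss_spline hl hi h hν β'
  simp only [popRisk, smul_eq_mul]
  rw [← integral_const_mul, ← integral_const_mul, ← integral_add (i1.const_mul s) (i2.const_mul t)]
  refine integral_mono (integrable_loss_spline hl hi h hν _)
    ((i1.const_mul s).add (i2.const_mul t)) fun z => ?_
  have := (hl.convex z.2).2 (Set.mem_univ (splineFun q d ξ β (z.1 j)))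
    (Set.mem_univ (splineFun q d ξ β' (z.1 j))) hs ht hst
  simpa only [splineFun_add_smul, smul_eq_mul] using this

omit hi h hν [IsProbabilityMeasure μ] in
theorem convexOn_empRisk {n : ℕ} (z : Fin n → (Fin p → ℝ) × ℝ) :
    ConvexOn ℝ Set.univ (empRisk l z q d ξ j) := by
  refine ⟨convex_univ, fun β _ β' _ s t hs ht hst => ?_⟩
  simp only [empRisk, smul_eq_mul]
  rw [mul_left_comm s, mul_left_comm t, ← mul_add]
  refine mul_le_mul_of_nonneg_left ?_ (by positivity)
  rw [Finset.mul_sum, Finset.mul_sum, ← Finset.sum_add_distrib]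
  refine Finset.sum_le_sum fun i _ => ?_
  have := (hl.convex (z i).2).2 (Set.mem_univ (splineFun q d ξ β ((z i).1 j)))
    (Set.mem_univ (splineFun q d ξ β' ((z i).1 j))) hs ht hst
  simpa only [splineFun_add_smul, smul_eq_mul] using this

/-- Quadratic growth of the population risk around its minimizer. -/
theorem popRisk_growth {R c : ℝ}
    (hc : ∀ᵐ x ∂μ.fst, StrongConvexOn (Set.Icc (-R) R) c (fun w => condMean μ (l w) x))
    {β β₀ : EuclideanSpace ℝ (Fin d)} (hmin : IsMinOn (popRisk l μ q d ξ j) Set.univ β₀)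
    (hβ : ∀ k, |β k| ≤ R) (hβ₀ : ∀ k, |β₀ k| ≤ R) :
    c / 4 * ∫ t, splineFun q d ξ (β - β₀) t ^ 2 ∂(μ.fst.map fun x => x j) ≤
      popRisk l μ q d ξ j β - popRisk l μ q d ξ j β₀ := by
  have : IsProbabilityMeasure (μ.fst.map fun x => x j) :=
    Measure.isProbabilityMeasure_map (measurable_pi_apply j).aemeasurable
  -- Comparison with the midpoint: strong convexity gains `c / 8` times the squared norm there, and
  -- minimality of `β₀` against `m` doubles it. No differentiation under the integral is needed.
  set m := (1 / 2 : ℝ) • β₀ + (1 / 2 : ℝ) • β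
  have h1 : popRisk l μ q d ξ j β₀ ≤ popRisk l μ q d ξ j m := hmin (Set.mem_univ m)
  obtain ⟨i0, e0⟩ := popRisk_eq hl hi h hν β₀
  obtain ⟨i1, e1⟩ := popRisk_eq hl hi h hν β
  obtain ⟨i2, e2⟩ := popRisk_eq hl hi h hν m
  have hsq : Integrable (fun x : Fin p → ℝ => splineFun q d ξ (β - β₀) (x j) ^ 2) μ.fst :=
    (integrable_splineFun_sq hν h (β - β₀)).comp_measurable (measurable_pi_apply j)
  have e3 : ∫ t, splineFun q d ξ (β - β₀) t ^ 2 ∂(μ.fst.map fun x => x j) =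
      ∫ x, splineFun q d ξ (β - β₀) (x j) ^ 2 ∂μ.fst :=
    integral_map (measurable_pi_apply j).aemeasurable
      ((measurable_splineFun q d ξ _).pow_const 2).aestronglyMeasurable
  have h2 : ∫ x, condMean μ (l (splineFun q d ξ m (x j))) x ∂μ.fst ≤
      ∫ x, (1 / 2 * condMean μ (l (splineFun q d ξ β₀ (x j))) x +
        1 / 2 * condMean μ (l (splineFun q d ξ β (x j))) x -
        c / 8 * splineFun q d ξ (β - β₀) (x j) ^ 2) ∂μ.fst := by
    refine integral_mono_ae i2 (((i0.const_mul _).add (i1.const_mul _)).sub (hsq.const_mul _)) ?_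
    filter_upwards [hc, ae_abs_spline_coord_le h hν hβ, ae_abs_spline_coord_le h hν hβ₀]
      with x h3 h4 h5
    have h6 := h3.2 (abs_le.1 h5) (abs_le.1 h4) (by norm_num : (0 : ℝ) ≤ 1 / 2)
      (by norm_num : (0 : ℝ) ≤ 1 / 2) (by norm_num)
    simp only [smul_eq_mul] at h6
    simp only [m, splineFun_add_smul, splineFun_sub]
    rw [norm_sub_rev, Real.norm_eq_abs, sq_abs] at h6
    linarith
  have i3 : Integrable (fun x => 1 / 2 * condMean μ (l (splineFun q d ξ β₀ (x j))) x +
        1 / 2 * condMean μ (l (splineFun q d ξ β (x j))) x) μ.fst :=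
    (i0.const_mul _).add (i1.const_mul _)
  rw [integral_sub i3 (hsq.const_mul _), integral_add (i0.const_mul _) (i1.const_mul _),
    integral_const_mul, integral_const_mul, integral_const_mul, ← e0, ← e1, ← e2, ← e3] at h2
  linarith

/-- A lower bound for the pointwise difference of the conditional risks gives a lower bound for the
difference of the population risks. -/
theorem integral_nonpos_of_isMinOn {β β' : EuclideanSpace ℝ (Fin d)}
    (hmin : IsMinOn (popRisk l μ q d ξ j) Set.univ β) {v : ℝ → ℝ} (hvm : Measurable v)
    (hvb : ∃ B, ∀ t ∈ Set.Ico a b, |v t| ≤ B)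
    (hv : ∀ᵐ x ∂μ.fst, v (x j) ≤ condMean μ (l (splineFun q d ξ β (x j))) x -
      condMean μ (l (splineFun q d ξ β' (x j))) x) :
    ∫ t, v t ∂(μ.fst.map fun x => x j) ≤ 0 := by
  obtain ⟨B, hB⟩ := hvb
  obtain ⟨i1, e1⟩ := popRisk_eq hl hi h hν β
  obtain ⟨i2, e2⟩ := popRisk_eq hl hi h hν β'
  have h1 : popRisk l μ q d ξ j β ≤ popRisk l μ q d ξ j β' := hmin (Set.mem_univ β')
  have hvi : Integrable (fun x : Fin p → ℝ => v (x j)) μ.fst := by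
    refine Integrable.of_bound (hvm.comp (measurable_pi_apply j)).aestronglyMeasurable B ?_
    filter_upwards [hν.ae_coord_mem] with x hx using hB _ hx
  rw [integral_map (measurable_pi_apply j).aemeasurable hvm.aestronglyMeasurable]
  have h2 := integral_mono_ae hvi (i1.sub i2) hv
  have h3 : ∫ x, ((fun x => condMean μ (l (splineFun q d ξ β (x j))) x) -
      fun x => condMean μ (l (splineFun q d ξ β' (x j))) x) x ∂μ.fst =
      popRisk l μ q d ξ j β - popRisk l μ q d ξ j β' := by
    rw [e1, e2]; exact integral_sub i1 i2
  rw [h3] at h2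
  linarith

end Risk

/-- Minimizers of the population risk are uniformly bounded. -/
theorem exists_minimizer_bound {p : ℕ → ℕ} {μ : ∀ n, Measure ((Fin (p n) → ℝ) × ℝ)}
    [∀ n, IsProbabilityMeasure (μ n)] {l l' : ℝ → ℝ → ℝ} (hl : IsConvexLoss l)
    (hl' : IsGenDeriv l l') (hlμ : IsCondStrictlyConvex μ l) {a b : ℝ} (q : ℕ) (ρ : ℝ)
    {K₁ K₂ : ℝ} (hK₁ : 0 < K₁) (hB : CondB μ a b K₁ K₂)
    {θ : ∀ n, (Fin (p n) → ℝ) → ℝ} {M : ℝ} (hC : CondC μ l θ M) (hG : CondG μ l') :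
    ∃ R : ℝ, 0 ≤ R ∧ ∀ n d ξ, q < d → IsQuasiUniformMesh a b ρ (d - q) ξ → ∀ j : Fin (p n),
      ∀ β, IsMinOn (popRisk l (μ n) q d ξ j) Set.univ β → ∀ k, |β k| ≤ R := by
  obtain ⟨c, K, hc, hK, hgrow⟩ := exists_growth_condMean hlμ hl hl' hG hC
  choose L hL0 hL using fun R : ℝ => exists_lipschitz_condMean hlμ hl hl' hG |R| (abs_nonneg R)
  obtain ⟨R, hR, hbound⟩ := exists_coeff_bound (a := a) (b := b) q ρ K₁ (max K₁ K₂) c K hK₁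
    (lt_max_of_lt_left hK₁) hc hK L hL0
  refine ⟨R, hR, fun n d ξ hd h j β hβ => ?_⟩
  have : IsProbabilityMeasure ((μ n).fst.map fun x => x j) :=
    Measure.isProbabilityMeasure_map (measurable_pi_apply j).aemeasurable
  have hν := hB.densityBounds n j
  refine hbound d ξ _ hd h hν β fun M β' v hM hvb hvm hv =>
    integral_nonpos_of_isMinOn hl (hlμ.integrable n) h hν hβ (β' := β') hvm hvb ?_
  filter_upwards [hν.ae_coord_mem, hgrow n, hL M n] with x hx h1 h2
  -- Off the modified cells the risks agree; on the block the linear growth applies; on the fences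
  -- the conditional risk is Lipschitz on `[-M, M]` and the splines differ by at most `2 * M`.
  rcases hv _ hx with ⟨h3, h4⟩ | ⟨h3, h4⟩ | ⟨h3, h4, h5⟩
  · rw [h3, sub_self]; exact h4
  · rw [h3]; exact h4.trans (h1 _)
  · refine h5.trans ?_
    have h6 := h2 (splineFun q d ξ β' (x j)) (splineFun q d ξ β (x j))
      (h4.trans (le_abs_self M)) (h3.trans (le_abs_self M))
    have h7 : |splineFun q d ξ β (x j) - splineFun q d ξ β' (x j)| ≤ 2 * M :=
      (abs_sub _ _).trans (by linarith)
    have h8 : L M * |splineFun q d ξ β (x j) - splineFun q d ξ β' (x j)| ≤ L M * (2 * M) :=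
      mul_le_mul_of_nonneg_left h7 (hL0 M)
    have h9 := (abs_le.1 h6).1
    linarith

/-- Deviation of the empirical from the population risk, for the difference of two splines. -/
theorem measureReal_risk_increment_le {p n : ℕ} {μ : Measure ((Fin p → ℝ) × ℝ)}
    [IsProbabilityMeasure μ] {Ω : Type*} [MeasurableSpace Ω] {P : Measure Ω}
    [IsProbabilityMeasure P] {Z : Fin n → Ω → (Fin p → ℝ) × ℝ} {l : ℝ → ℝ → ℝ}
    {a b ρ K₁ K₂ : ℝ} {q d : ℕ} {ξ : ℕ → ℝ} {j : Fin p} (hn : 0 < n)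
    (hZ : ∀ i, Measurable (Z i)) (hind : iIndepFun Z P) (hlaw : ∀ i, P.map (Z i) = μ)
    (hl : IsConvexLoss l) (hi : ∀ w, Integrable (fun z : (Fin p → ℝ) × ℝ => l w z.2) μ)
    (h : IsQuasiUniformMesh a b ρ (d - q) ξ)
    (hν : DensityBounds a b K₁ K₂ (μ.fst.map fun x => x j))
    {R c C Cg s t τ : ℝ} {W : ℝ → ℝ} (hW : LipMoment l μ R c C W) (hWm : Measurable W)
    (hW0 : ∀ y, 0 ≤ W y) (hC : 0 ≤ C) (hCg : 0 ≤ Cg)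
    (hgram : ∀ β : EuclideanSpace ℝ (Fin d),
      ∫ x, splineFun q d ξ β x ^ 2 ∂(μ.fst.map fun x => x j) ≤ Cg * ‖β‖ ^ 2 / d)
    {β β' : EuclideanSpace ℝ (Fin d)} (hβ : ∀ k, |β k| ≤ R) (hβ' : ∀ k, |β' k| ≤ R)
    (hs : ‖β - β'‖ ≤ s) (ht : 0 ≤ t) (hts : t * s ≤ c) :
    P.real {ω | τ ≤ |(empRisk l (fun i => Z i ω) q d ξ j β - popRisk l μ q d ξ j β) -
      (empRisk l (fun i => Z i ω) q d ξ j β' - popRisk l μ q d ξ j β')|} ≤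
      2 * Real.exp (-(n * (t * τ - t ^ 2 * (C * (Cg * s ^ 2 / d))))) := by
  set U : (Fin p → ℝ) × ℝ → ℝ := fun z =>
    l (splineFun q d ξ β (z.1 j)) z.2 - l (splineFun q d ξ β' (z.1 j)) z.2
  have hU : Measurable U := (measurable_loss_comp hl (measurable_spline_coord β)).sub
    (measurable_loss_comp hl (measurable_spline_coord β'))
  have i1 := integrable_loss_spline hl hi h hν β
  have i2 := integrable_loss_spline hl hi h hν β'
  have hm : ∫ z, U z ∂μ = popRisk l μ q d ξ j β - popRisk l μ q d ξ j β' := integral_sub i1 i2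
  have hV : ∫ x : Fin p → ℝ, (splineFun q d ξ β (x j) - splineFun q d ξ β' (x j)) ^ 2 ∂μ.fst ≤
      Cg * s ^ 2 / d := by
    have e : ∫ t, splineFun q d ξ (β - β') t ^ 2 ∂(μ.fst.map fun x => x j) =
        ∫ x, splineFun q d ξ (β - β') (x j) ^ 2 ∂μ.fst :=
      integral_map (measurable_pi_apply j).aemeasurable
        ((measurable_splineFun q d ξ _).pow_const 2).aestronglyMeasurable
    simp only [← splineFun_sub]
    rw [← e]
    refine (hgram _).trans ?_
    gcongr
  have hsup : ∀ᵐ x ∂μ.fst, |splineFun q d ξ β (x j) - splineFun q d ξ β' (x j)| ≤ s := by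
    filter_upwards [ae_abs_spline_coord_le h hν (EuclideanSpace.abs_le_norm (β - β'))] with x hx
    rw [← splineFun_sub]
    exact hx.trans hs
  have key := measureReal_abs_mean_ge_le hn hZ hind hlaw hU (m := ∫ z, U z ∂μ) (τ := τ) ht
    (v := t ^ 2 * (C * (Cg * s ^ 2 / d))) (fun u hu => by
      have := mgf_increment_le hl hi hW hWm hW0 hC (measurable_spline_coord β)
        (measurable_spline_coord β') (ae_abs_spline_coord_le h hν hβ)
        (ae_abs_spline_coord_le h hν hβ') hsup hV (t := u) (by rw [hu]; exact hts)
      rwa [← sq_abs u, hu] at this)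
  refine le_trans (le_of_eq ?_) key
  congr 1
  ext ω
  simp only [Set.mem_ofPred_eq]
  rw [hm]
  simp only [U, empRisk, Finset.sum_sub_distrib]
  have : ∀ x y u v : ℝ, (x - u) - (y - v) = x - y - (u - v) := fun x y u v => by ring
  rw [this, mul_sub]

theorem TailBound.mono {p n : ℕ} {Ω : Type*} [MeasurableSpace Ω] {P : Measure Ω}
    {l : ℝ → ℝ → ℝ} {μ : Measure ((Fin p → ℝ) × ℝ)} {Z : Fin n → Ω → (Fin p → ℝ) × ℝ}
    {q d : ℕ} {ξ : ℕ → ℝ} {j : Fin p} {r B B' : ℝ} (h : TailBound P l μ Z q d ξ j r B)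
    (hB : B ≤ B') : TailBound P l μ Z q d ξ j r B' :=
  fun β βhat h1 h2 => (h β βhat h1 h2).trans hB

end Screening

/-! ### The tail bound -/

namespace Screening

/-- The union bound over the tree of the chaining argument. -/
theorem chaining_union_bound {d : ℕ} {y : ℝ} (hd : 1 ≤ d) (hy : 16 * d ≤ y) (k : ℕ) :
    (5 ^ d : ℝ) ^ (k + 1) * (2 * Real.exp (-(y * (3 / 2) ^ k))) ≤
      Real.exp (-(y / 4)) * (1 / 2) ^ (k + 1) := by
  have hd' : (1 : ℝ) ≤ d := by exact_mod_cast hd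
  have e2 : (2 : ℝ) ≤ Real.exp 1 := by linarith [Real.add_one_le_exp (1 : ℝ)]
  have e5 : (5 : ℝ) ≤ Real.exp 2 := by
    have := Real.quadratic_le_exp_of_nonneg (zero_le_two (α := ℝ))
    linarith
  have h5 : (5 ^ d : ℝ) ^ (k + 1) ≤ Real.exp (2 * d * (k + 1)) := by
    calc (5 ^ d : ℝ) ^ (k + 1) ≤ (Real.exp 2 ^ d) ^ (k + 1) := by gcongr
      _ = Real.exp (2 * d * (k + 1)) := by
          rw [← Real.exp_nat_mul, ← Real.exp_nat_mul]; push_cast; congr 1; ring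
  have h2 : (2 : ℝ) * 2 ^ (k + 1) ≤ Real.exp (k + 2) := by
    calc (2 : ℝ) * 2 ^ (k + 1) = 2 ^ (k + 2) := by ring
      _ ≤ Real.exp 1 ^ (k + 2) := by gcongr
      _ = _ := by rw [← Real.exp_nat_mul]; push_cast; ring_nf
  have hb : (k + 1 : ℝ) / 2 ≤ (3 / 2 : ℝ) ^ k := by
    have := one_add_mul_le_pow (by norm_num : (-2 : ℝ) ≤ 1 / 2) k
    rw [show (1 : ℝ) + 1 / 2 = 3 / 2 by norm_num] at this
    linarith
  have hy0 : 0 ≤ y := by linarith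
  have hk : (0 : ℝ) ≤ k := Nat.cast_nonneg k
  rw [one_div, inv_pow, ← div_eq_mul_inv, le_div_iff₀ (by positivity)]
  calc (5 ^ d : ℝ) ^ (k + 1) * (2 * Real.exp (-(y * (3 / 2) ^ k))) * 2 ^ (k + 1)
      = (5 ^ d : ℝ) ^ (k + 1) * (2 * 2 ^ (k + 1)) * Real.exp (-(y * (3 / 2) ^ k)) := by ring
    _ ≤ Real.exp (2 * d * (k + 1)) * Real.exp (k + 2) * Real.exp (-(y * ((k + 1) / 2))) := by
        gcongr
    _ = Real.exp (2 * d * (k + 1) + (k + 2) + -(y * ((k + 1) / 2))) := by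
        rw [← Real.exp_add, ← Real.exp_add]
    _ ≤ _ := by
        -- As `d ≥ 1`, the entropy terms satisfy `2 * d * (k + 1) + (k + 2) ≤ 4 * d * (k + 1) ≤ y *
        -- (k + 1) / 4`, half of the available exponent.
        refine Real.exp_le_exp.2 ?_
        nlinarith

theorem continuous_of_convexOn_univ {d : ℕ} {f : EuclideanSpace ℝ (Fin d) → ℝ}
    (hf : ConvexOn ℝ Set.univ f) : Continuous f :=
  hf.locallyLipschitz.continuous

/-- The tail bound at a fixed sample size. -/
theorem tailBound_of_lipMoment {p n : ℕ} {μ : Measure ((Fin p → ℝ) × ℝ)}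
    [IsProbabilityMeasure μ] {Ω : Type*} [MeasurableSpace Ω] {P : Measure Ω}
    [IsProbabilityMeasure P] {Z : Fin n → Ω → (Fin p → ℝ) × ℝ} {l : ℝ → ℝ → ℝ}
    {a b ρ K₁ K₂ : ℝ} {q d : ℕ} {ξ : ℕ → ℝ} {j : Fin p} (hn : 0 < n)
    (hZ : ∀ i, Measurable (Z i)) (hind : iIndepFun Z P) (hlaw : ∀ i, P.map (Z i) = μ)
    (hl : IsConvexLoss l) (hi : ∀ w, Integrable (fun z : (Fin p → ℝ) × ℝ => l w z.2) μ)
    (hd : 1 ≤ d) (h : IsQuasiUniformMesh a b ρ (d - q) ξ)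
    (hν : DensityBounds a b K₁ K₂ (μ.fst.map fun x => x j))
    {R c C cs cg Cg lam η r B : ℝ} {W : ℝ → ℝ} (hW : LipMoment l μ (R + 2) c C W)
    (hWm : Measurable W) (hW0 : ∀ y, 0 ≤ W y) (hC : 0 ≤ C) (hCg : 0 ≤ Cg)
    (hgramu : ∀ β : EuclideanSpace ℝ (Fin d),
      ∫ x, splineFun q d ξ β x ^ 2 ∂(μ.fst.map fun x => x j) ≤ Cg * ‖β‖ ^ 2 / d)
    (hgraml : ∀ β : EuclideanSpace ℝ (Fin d),
      cg * ‖β‖ ^ 2 / d ≤ ∫ x, splineFun q d ξ β x ^ 2 ∂(μ.fst.map fun x => x j))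
    (hcs : 0 < cs) (hstrong : ∀ᵐ x ∂μ.fst,
      StrongConvexOn (Set.Icc (-(R + 2)) (R + 2)) cs (fun w => condMean μ (l w) x))
    (hbound : ∀ β, IsMinOn (popRisk l μ q d ξ j) Set.univ β → ∀ k, |β k| ≤ R)
    (hlam : 0 < lam) (hlamc : lam ≤ c) (hη : 0 < η) (hηγ : 4 * η < cs / 4 * cg)
    (hlamη : lam * (C * Cg) ≤ η / 2) (hr : 0 < r) (hdr : d * r ≤ 1) (hrB : d * r ≤ B)
    (hbig : 16 * d ≤ n * r * lam * η / 2) :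
    TailBound P l μ Z q d ξ j B (Real.exp (-(n * r * lam * η / 8))) := by
  intro β₀ βhat hβ₀ hβhat
  have hd' : (1 : ℝ) ≤ d := by exact_mod_cast hd
  have hd0 : (0 : ℝ) < d := by linarith
  set δ := √(d * r)
  have hδ2 : δ ^ 2 = d * r := Real.sq_sqrt (by positivity)
  have hδ : 0 < δ := Real.sqrt_pos.2 (by positivity)
  have hδ1 : δ ≤ 1 := Real.sqrt_le_one.2 hdr
  -- The chaining tree stays in the ball of radius `2 * δ ≤ 2`, whence the range `R + 2` in the
  -- hypotheses.
  have hRβ : ∀ β : EuclideanSpace ℝ (Fin d), ‖β - β₀‖ ≤ 2 * δ → ∀ k, |β k| ≤ R + 2 := by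
    intro β hβ k
    have h1 := EuclideanSpace.abs_le_norm (β - β₀) k
    have h2 := hbound β₀ hβ₀ k
    have h3 := abs_add_le ((β - β₀) k) (β₀ k)
    rw [PiLp.sub_apply, sub_add_cancel, ← PiLp.sub_apply] at h3
    linarith
  set D : Ω → EuclideanSpace ℝ (Fin d) → ℝ := fun ω β =>
    (empRisk l (fun i => Z i ω) q d ξ j β - popRisk l μ q d ξ j β) -
      (empRisk l (fun i => Z i ω) q d ξ j β₀ - popRisk l μ q d ξ j β₀)
  have hemp : ∀ ω, ConvexOn ℝ Set.univ (empRisk l (fun i => Z i ω) q d ξ j) := fun ω =>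
    convexOn_empRisk hl _
  have hDc : ∀ ω, Continuous (D ω) := fun ω =>
    ((continuous_of_convexOn_univ (hemp ω)).sub
      (continuous_of_convexOn_univ (convexOn_popRisk hl hi h hν))).sub continuous_const
  -- At level `k` the parameter is `t = lam * 2 ^ k`, inversely proportional to the link length. The
  -- variance term `t ^ 2 * V` is then the same at all levels, while `t` times the threshold grows
  -- like `(2 * 3 / 4) ^ k` and beats the number of links.
  have hchain := measureReal_chaining (P := P) D hDc β₀ (fun ω => sub_self _) hδ
    (τ := η * r) (A := Real.exp (-(n * r * lam * η / 2 / 4))) (by positivity)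
    (Real.exp_pos _).le (fun k => 2 * Real.exp (-(n * r * lam * η / 2 * (3 / 2) ^ k)))
    (fun k b b' hb hb' hbb' => by
      have h1 := measureReal_risk_increment_le hn hZ hind hlaw hl hi h hν hW hWm hW0 hC hCg hgramu
        (τ := η * r * (3 / 4) ^ k) (hRβ b hb) (hRβ b' hb') hbb' (t := lam * 2 ^ k) (by positivity)
        (by
          calc lam * 2 ^ k * (δ / 2 ^ k) = lam * δ := by field_simp
            _ ≤ lam * 1 := by gcongr
            _ ≤ c := by linarith)
      have e : ∀ ω, D ω b - D ω b' =
          (empRisk l (fun i => Z i ω) q d ξ j b - popRisk l μ q d ξ j b) -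
          (empRisk l (fun i => Z i ω) q d ξ j b' - popRisk l μ q d ξ j b') := fun ω => by
        simp only [D]; ring
      simp only [e]
      refine h1.trans ?_
      have e1 : lam * 2 ^ k * (η * r * (3 / 4) ^ k) = r * lam * η * (3 / 2 : ℝ) ^ k := by
        rw [show (3 / 2 : ℝ) = 2 * (3 / 4) by norm_num, mul_pow]; ring
      have e2 : (lam * 2 ^ k) ^ 2 * (C * (Cg * (δ / 2 ^ k) ^ 2 / d)) =
          r * lam * (lam * (C * Cg)) := by
        rw [div_pow, hδ2]; field_simp
      rw [e1, e2]
      have h2 : (1 : ℝ) ≤ (3 / 2) ^ k := one_le_pow₀ (by norm_num)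
      have h3 : r * lam * (lam * (C * Cg)) ≤ r * lam * (η / 2 * (3 / 2) ^ k) := by
        refine mul_le_mul_of_nonneg_left (hlamη.trans ?_) (by positivity)
        nlinarith
      have h4 : (n : ℝ) * (r * lam * η / 2 * (3 / 2) ^ k) ≤
          n * (r * lam * η * (3 / 2) ^ k - r * lam * (lam * (C * Cg))) := by
        gcongr
        linarith
      have h5 : n * r * lam * η / 2 * (3 / 2 : ℝ) ^ k = n * (r * lam * η / 2 * (3 / 2) ^ k) := by
        ring
      rw [h5]
      gcongr)
    (chaining_union_bound hd hbig)
  have hA : n * r * lam * η / 2 / 4 = n * r * lam * η / 8 := by ring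
  rw [hA] at hchain
  set S₁ := {ω | ∃ β, ‖β - β₀‖ ≤ δ ∧ 4 * (η * r) < |D ω β|}
  set S₂ := {ω | ¬ ((∃ b, IsMinOn (empRisk l (fun i => Z i ω) q d ξ j) Set.univ b) →
      IsMinOn (empRisk l (fun i => Z i ω) q d ξ j) Set.univ (βhat ω))}
  have hS₂ : P.real S₂ = 0 := by
    rw [measureReal_def, show P S₂ = 0 from ae_iff.1 hβhat, ENNReal.toReal_zero]
  have hsub : {ω | B ≤ ‖βhat ω - β₀‖ ^ 2} ⊆ S₁ ∪ S₂ := by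
    intro ω hω
    by_contra hcon
    rw [Set.mem_union, not_or] at hcon
    obtain ⟨hc1, hc2⟩ := hcon
    simp only [S₁, Set.mem_ofPred_eq, not_exists, not_and, not_lt] at hc1
    simp only [S₂, Set.mem_ofPred_eq, not_not] at hc2
    have hsphere : ∀ β, ‖β - β₀‖ = δ → empRisk l (fun i => Z i ω) q d ξ j β₀ <
        empRisk l (fun i => Z i ω) q d ξ j β := by
      intro β hβ
      have h1 := popRisk_growth hl hi h hν hstrong hβ₀ (hRβ β (by linarith))
        (hRβ β₀ (by simpa using hδ.le))
      have h2 := hgraml (β - β₀)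
      rw [hβ, hδ2, show cg * (d * r) / d = cg * r by field_simp] at h2
      have h3 := (abs_le.1 (hc1 β hβ.le)).1
      have h4 : cs / 4 * (cg * r) ≤
          cs / 4 * ∫ x, splineFun q d ξ (β - β₀) x ^ 2 ∂(μ.fst.map fun x => x j) := by gcongr
      have h5 : 4 * η * r < cs / 4 * cg * r := by gcongr
      simp only [D] at h3
      linarith
    obtain ⟨hex, hin⟩ := isMinOn_of_lt_on_sphere (hemp ω) (continuous_of_convexOn_univ (hemp ω)) hδ
      hsphere
    have h1 := hin _ (hc2 hex)
    have h2 : ‖βhat ω - β₀‖ ^ 2 < δ ^ 2 := by gcongr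
    have h3 : B ≤ ‖βhat ω - β₀‖ ^ 2 := hω
    linarith
  calc P.real {ω | B ≤ ‖βhat ω - β₀‖ ^ 2} ≤ P.real (S₁ ∪ S₂) := measureReal_mono hsub
    _ ≤ P.real S₁ + P.real S₂ := measureReal_union_le _ _
    _ ≤ _ := by rw [hS₂, add_zero]; exact hchain

/-- The tail bound under condition H3 (which is implied by H1, and by G and H2). -/
theorem exists_tailBound (p : ℕ → ℕ) (μ : ∀ n, Measure ((Fin (p n) → ℝ) × ℝ))
    [∀ n, IsProbabilityMeasure (μ n)] {Ω : ℕ → Type*} [∀ n, MeasurableSpace (Ω n)]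
    (P : ∀ n, Measure (Ω n)) [∀ n, IsProbabilityMeasure (P n)]
    (Z : ∀ n, Fin n → Ω n → (Fin (p n) → ℝ) × ℝ) (hZ : IsSample μ P Z)
    (l l' : ℝ → ℝ → ℝ) (hl : IsConvexLoss l) (hl' : IsGenDeriv l l')
    (hlμ : IsCondStrictlyConvex μ l) (a b : ℝ) (hab : a < b) (q : ℕ) (d : ℕ → ℕ)
    (hd : ∀ n, q < d n) (ρ : ℝ) (ξ : ℕ → ℕ → ℝ)
    (hξ : ∀ n, IsQuasiUniformMesh a b ρ (d n - q) (ξ n)) (K₁ K₂ : ℝ) (hK₁ : 0 < K₁)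
    (hB : CondB μ a b K₁ K₂) (θ : ∀ n, (Fin (p n) → ℝ) → ℝ) (M : ℝ) (hC : CondC μ l θ M)
    (κ : ℝ) (hF : CondF d κ) (hG : CondG μ l') (c₃ : ℝ) (hc₃ : 0 < c₃) (hH3 : CondH3 μ l')
    (hdo : (fun m : ℕ => (d m : ℝ)) =o[atTop] (fun m : ℕ => (m : ℝ) ^ (1 - 2 * κ))) :
    ∃ c₄ : ℝ, 0 < c₄ ∧ ∀ᶠ n : ℕ in atTop, ∀ j : Fin (p n),
      TailBound (P n) l (μ n) (Z n) q (d n) (ξ n) j (c₃ * (d n : ℝ) * (n : ℝ) ^ (-(2 * κ)))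
        (Real.exp (-(c₄ * (n : ℝ) ^ (1 - 2 * κ) * (d n : ℝ)⁻¹))) := by
  obtain ⟨R, hR, hbound⟩ := exists_minimizer_bound hl hl' hlμ q ρ hK₁ hB hC hG
  obtain ⟨cs, hcs, hstrong⟩ := exists_strongConvexOn_condMean hlμ (R + 2)
  obtain ⟨c, C, W, hc, hC0, hWm, hW0, hW⟩ := exists_lipMoment hl hl' hH3 (R + 2) (by linarith)
  obtain ⟨cg, hcg, hgraml⟩ := exists_gram_lower hab q ρ K₁ (max K₁ K₂) hK₁
  obtain ⟨Cg, hCg, hgramu⟩ := exists_gram_upper hab q ρ K₁ (max K₁ K₂) (lt_max_of_lt_left hK₁)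
  obtain ⟨CF, hCF, hCFle⟩ := hF.2.exists_pos
  rw [isBigOWith_iff] at hCFle
  -- The fluctuation `4 * η * r` is then half of the population gain `cs / 4 * cg * r` on the
  -- sphere.
  set η := cs * cg / 32
  have hη : 0 < η := by positivity
  -- Small enough for the exponential moment to exist, and for the quadratic term to take at most
  -- half of the linear one.
  set lam := min c (η / (2 * (C * Cg + 1)))
  have hlam : 0 < lam := lt_min hc (by positivity)
  have hlamη : lam * (C * Cg) ≤ η / 2 := by
    have h1 : lam ≤ η / (2 * (C * Cg + 1)) := min_le_right _ _
    have h2 : 0 ≤ C * Cg := by positivity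
    rw [le_div_iff₀ (by positivity)] at h1
    nlinarith
  -- Lowering the constant only strengthens the claim; by `d = O(n ^ (2κ))` it makes the radius `δ`
  -- at most one.
  set c₃' := min c₃ CF⁻¹
  have hc₃' : 0 < c₃' := lt_min hc₃ (inv_pos.2 hCF)
  have hc₆ : 0 < c₃' * lam * η := by positivity
  refine ⟨c₃' * lam * η / 8, by positivity, ?_⟩
  filter_upwards [hCFle, (isLittleO_iff.1 hdo) (show 0 < c₃' * lam * η / 32 by positivity),
    eventually_gt_atTop 0] with n h1 h2 hn j
  have hn' : (0 : ℝ) < n := by exact_mod_cast hn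
  have hd1 : 1 ≤ d n := by have := hd n; omega
  have hd1' : (1 : ℝ) ≤ d n := by exact_mod_cast hd1
  set u := (n : ℝ) ^ (-(2 * κ))
  have hu : 0 < u := Real.rpow_pos_of_pos hn' _
  have hx : (n : ℝ) ^ (1 - 2 * κ) = n * u := by
    rw [sub_eq_add_neg, Real.rpow_add hn', Real.rpow_one]
  have hu' : (n : ℝ) ^ (2 * κ) * u = 1 := by
    rw [← Real.rpow_add hn', add_neg_cancel, Real.rpow_zero]
  rw [Real.norm_of_nonneg (Nat.cast_nonneg _), Real.norm_of_nonneg (by positivity)] at h1 h2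
  rw [hx] at h2 ⊢
  have : IsProbabilityMeasure ((μ n).fst.map fun x => x j) :=
    Measure.isProbabilityMeasure_map (measurable_pi_apply j).aemeasurable
  have hν := hB.densityBounds n j
  have hdr : d n * (c₃' * u) ≤ 1 := by
    calc d n * (c₃' * u) ≤ CF * (n : ℝ) ^ (2 * κ) * (CF⁻¹ * u) := by
          gcongr
          exact min_le_right _ _
      _ = (CF * CF⁻¹) * ((n : ℝ) ^ (2 * κ) * u) := by ring
      _ = 1 := by rw [mul_inv_cancel₀ hCF.ne', hu', one_mul]
  have hdrB : d n * (c₃' * u) ≤ c₃ * d n * u := by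
    calc d n * (c₃' * u) = c₃' * d n * u := by ring
      _ ≤ c₃ * d n * u := by gcongr; exact min_le_left _ _
  have key := tailBound_of_lipMoment hn (hZ n).1 (hZ n).2.1 (hZ n).2.2 hl (hlμ.integrable n) hd1
    (hξ n) hν (hW n) hWm hW0 hC0 hCg.le (hgramu (d n) (ξ n) _ (hd n) (hξ n) hν)
    (hgraml (d n) (ξ n) _ (hd n) (hξ n) hν) hcs (hstrong n)
    (fun β hβ => hbound n (d n) (ξ n) (hd n) (hξ n) j β hβ) hlam (min_le_left _ _) hη
    (by simp only [η]; nlinarith [mul_pos hcs hcg]) hlamη (mul_pos hc₃' hu) hdr hdrB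
    (by linarith)
  refine key.mono (Real.exp_le_exp.2 (neg_le_neg ?_))
  have h3 : (d n : ℝ)⁻¹ ≤ 1 := inv_le_one_of_one_le₀ hd1'
  calc c₃' * lam * η / 8 * (n * u) * (d n : ℝ)⁻¹ ≤ c₃' * lam * η / 8 * (n * u) * 1 := by gcongr
    _ = n * (c₃' * u) * lam * η / 8 := by ring

theorem isLittleO_rpow_of_le {d : ℕ → ℕ} {s t : ℝ} (hst : s ≤ t)
    (h : (fun m : ℕ => (d m : ℝ)) =o[atTop] (fun m : ℕ => (m : ℝ) ^ s)) :
    (fun m : ℕ => (d m : ℝ)) =o[atTop] (fun m : ℕ => (m : ℝ) ^ t) := by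
  refine h.trans_isBigO (IsBigO.of_bound 1 ?_)
  filter_upwards [eventually_ge_atTop 1] with m hm
  have hm' : (1 : ℝ) ≤ m := by exact_mod_cast hm
  rw [one_mul, Real.norm_of_nonneg (by positivity), Real.norm_of_nonneg (by positivity)]
  exact Real.rpow_le_rpow_of_exponent_le hm' hst

end Screening

theorem theorem1
    -- the laws of `(X, Y)`, where `X` has dimension `p n` at sample size `n`
    (p : ℕ → ℕ) (μ : ∀ n, Measure ((Fin (p n) → ℝ) × ℝ)) [∀ n, IsProbabilityMeasure (μ n)]
    -- the samples
    {Ω : ℕ → Type*} [∀ n, MeasurableSpace (Ω n)]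
    (P : ∀ n, Measure (Ω n)) [∀ n, IsProbabilityMeasure (P n)]
    (Z : ∀ n, Fin n → Ω n → (Fin (p n) → ℝ) × ℝ) (hZ : Screening.IsSample μ P Z)
    -- the loss, and its generalized derivative
    (l l' : ℝ → ℝ → ℝ) (hl : Screening.IsConvexLoss l) (hl' : Screening.IsGenDeriv l l')
    (hlμ : Screening.IsCondStrictlyConvex μ l)
    -- the B-spline basis: degree `q`, dimension `d n`, breakpoints `ξ n`
    (a b : ℝ) (hab : a < b) (q : ℕ) (hq : 1 ≤ q) (d : ℕ → ℕ) (hd : ∀ n, q < d n)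
    (ρ : ℝ) (ξ : ℕ → ℕ → ℝ) (hξ : ∀ n, Screening.IsQuasiUniformMesh a b ρ (d n - q) (ξ n))
    -- the regularity conditions
    (K₁ K₂ : ℝ) (hK₁ : 0 < K₁) (hB : Screening.CondB μ a b K₁ K₂)
    (θ : ∀ n, (Fin (p n) → ℝ) → ℝ) (M : ℝ) (hC : Screening.CondC μ l θ M)
    (κ : ℝ) (hκ : 0 < κ) (hκ' : κ < 1 / 2) (hF : Screening.CondF d κ)
    (hG : Screening.CondG μ l')
    (c₃ : ℝ) (hc₃ : 0 < c₃) :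
    ∃ c₄ c₅ : ℝ, 0 < c₄ ∧ 0 < c₅ ∧ ∀ᶠ n : ℕ in atTop,
      (Screening.CondH1 μ l' →
        (fun m : ℕ => (d m : ℝ)) =o[atTop] (fun m : ℕ => (m : ℝ) ^ (1 - 2 * κ)) →
        ∀ j : Fin (p n),
          Screening.TailBound (P n) l (μ n) (Z n) q (d n) (ξ n) j
            (c₃ * (d n : ℝ) * (n : ℝ) ^ (-(2 * κ)))
            (Real.exp (-(c₄ * (n : ℝ) ^ (1 - 2 * κ) * (d n : ℝ)⁻¹)))) ∧
      (Screening.CondH2 μ l' →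
        (fun m : ℕ => (d m : ℝ)) =o[atTop] (fun m : ℕ => (m : ℝ) ^ ((1 - 2 * κ) / 2)) →
        ∀ j : Fin (p n),
          Screening.TailBound (P n) l (μ n) (Z n) q (d n) (ξ n) j
            (c₃ * (d n : ℝ) * (n : ℝ) ^ (-(2 * κ)))
            (Real.exp (-(c₄ * (n : ℝ) ^ (1 - 2 * κ) * (d n : ℝ)⁻¹)) +
              Real.exp (-(c₅ * (n : ℝ) ^ (1 - 2 * κ) * ((d n : ℝ) ^ 2)⁻¹)))) ∧
      (Screening.CondH3 μ l' →
        (fun m : ℕ => (d m : ℝ)) =o[atTop] (fun m : ℕ => (m : ℝ) ^ ((1 - 2 * κ) / 3)) →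
        ∀ j : Fin (p n),
          Screening.TailBound (P n) l (μ n) (Z n) q (d n) (ξ n) j
            (c₃ * (d n : ℝ) * (n : ℝ) ^ (-(2 * κ)))
            (Real.exp (-(c₄ * (n : ℝ) ^ (1 - 2 * κ) * (d n : ℝ)⁻¹)) +
              2 * Real.exp (-(c₅ * (n : ℝ) ^ (1 / 2 - κ) * (d n : ℝ) ^ (-(3 / 2) : ℝ))))) := by
  classical
  have main : ∀ (H : Prop) (e : ℝ), e ≤ 1 - 2 * κ → (H → Screening.CondH3 μ l') →
      ∃ c₄ : ℝ, 0 < c₄ ∧ ∀ᶠ n : ℕ in atTop, H →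
        (fun m : ℕ => (d m : ℝ)) =o[atTop] (fun m : ℕ => (m : ℝ) ^ e) → ∀ j : Fin (p n),
          Screening.TailBound (P n) l (μ n) (Z n) q (d n) (ξ n) j
            (c₃ * (d n : ℝ) * (n : ℝ) ^ (-(2 * κ)))
            (Real.exp (-(c₄ * (n : ℝ) ^ (1 - 2 * κ) * (d n : ℝ)⁻¹))) := by
    intro H e he hH
    -- The constants are chosen before it is known which conditions hold. When the premises of a
    -- case fail, any constant will do.
    by_cases h : H ∧ (fun m : ℕ => (d m : ℝ)) =o[atTop] (fun m : ℕ => (m : ℝ) ^ e)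
    · obtain ⟨c₄, hc₄, hev⟩ := Screening.exists_tailBound p μ P Z hZ l l' hl hl' hlμ a b hab q d hd
        ρ ξ hξ K₁ K₂ hK₁ hB θ M hC κ hF hG c₃ hc₃ (hH h.1) (Screening.isLittleO_rpow_of_le he h.2)
      exact ⟨c₄, hc₄, hev.mono fun n hn _ _ => hn⟩
    · exact ⟨1, one_pos, Eventually.of_forall fun n h1 h2 => absurd ⟨h1, h2⟩ h⟩
  have mono : ∀ {c c' : ℝ} (n : ℕ), c ≤ c' →
      Real.exp (-(c' * (n : ℝ) ^ (1 - 2 * κ) * (d n : ℝ)⁻¹)) ≤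
        Real.exp (-(c * (n : ℝ) ^ (1 - 2 * κ) * (d n : ℝ)⁻¹)) := by
    intro c c' n hcc
    refine Real.exp_le_exp.2 (neg_le_neg ?_)
    gcongr
  obtain ⟨u₁, hu₁, h₁⟩ := main (Screening.CondH1 μ l') (1 - 2 * κ) le_rfl fun h => h.condH3 hl'
  obtain ⟨u₂, hu₂, h₂⟩ := main (Screening.CondH2 μ l') ((1 - 2 * κ) / 2) (by linarith)
    fun h => h.condH3 hG
  obtain ⟨u₃, hu₃, h₃⟩ := main (Screening.CondH3 μ l') ((1 - 2 * κ) / 3) (by linarith) id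
  -- The first exponential already bounds the probability in all three cases, so the value of `c₅`
  -- is immaterial.
  refine ⟨min u₁ (min u₂ u₃), 1, lt_min hu₁ (lt_min hu₂ hu₃), one_pos, ?_⟩
  filter_upwards [h₁, h₂, h₃] with n h₁ h₂ h₃
  refine ⟨fun hH ho j => (h₁ hH ho j).mono (mono n (min_le_left _ _)),
    fun hH ho j => (h₂ hH ho j).mono ?_, fun hH ho j => (h₃ hH ho j).mono ?_⟩
  · exact (mono n ((min_le_right _ _).trans (min_le_left _ _))).trans
      (le_add_of_nonneg_right (Real.exp_pos _).le)
  · exact (mono n ((min_le_right _ _).trans (min_le_right _ _))).trans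
      (le_add_of_nonneg_right (by positivity))
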